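/- **Theorem 2.** Let $\lambda$ be a $\sigma$-finite measure on a sample space $\mathcal X\subseteq\mathbb R$, let $h\ge 0$ be a measurable density with $\nu:=h\,\lambda\neq 0$, and consider the natural exponential family with densities (with respect to $\lambda$) $$p_\theta(x)=h(x)\,e^{\theta x-A(\theta)},\qquad A(\theta)=\ln\int e^{\theta x}\,d\nu(x),\qquad \theta\in\Theta ,$$ where the parameter set $\Theta\subseteq\{\theta: A(\theta)<\infty\}$ has non-empty interior; if $\nu$ has a point mass at the infimum (supremum) of its support, $\Theta$ may also contain the value $\theta=-\infty$ ($\theta=+\infty$), which stands for the distribution degenerate at that point. For $x^n=(x_1,\dots,x_n)$ put $p_\theta(x^n)=\prod_{i\le n}p_\theta(x_i)$. Let $M$ be the set of (finite) means of the members of the family, and for $\mu\in M$ let $V(\mu)$ be the variance of the member with mean $\mu$. Let the *convex core* be the interval from $x_0=\inf\operatorname{supp}\nu$ to $x_1=\sup\operatorname{supp}\nu$, where a finite end point is included if and only if $\nu$ has a point mass there. The mean-value parameter space is *maximal* if $M$ equals the convex core. Let $I$ be the Fisher information and let $m$ be the smallest $n$ such that for all $x^n\in\mathcal X^n$ both $\int_\Theta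 p_\theta(x^n)I(\theta)^{1/2}\,d\theta<\infty$ and $\int_{\mathcal X^{k-n}}\sup_{\theta\in\Theta}p_\theta(x^n,y^{k-n})\,d\lambda^{k-n}(y^{k-n})<\infty$ for all $k\ge n$. The sequential normalized maximum likelihood (SNML) strategy conditioned on $x^m$ assigns to $x_{m+1}^n=(x_{m+1},\dots,x_n)$, $n>m$, the density $$p_{snml}(x_{m+1}^n\mid x^m)=\prod_{t=m+1}^{n}\frac{\sup_{\theta\in\Theta}p_\theta(x^t)}{\int_{\mathcal X}\sup_{\theta\in\Theta}p_\theta(x^{t-1},y)\,d\lambda(y)} .$$ The family is *SNML exchangeable* if $m$ exists and, for all $n>m$ and all $x^n\in\mathcal X^n$, the value $p_{snml}(x_{m+1}^n\mid x^m)$ is invariant under all permutations of $x^n$ that leave $x^m$ unchanged. Suppose that the family has maximal mean-value parameter space and is SNML exchangeable. Then there are constants $k,\ell\in\mathbb R$ such that either $V(\mu)=(k\mu+\ell)^2$ for all $\mu\in M$, or $k\mu+\ell\ge 0$ and $V(\mu)=(k\mu+\ell)^{3/2}$ for all $\mu\in M$. -/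

import Mathlib

open MeasureTheory ProbabilityTheory
open scoped ENNReal NNReal

noncomputable section

namespace SNML

/-! ### Reference measures: convex core and extended natural parameter space -/

/-- Infimum of the support of a measure on `ℝ`, as an extended real. -/
def lowerEnd (ν : Measure ℝ) : EReal := sInf ((fun x : ℝ => (x : EReal)) '' ν.support)

/-- Supremum of the support of a measure on `ℝ`, as an extended real. -/
def upperEnd (ν : Measure ℝ) : EReal := sSup ((fun x : ℝ => (x : EReal)) '' ν.support)

/-- The convex core: the interval between the two ends of the support, where an end point
belongs to it if and only if it carries a point mass. -/
def convexCore (ν : Measure ℝ) : Set ℝ :=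
  {x | (lowerEnd ν < (x : EReal) ∨ ((x : EReal) = lowerEnd ν ∧ ν {x} ≠ 0)) ∧
       ((x : EReal) < upperEnd ν ∨ ((x : EReal) = upperEnd ν ∧ ν {x} ≠ 0))}

/-- Extended natural parameter space: the real `θ` with `∫ exp (θ x) dν < ∞`, together with
`-∞` (resp. `+∞`) if `ν` has a leftmost (resp. rightmost) point that carries a point mass; these
infinite parameter values stand for the distribution degenerate at that point. -/
def extNaturalSpace (ν : Measure ℝ) : Set EReal :=
  {θ | (∃ t : ℝ, θ = (t : EReal) ∧ t ∈ integrableExpSet id ν) ∨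
       (θ = ⊥ ∧ ∃ x : ℝ, (x : EReal) = lowerEnd ν ∧ ν {x} ≠ 0) ∨
       (θ = ⊤ ∧ ∃ x : ℝ, (x : EReal) = upperEnd ν ∧ ν {x} ≠ 0)}

open scoped Classical in
/-- Density of the member with parameter `θ` relative to the reference measure `ν`:
`exp (θ x - A θ)` with `A θ = log ∫ exp (θ x) dν` for real `θ`, and the density of the point mass
at the leftmost (rightmost) point of `ν` for `θ = -∞` (`θ = +∞`). -/
def relDensity (ν : Measure ℝ) (θ : EReal) (x : ℝ) : ℝ≥0∞ :=
  if θ = ⊥ then (if (x : EReal) = lowerEnd ν then (ν {x})⁻¹ else 0)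
  else if θ = ⊤ then (if (x : EReal) = upperEnd ν then (ν {x})⁻¹ else 0)
  else ENNReal.ofReal (Real.exp (θ.toReal * x - cgf id ν θ.toReal))

/-! ### Natural exponential families -/

/-- A one-dimensional natural exponential family `p_θ(x) = h(x) exp (θ x - A θ)`, `θ ∈ Θ`, of
densities with respect to an underlying measure `lam` on a sample space `X ⊆ ℝ`. -/
structure NaturalExpFamily where
  /-- the sample space -/
  X : Set ℝ
  /-- the underlying measure -/
  lam : Measure ℝ
  /-- the density of the reference measure -/
  h : ℝ → ℝ≥0
  /-- the parameter set -/
  Θ : Set EReal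
  measurableSet_X : MeasurableSet X
  lam_compl_X : lam Xᶜ = 0
  sigmaFinite_lam : SigmaFinite lam
  measurable_h : Measurable h
  ref_ne_zero : lam.withDensity (fun x => (h x : ℝ≥0∞)) ≠ 0
  subset_extNaturalSpace : Θ ⊆ extNaturalSpace (lam.withDensity (fun x => (h x : ℝ≥0∞)))
  interior_nonempty : (interior {t : ℝ | (t : EReal) ∈ Θ}).Nonempty

namespace NaturalExpFamily

variable (F : NaturalExpFamily)

/-- The reference measure `dh = h dλ`. -/
def ref : Measure ℝ := F.lam.withDensity (fun x => (F.h x : ℝ≥0∞))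

/-- The density `p_θ(x)` with respect to the underlying measure. -/
def density (θ : EReal) (x : ℝ) : ℝ≥0∞ := (F.h x : ℝ≥0∞) * relDensity F.ref θ x

/-- The distribution with density `p_θ`. -/
def law (θ : EReal) : Measure ℝ := F.lam.withDensity (F.density θ)

/-- `p_θ` has the finite mean `μ`. -/
def HasMean (θ : EReal) (μ : ℝ) : Prop := Integrable id (F.law θ) ∧ ∫ x, x ∂(F.law θ) = μ

/-- The mean-value parameter space `M`. -/
def meanSpace : Set ℝ := {μ | ∃ θ ∈ F.Θ, F.HasMean θ μ}

open scoped Classical in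
/-- The variance function: `V μ` is the variance of the member of the family with mean `μ`. -/
def varianceFunction (μ : ℝ) : ℝ :=
  if hμ : ∃ θ ∈ F.Θ, F.HasMean θ μ then variance id (F.law hμ.choose) else 0

/-- The mean-value parameter space equals the convex core. -/
def HasMaximalMeanSpace : Prop := F.meanSpace = convexCore F.ref

/-! ### Prediction strategies

A data sequence is a function `x : ℕ → ℝ`, and `x^n` consists of its first `n` entries
`x 0, …, x (n - 1)`. -/

/-- `p_θ(x^n)`. -/
def lik (θ : EReal) (n : ℕ) (x : ℕ → ℝ) : ℝ≥0∞ := ∏ i ∈ Finset.range n, F.density θ (x i)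

/-- `sup_θ p_θ(x^n)`. -/
def maxLik (n : ℕ) (x : ℕ → ℝ) : ℝ≥0∞ := ⨆ θ ∈ F.Θ, F.lik θ n x

/-- The conditional Shtarkov integral `∫ sup_θ p_θ(x^n, y^j) dλ^j(y^j)`. -/
def shtarkov (n j : ℕ) (x : ℕ → ℝ) : ℝ≥0∞ :=
  ∫⁻ y : Fin j → ℝ, ⨆ θ ∈ F.Θ, F.lik θ n x * ∏ i, F.density θ (y i)
    ∂(Measure.pi (fun _ => F.lam))

/-- The CNML density with horizon `n + j` of the last `j` outcomes given `x^n`. -/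
def cnml (n j : ℕ) (x : ℕ → ℝ) : ℝ≥0∞ := F.maxLik (n + j) x / F.shtarkov n j x

/-- The SNML density of the next outcome given the first `t` ones: the CNML density whose
horizon is the next outcome. -/
def snml (t : ℕ) (x : ℕ → ℝ) : ℝ≥0∞ := F.cnml t 1 x

/-- The joint SNML density of `x_{m+1}, …, x_n` given `x^m`. -/
def snmlJoint (m n : ℕ) (x : ℕ → ℝ) : ℝ≥0∞ := ∏ t ∈ Finset.Ico m n, F.snml t x

/-- The Fisher information `I(θ)`, the second moment of the score, at a real parameter. -/
def fisher (t : ℝ) : ℝ≥0∞ :=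
  ∫⁻ x, ENNReal.ofReal ((deriv (fun s : ℝ => s * x - cgf id F.ref s) t) ^ 2) ∂(F.law (t : EReal))

/-- `∫ p_θ(x^n) I(θ)^{1/2} dθ`. -/
def jeffreys (n : ℕ) (x : ℕ → ℝ) : ℝ≥0∞ :=
  ∫⁻ t in {t : ℝ | (t : EReal) ∈ F.Θ}, F.lik (t : EReal) n x * F.fisher t ^ (1 / 2 : ℝ)

/-- After any `n` initial outcomes the Jeffreys posterior is proper and all conditional Shtarkov
integrals are finite. -/
def ProperAfter (n : ℕ) : Prop :=
  ∀ x : ℕ → ℝ, (∀ i < n, x i ∈ F.X) → F.jeffreys n x < ∞ ∧ ∀ j, F.shtarkov n j x < ∞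

/-- SNML exchangeability: with `m` the smallest length of an initial sequence for which the
strategies are well defined, the joint SNML density of `x_{m+1}, …, x_n` given `x^m` is invariant
under all permutations of `x^n` that fix the first `m` places. -/
def SNMLExchangeable : Prop :=
  ∃ m, IsLeast {n | F.ProperAfter n} m ∧
    ∀ n, m < n → ∀ x : ℕ → ℝ, (∀ i < n, x i ∈ F.X) →
      ∀ σ : Equiv.Perm ℕ, (∀ i < m, σ i = i) → (∀ i, n ≤ i → σ i = i) →
        F.snmlJoint m n (x ∘ σ) = F.snmlJoint m n x

end NaturalExpFamily

end SNML

end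

/-! Let A be the cumulant generating function of ν, w the mean of the member t₀, and let n - 1
observations have mean w. Divide the integral of the maximized likelihood over the n-th outcome by
the maximized likelihood of the first n - 1. The quotient is the expectation under t₀ of
exp(n·D(h)), where h = (y - w)/n is the shift of the empirical mean caused by the outcome y, and
D(h) is the divergence from t₀ of the member with mean w + h. Since D is a Legendre transform, its
Taylor coefficients are rational in the cumulants of t₀, and a Laplace-type argument gives 1 +
1/(2n) + c₂/n² + c₃/n³ + O(n⁻⁴), with c₂ and c₃ rational in the cumulants of orders 2 to 6
(`exists_shtarkov_expansion`).

Exchanging the last two of s + 2 outcomes leaves the first Shtarkov integral and the final maximized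
likelihood unchanged. What remains says that the quotient above does not depend on how many
observations equal a and how many equal b (`gridInvariant`). For a fixed pair of rational convex
combinations of a and b as means, the quotients agree for infinitely many n, so c₂ and c₃ agree
there; by density and continuity they are constant over all inner means
(`variance_form_of_gridInvariant`).

Constancy of c₂ is the equation 3VV'' - V'² = KV for the variance as a function of the mean, with K
= 24c₂ - 9. Given it, c₃ is affine in V'²/V with slope proportional to K. If K ≠ 0, then V'²/V is
constant and √V is affine. If K = 0, the equation makes V^(2/3) affine (`variance_form`).

Maximality enters three times: each inner mean belongs to an interior parameter, so maximum
likelihood points exist; densities are bounded at almost every sample point, so the integrals are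
finite; and a mean outside the inner core sits at an atom bounding the support, where the variance
is 0 and the formula follows by continuity. -/

noncomputable section

namespace SNML

/-! ### Differential equations for the cumulants -/

/-- A function with vanishing derivative on an open convex set of reals is constant there. -/
lemma eq_of_hasDerivAt_zero {S : Set ℝ} (hS : IsOpen S) (hc : Convex ℝ S) {q : ℝ → ℝ}
    (hq : ∀ t ∈ S, HasDerivAt q 0 t) {x y : ℝ} (hx : x ∈ S) (hy : y ∈ S) : q x = q y :=
  hS.is_const_of_deriv_eq_zero hc.isPreconnected
    (fun t ht => (hq t ht).differentiableAt.differentiableWithinAt)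
    (fun t ht => (hq t ht).deriv) hx hy

/-- A function that is constant on an open set has vanishing derivative there. -/
lemma deriv_eq_zero_of_eq_const {S : Set ℝ} (hS : IsOpen S) {q : ℝ → ℝ} {c d t : ℝ}
    (hq : ∀ t ∈ S, q t = c) (ht : t ∈ S) (hd : HasDerivAt q d t) : d = 0 := by
  have h : q =ᶠ[nhds t] fun _ => c := Filter.eventuallyEq_of_mem (hS.mem_nhds ht) hq
  exact hd.unique ((hasDerivAt_const t c).congr_of_eventuallyEq h)

/-- The second order coefficient of the expansion of the normalized Shtarkov integral, in terms
of cumulants. -/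
def coeffTwo (k2 k3 k4 : ℝ) : ℝ :=
  (-k3 / (6 * k2 ^ 3)) * k3 + (1 / (2 * k2)) ^ 2 * (k4 + 3 * k2 ^ 2) / 2

/-- The third order coefficient of the expansion of the normalized Shtarkov integral, in terms
of cumulants. -/
def coeffThree (k2 k3 k4 k5 k6 : ℝ) : ℝ :=
  ((3 * k3 ^ 2 / k2 ^ 5 - k4 / k2 ^ 4) / 24) * (k4 + 3 * k2 ^ 2)
    + (1 / (2 * k2)) * (-k3 / (6 * k2 ^ 3)) * (k5 + 10 * k2 * k3)
    + (1 / (2 * k2)) ^ 3 * (k6 + 10 * k3 ^ 2 + 15 * k2 * k4 + 15 * k2 ^ 3) / 6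

section ODE

variable {S : Set ℝ} {k : ℕ → ℝ → ℝ} {c₂ c₃ : ℝ}

/-- With V the variance as a function of the mean, k 3 = VV' and k 4 = V(VV')', so this is 3VV'' -
V'² = KV with K = 24c₂ - 9. -/
lemma cumulant_four (hpos : ∀ t ∈ S, 0 < k 2 t)
    (h₂ : ∀ t ∈ S, coeffTwo (k 2 t) (k 3 t) (k 4 t) = c₂) {t : ℝ} (ht : t ∈ S) :
    3 * k 4 t * k 2 t - 4 * k 3 t ^ 2 - (24 * c₂ - 9) * k 2 t ^ 3 = 0 := by
  have h := h₂ t ht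
  have h0 := (hpos t ht).ne'
  rw [← h, coeffTwo]
  field_simp
  ring

lemma cumulant_five (hS : IsOpen S) (hk : ∀ t ∈ S, ∀ i, HasDerivAt (k i) (k (i + 1) t) t)
    (hpos : ∀ t ∈ S, 0 < k 2 t)
    (h₂ : ∀ t ∈ S, coeffTwo (k 2 t) (k 3 t) (k 4 t) = c₂) {t : ℝ} (ht : t ∈ S) :
    3 * k 5 t * k 2 t - 5 * k 3 t * k 4 t - 3 * (24 * c₂ - 9) * k 2 t ^ 2 * k 3 t = 0 := by
  have hd := ((((hk t ht 4).const_mul 3).mul (hk t ht 2)).sub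
    (((hk t ht 3).pow 2).const_mul 4)).sub (((hk t ht 2).pow 3).const_mul (24 * c₂ - 9))
  have := deriv_eq_zero_of_eq_const hS (c := 0)
    (fun t ht => by simpa using cumulant_four hpos h₂ ht) ht hd
  norm_num at this
  linear_combination this

lemma cumulant_six (hS : IsOpen S) (hk : ∀ t ∈ S, ∀ i, HasDerivAt (k i) (k (i + 1) t) t)
    (hpos : ∀ t ∈ S, 0 < k 2 t)
    (h₂ : ∀ t ∈ S, coeffTwo (k 2 t) (k 3 t) (k 4 t) = c₂) {t : ℝ} (ht : t ∈ S) :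
    3 * k 6 t * k 2 t - 2 * k 3 t * k 5 t - 5 * k 4 t ^ 2
      - 3 * (24 * c₂ - 9) * (2 * k 2 t * k 3 t ^ 2 + k 2 t ^ 2 * k 4 t) = 0 := by
  have hd := ((((hk t ht 5).const_mul 3).mul (hk t ht 2)).sub
    (((hk t ht 3).const_mul 5).mul (hk t ht 4))).sub
    ((((hk t ht 2).pow 2).const_mul (3 * (24 * c₂ - 9))).mul (hk t ht 3))
  have := deriv_eq_zero_of_eq_const hS (c := 0)
    (fun t ht => by simpa using cumulant_five hS hk hpos h₂ ht) ht hd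
  norm_num at this
  linear_combination this

/-- The relation of `cumulant_four` and its first two derivatives express k 4, k 5, k 6 through k 2
and k 3. The third coefficient then depends only on k 3² / k 2³, with a slope proportional to 24c₂ -
9; this is why the case where that number vanishes must be treated separately. -/
lemma coeffThree_eq (hS : IsOpen S) (hk : ∀ t ∈ S, ∀ i, HasDerivAt (k i) (k (i + 1) t) t)
    (hpos : ∀ t ∈ S, 0 < k 2 t)
    (h₂ : ∀ t ∈ S, coeffTwo (k 2 t) (k 3 t) (k 4 t) = c₂) {t : ℝ} (ht : t ∈ S) :
    48 * coeffThree (k 2 t) (k 3 t) (k 4 t) (k 5 t) (k 6 t) =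
      3 * (24 * c₂ - 9) + 15
        - 4 / 27 * (24 * c₂ - 9) * (k 3 t ^ 2 / k 2 t ^ 3 - 2 * (24 * c₂ - 9)) := by
  have e4 := cumulant_four hpos h₂ ht
  have e5 := cumulant_five hS hk hpos h₂ ht
  have e6 := cumulant_six hS hk hpos h₂ ht
  have h0 := (hpos t ht).ne'
  generalize 24 * c₂ - 9 = K at *
  generalize k 2 t = v at *
  generalize k 3 t = v3 at *
  have h4 : k 4 t = (4 * v3 ^ 2 + K * v ^ 3) / (3 * v) := by
    field_simp; linear_combination e4
  have h5 : k 5 t = (5 * v3 * k 4 t + 3 * K * v ^ 2 * v3) / (3 * v) := by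
    field_simp; linear_combination e5
  have h6 : k 6 t = (2 * v3 * k 5 t + 5 * k 4 t ^ 2
      + 3 * K * (2 * v * v3 ^ 2 + v ^ 2 * k 4 t)) / (3 * v) := by
    field_simp; linear_combination e6
  rw [h6, h5, h4, coeffThree]
  field_simp
  ring

/-- If both expansion coefficients are constant, then the variance `k 2` is a square or a
`3/2`-power of an affine function of the mean `k 1`. -/
theorem variance_form (hS : IsOpen S) (hc : Convex ℝ S)
    (hk : ∀ t ∈ S, ∀ i, HasDerivAt (k i) (k (i + 1) t) t)
    (hpos : ∀ t ∈ S, 0 < k 2 t)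
    (h₂ : ∀ t ∈ S, coeffTwo (k 2 t) (k 3 t) (k 4 t) = c₂)
    (h₃ : ∀ t ∈ S, coeffThree (k 2 t) (k 3 t) (k 4 t) (k 5 t) (k 6 t) = c₃) :
    ∃ a l : ℝ, (∀ t ∈ S, k 2 t = (a * k 1 t + l) ^ 2) ∨
      (∀ t ∈ S, 0 ≤ a * k 1 t + l ∧ k 2 t = (a * k 1 t + l) ^ (3 / 2 : ℝ)) := by
  rcases S.eq_empty_or_nonempty with rfl | ⟨t₀, ht₀⟩
  · exact ⟨0, 0, Or.inl (by simp)⟩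
  have e4 := fun t ht => cumulant_four (t := t) hpos h₂ ht
  by_cases hK : 24 * c₂ - 9 = 0
  -- In the mean coordinate p = V'V^(-1/3), and (2/3)p is the slope of V^(2/3).
  · set p : ℝ → ℝ := fun t => k 3 t * k 2 t ^ (-(4 / 3) : ℝ) with hp
    have hp0 : ∀ t ∈ S, HasDerivAt p 0 t := by
      intro t ht
      have hv := hpos t ht
      have h := (hk t ht 3).mul ((hk t ht 2).rpow_const (p := (-(4 / 3) : ℝ)) (Or.inl hv.ne'))
      refine h.congr_deriv ?_
      have e : k 2 t ^ (-(4 / 3) : ℝ) = k 2 t ^ (-(4 / 3) - 1 : ℝ) * k 2 t := by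
        conv_rhs => rw [← Real.rpow_add_one hv.ne']
        norm_num
      have := e4 t ht
      rw [hK] at this
      rw [e]
      linear_combination (k 2 t ^ (-(4 / 3) - 1 : ℝ)) / 3 * this
    set r : ℝ → ℝ := fun t => k 2 t ^ (2 / 3 : ℝ) - 2 / 3 * p t₀ * k 1 t with hr
    have hr0 : ∀ t ∈ S, HasDerivAt r 0 t := by
      intro t ht
      have hv := hpos t ht
      have h := ((hk t ht 2).rpow_const (p := (2 / 3 : ℝ)) (Or.inl hv.ne')).sub
        ((hk t ht 1).const_mul (2 / 3 * p t₀))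
      refine h.congr_deriv ?_
      rw [eq_of_hasDerivAt_zero hS hc hp0 ht₀ ht, hp]
      have e : k 2 t ^ (2 / 3 - 1 : ℝ) = k 2 t ^ (-(4 / 3) : ℝ) * k 2 t := by
        conv_rhs => rw [← Real.rpow_add_one hv.ne']
        norm_num
      simp only [e]
      ring
    refine ⟨2 / 3 * p t₀, r t₀, Or.inr fun t ht => ?_⟩
    have hv := hpos t ht
    have e : 2 / 3 * p t₀ * k 1 t + r t₀ = k 2 t ^ (2 / 3 : ℝ) := by
      rw [eq_of_hasDerivAt_zero hS hc hr0 ht₀ ht, hr]; ring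
    rw [e, ← Real.rpow_mul hv.le]
    refine ⟨by positivity, ?_⟩
    norm_num
  · have ha : ∀ t ∈ S, k 3 t ^ 2 / k 2 t ^ 3 = k 3 t₀ ^ 2 / k 2 t₀ ^ 3 := by
      intro t ht
      have h := coeffThree_eq hS hk hpos h₂ ht
      have h' := coeffThree_eq hS hk hpos h₂ ht₀
      rw [h₃ t ht] at h
      rw [h₃ t₀ ht₀] at h'
      have := mul_left_cancel₀ hK (show (24 * c₂ - 9) * (k 3 t ^ 2 / k 2 t ^ 3) =
        (24 * c₂ - 9) * (k 3 t₀ ^ 2 / k 2 t₀ ^ 3) by linear_combination 27 / 4 * (h - h'))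
      exact this
    -- Differentiating the constant ratio leaves a factor k 3. Where k 3 vanishes, the constant is
    -- 0, so k 3 vanishes identically and k 4 = 0.
    have hrel : ∀ t ∈ S, 2 * k 4 t * k 2 t = 3 * k 3 t ^ 2 := by
      intro t ht
      by_cases h3 : k 3 t = 0
      · have hz : ∀ s ∈ S, k 3 s = 0 := by
          intro s hs
          have := (ha s hs).trans (ha t ht).symm
          rw [h3] at this
          have hv := (hpos s hs).ne'
          simpa [hv] using this
        have := deriv_eq_zero_of_eq_const hS hz ht (hk t ht 3)
        simp only [Nat.reduceAdd] at this
        rw [this, h3]; ring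
      · have hv := (hpos t ht).ne'
        have hd := ((hk t ht 3).pow 2).div ((hk t ht 2).pow 3) (pow_ne_zero 3 hv)
        have := deriv_eq_zero_of_eq_const hS ha ht hd
        norm_num [hv] at this
        have h6 : k 3 t * k 2 t ^ 2 ≠ 0 := by positivity
        apply mul_left_cancel₀ h6
        linear_combination this
    -- Here p = V'V^(-1/2), and p/2 is the slope of √V. Constancy of p² would leave the sign of p
    -- open; the differentiated relation gives constancy of p itself.
    set p : ℝ → ℝ := fun t => k 3 t * k 2 t ^ (-(3 / 2) : ℝ) with hp
    have hp0 : ∀ t ∈ S, HasDerivAt p 0 t := by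
      intro t ht
      have hv := hpos t ht
      have h := (hk t ht 3).mul ((hk t ht 2).rpow_const (p := (-(3 / 2) : ℝ)) (Or.inl hv.ne'))
      refine h.congr_deriv ?_
      have e : k 2 t ^ (-(3 / 2) : ℝ) = k 2 t ^ (-(3 / 2) - 1 : ℝ) * k 2 t := by
        conv_rhs => rw [← Real.rpow_add_one hv.ne']
        norm_num
      rw [e]
      linear_combination (k 2 t ^ (-(3 / 2) - 1 : ℝ)) / 2 * hrel t ht
    set r : ℝ → ℝ := fun t => k 2 t ^ (1 / 2 : ℝ) - 1 / 2 * p t₀ * k 1 t with hr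
    have hr0 : ∀ t ∈ S, HasDerivAt r 0 t := by
      intro t ht
      have hv := hpos t ht
      have h := ((hk t ht 2).rpow_const (p := (1 / 2 : ℝ)) (Or.inl hv.ne')).sub
        ((hk t ht 1).const_mul (1 / 2 * p t₀))
      refine h.congr_deriv ?_
      rw [eq_of_hasDerivAt_zero hS hc hp0 ht₀ ht, hp]
      have e : k 2 t ^ (1 / 2 - 1 : ℝ) = k 2 t ^ (-(3 / 2) : ℝ) * k 2 t := by
        conv_rhs => rw [← Real.rpow_add_one hv.ne']
        norm_num
      simp only [e]
      ring
    refine ⟨1 / 2 * p t₀, r t₀, Or.inl fun t ht => ?_⟩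
    have hv := hpos t ht
    have e : 1 / 2 * p t₀ * k 1 t + r t₀ = k 2 t ^ (1 / 2 : ℝ) := by
      rw [eq_of_hasDerivAt_zero hS hc hr0 ht₀ ht, hr]; ring
    rw [e, ← Real.rpow_natCast, ← Real.rpow_mul hv.le]
    norm_num

end ODE

/-! ### Laplace-type expansion of integrals -/

lemma abs_exp_sub_cubic_le (z : ℝ) :
    |Real.exp z - (1 + z + z ^ 2 / 2 + z ^ 3 / 6)| ≤ |z| ^ 4 * Real.exp |z| := by
  have h := Complex.norm_exp_sub_sum_le_norm_mul_exp (z : ℂ) 4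
  have e : Complex.exp z - ∑ m ∈ Finset.range 4, (z : ℂ) ^ m / m.factorial
      = ((Real.exp z - (1 + z + z ^ 2 / 2 + z ^ 3 / 6) : ℝ) : ℂ) := by
    push_cast
    simp [Finset.sum_range_succ, Nat.factorial]
  rw [e, Complex.norm_real, Complex.norm_real] at h
  simpa using h

/-- The expansion of `exp (c₂ u² x + c₃ u³ x² + c₄ u⁴ x³)` up to the third power of `x`. -/
def expPoly (c₂ c₃ c₄ x u : ℝ) : ℝ :=
  1 + c₂ * u ^ 2 * x + (c₃ * u ^ 3 + c₂ ^ 2 * u ^ 4 / 2) * x ^ 2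
    + (c₄ * u ^ 4 + c₂ * c₃ * u ^ 5 + c₂ ^ 3 * u ^ 6 / 6) * x ^ 3

lemma pow_le_one_add_pow {v : ℝ} (hv : 0 ≤ v) {i j : ℕ} (hij : i ≤ j) : v ^ i ≤ 1 + v ^ j := by
  rcases le_total v 1 with h | h
  · have := pow_le_one₀ (n := i) hv h
    have := pow_nonneg hv j
    linarith
  · have := pow_le_pow_right₀ h hij
    linarith

/-- Bounds what is left of 1 + z + z²/2 + z³/6 after `expPoly` is subtracted and x⁴ is factored out;
powers u⁵ to u⁷ are absorbed in 1 + |u|⁸. -/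
lemma abs_remainder_le {c ρ δ γ y u B C : ℝ} (hc : |c| ≤ B) (hρC : |ρ| ≤ C) (hδB : |δ| ≤ B)
    (hγB : |γ| ≤ B) (hy1 : |y| ≤ 1) :
    |u ^ 5 * ρ + u ^ 6 * ((2 * c * δ + γ ^ 2) / 2)
        + u ^ 7 * (γ * (3 * c ^ 2 + 3 * c * y * γ + y ^ 2 * γ ^ 2) / 6)| ≤
      (C + 2 * B ^ 2 + 2 * B ^ 3) * (1 + |u| ^ 8) := by
  have hB0 : 0 ≤ B := (abs_nonneg _).trans hc
  have hA : |u ^ 5 * ρ| ≤ (1 + |u| ^ 8) * C := by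
    rw [abs_mul, abs_pow]
    gcongr
    exact pow_le_one_add_pow (abs_nonneg _) (by norm_num)
  have hQ1 : |(2 * c * δ + γ ^ 2) / 2| ≤ 2 * B ^ 2 := by
    rw [abs_div, abs_two, div_le_iff₀ two_pos]
    refine (abs_add_le _ _).trans ?_
    rw [abs_mul, abs_mul, abs_two, abs_pow]
    have : |c| * |δ| ≤ B * B := by gcongr
    have : |γ| ^ 2 ≤ B ^ 2 := by gcongr
    nlinarith
  have hQ2 : |γ * (3 * c ^ 2 + 3 * c * y * γ + y ^ 2 * γ ^ 2) / 6| ≤ 2 * B ^ 3 := by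
    have : |3 * c ^ 2 + 3 * c * y * γ + y ^ 2 * γ ^ 2| ≤ 7 * B ^ 2 := by
      have a1 : |3 * c ^ 2| ≤ 3 * B ^ 2 := by
        rw [abs_mul, abs_pow, abs_of_pos (by norm_num : (0 : ℝ) < 3)]; gcongr
      have a2 : |3 * c * y * γ| ≤ 3 * B * 1 * B := by
        rw [abs_mul, abs_mul, abs_mul, abs_of_pos (by norm_num : (0 : ℝ) < 3)]; gcongr
      have a3 : |y ^ 2 * γ ^ 2| ≤ 1 ^ 2 * B ^ 2 := by
        rw [abs_mul, abs_pow, abs_pow]; gcongr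
      have := abs_add_le (3 * c ^ 2 + 3 * c * y * γ) (y ^ 2 * γ ^ 2)
      have := abs_add_le (3 * c ^ 2) (3 * c * y * γ)
      linarith
    rw [abs_div, abs_mul, abs_of_pos (by norm_num : (0 : ℝ) < 6), div_le_iff₀ (by norm_num)]
    calc _ ≤ B * (7 * B ^ 2) := by gcongr
      _ ≤ _ := by have := pow_nonneg hB0 3; linarith
  have hA2 : |u ^ 6 * ((2 * c * δ + γ ^ 2) / 2)| ≤ (1 + |u| ^ 8) * (2 * B ^ 2) := by
    rw [abs_mul, abs_pow]
    gcongr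
    exact pow_le_one_add_pow (abs_nonneg _) (by norm_num)
  have hA3 : |u ^ 7 * (γ * (3 * c ^ 2 + 3 * c * y * γ + y ^ 2 * γ ^ 2) / 6)|
      ≤ (1 + |u| ^ 8) * (2 * B ^ 3) := by
    rw [abs_mul, abs_pow]
    gcongr
    exact pow_le_one_add_pow (abs_nonneg _) (by norm_num)
  refine (abs_add_three _ _ _).trans ?_
  linarith

/-- The exponent is of order u²x. On |xu| ≤ ε one factor xu is traded for ε, so that |z| ≤ εB|u|:
the growth in u is exponential with a rate that can be made small, hence integrable. The fourth
power of z in the remainder of the exponential series supplies x⁴. -/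
lemma abs_exp_sub_expPoly_le {c₂ c₃ c₄ C ε x u z : ℝ} (hx : 0 < x) (hC : 0 ≤ C)
    (hε : ε ≤ 1) (hxu : |x * u| ≤ ε)
    (hz : |z - (c₂ * u ^ 2 * x + c₃ * u ^ 3 * x ^ 2 + c₄ * u ^ 4 * x ^ 3)| ≤ C * |u| ^ 5 * x ^ 4)
    {B : ℝ} (hB : B = |c₂| + |c₃| + |c₄| + C) :
    |Real.exp z - expPoly c₂ c₃ c₄ x u| ≤
      x ^ 4 * ((C + 2 * B ^ 2 + 2 * B ^ 3 + B ^ 4) * (1 + |u| ^ 8) * Real.exp (ε * B * |u|)) := by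
  have hB0 : 0 ≤ B := by rw [hB]; positivity
  have hCB : C ≤ B := by rw [hB]; have := abs_nonneg c₂; have := abs_nonneg c₃; have := abs_nonneg c₄; linarith
  rcases eq_or_ne u 0 with rfl | hu
  · have : z = 0 := by simpa using hz
    subst this
    simp [expPoly]
    positivity
  obtain ⟨ρ, hρ⟩ : ∃ ρ, z = c₂ * u ^ 2 * x + c₃ * u ^ 3 * x ^ 2 + c₄ * u ^ 4 * x ^ 3
      + ρ * u ^ 5 * x ^ 4 :=
    ⟨(z - (c₂ * u ^ 2 * x + c₃ * u ^ 3 * x ^ 2 + c₄ * u ^ 4 * x ^ 3)) / (u ^ 5 * x ^ 4), by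
      field_simp; ring⟩
  have hρC : |ρ| ≤ C := by
    rw [hρ, add_sub_cancel_left, abs_mul, abs_mul, abs_pow, abs_pow, abs_of_pos hx] at hz
    have h1 : 0 < |u| ^ 5 * x ^ 4 := by positivity
    exact le_of_mul_le_mul_right (by linarith) h1
  obtain ⟨y, hy⟩ : ∃ y, y = x * u := ⟨_, rfl⟩
  rw [← hy] at hxu
  have hy1 : |y| ≤ 1 := hxu.trans hε
  -- Horner form of the exponent: z = x u² β, where β, γ, δ stay bounded by B because |y| ≤ 1.
  obtain ⟨δ, hδ⟩ : ∃ δ, δ = c₄ + ρ * y := ⟨_, rfl⟩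
  obtain ⟨γ, hγ⟩ : ∃ γ, γ = c₃ + y * δ := ⟨_, rfl⟩
  obtain ⟨β, hβ⟩ : ∃ β, β = c₂ + y * γ := ⟨_, rfl⟩
  have hc2 : |c₂| ≤ B := by rw [hB]; have := abs_nonneg c₃; have := abs_nonneg c₄; linarith
  have hδB : |δ| ≤ |c₄| + C := by
    rw [hδ]
    refine (abs_add_le _ _).trans ?_
    rw [abs_mul]
    gcongr
    calc |ρ| * |y| ≤ |ρ| * 1 := by gcongr
      _ ≤ C := by linarith
  have hγB' : |γ| ≤ |c₃| + (|c₄| + C) := by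
    rw [hγ]
    refine (abs_add_le _ _).trans ?_
    rw [abs_mul]
    gcongr
    calc |y| * |δ| ≤ 1 * |δ| := by gcongr
      _ ≤ _ := by linarith
  have hβB : |β| ≤ B := by
    rw [hβ]
    refine (abs_add_le _ _).trans ?_
    rw [abs_mul, hB]
    have : |y| * |γ| ≤ 1 * |γ| := by gcongr
    linarith
  have hδB : |δ| ≤ B := by rw [hB]; have := abs_nonneg c₂; have := abs_nonneg c₃; linarith
  have hγB : |γ| ≤ B := by rw [hB]; have := abs_nonneg c₂; linarith
  have hz1 : z = x * u ^ 2 * β := by rw [hρ, hβ, hγ, hδ, hy]; ring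
  have hzabs : |z| ≤ ε * B * |u| := by
    have : z = y * β * u := by rw [hz1, hy]; ring
    rw [this, abs_mul, abs_mul]
    gcongr
    exact (abs_nonneg _).trans hxu
  have hz4 : |z| ^ 4 ≤ x ^ 4 * (B ^ 4 * |u| ^ 8) := by
    rw [hz1, abs_mul, abs_mul, abs_pow, abs_of_pos hx]
    calc (x * |u| ^ 2 * |β|) ^ 4 ≤ (x * |u| ^ 2 * B) ^ 4 := by gcongr
      _ = _ := by ring
  have key : Real.exp z - expPoly c₂ c₃ c₄ x u =
      (Real.exp z - (1 + z + z ^ 2 / 2 + z ^ 3 / 6))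
      + x ^ 4 * (u ^ 5 * ρ + u ^ 6 * ((2 * c₂ * δ + γ ^ 2) / 2)
        + u ^ 7 * (γ * (3 * c₂ ^ 2 + 3 * c₂ * y * γ + y ^ 2 * γ ^ 2) / 6)) := by
    have e : expPoly c₂ c₃ c₄ x u + x ^ 4 * (u ^ 5 * ρ + u ^ 6 * ((2 * c₂ * δ + γ ^ 2) / 2)
        + u ^ 7 * (γ * (3 * c₂ ^ 2 + 3 * c₂ * y * γ + y ^ 2 * γ ^ 2) / 6))
        = 1 + z + z ^ 2 / 2 + z ^ 3 / 6 := by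
      rw [hz1, hβ, hγ, hδ, hy, expPoly]; ring
    linear_combination -e
  have h1 := abs_exp_sub_cubic_le z
  have hE : 1 ≤ Real.exp (ε * B * |u|) := Real.one_le_exp ((abs_nonneg _).trans hzabs)
  have hEz : Real.exp |z| ≤ Real.exp (ε * B * |u|) := Real.exp_le_exp.2 hzabs
  rw [key]
  refine (abs_add_le _ _).trans ?_
  have hfirst : |z| ^ 4 * Real.exp |z| ≤
      x ^ 4 * (B ^ 4 * (1 + |u| ^ 8) * Real.exp (ε * B * |u|)) := by
    calc |z| ^ 4 * Real.exp |z| ≤ x ^ 4 * (B ^ 4 * |u| ^ 8) * Real.exp (ε * B * |u|) := by gcongr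
      _ ≤ x ^ 4 * (B ^ 4 * (1 + |u| ^ 8)) * Real.exp (ε * B * |u|) := by
        gcongr; linarith
      _ = _ := by ring
  have hsecond : |x ^ 4 * (u ^ 5 * ρ + u ^ 6 * ((2 * c₂ * δ + γ ^ 2) / 2)
        + u ^ 7 * (γ * (3 * c₂ ^ 2 + 3 * c₂ * y * γ + y ^ 2 * γ ^ 2) / 6))| ≤
      x ^ 4 * ((C + 2 * B ^ 2 + 2 * B ^ 3) * (1 + |u| ^ 8) * Real.exp (ε * B * |u|)) := by
    rw [abs_mul, abs_of_pos (pow_pos hx 4)]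
    gcongr
    have hn : 0 ≤ (C + 2 * B ^ 2 + 2 * B ^ 3) * (1 + |u| ^ 8) := by positivity
    exact (abs_remainder_le hc2 hρC hδB hγB hy1).trans (le_mul_of_one_le_right hn hE)
  calc _ ≤ _ := add_le_add (h1.trans hfirst) hsecond
    _ = _ := by ring

lemma integrable_pow_mul_exp_abs {P : Measure ℝ} {w a b : ℝ} (hab : a < b)
    (hb : Integrable (fun y => Real.exp (b * |y - w|)) P) (i : ℕ) :
    Integrable (fun y => |y - w| ^ i * Real.exp (a * |y - w|)) P := by
  have hd : 0 < b - a := sub_pos.2 hab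
  refine (hb.const_mul (i.factorial / (b - a) ^ i)).mono' ?_ (ae_of_all _ fun y => ?_)
  · fun_prop
  · have h := Real.pow_div_factorial_le_exp ((b - a) * |y - w|) (by positivity) i
    rw [Real.norm_of_nonneg (by positivity)]
    have e : b * |y - w| = (b - a) * |y - w| + a * |y - w| := by ring
    rw [e, Real.exp_add, ← mul_assoc]
    gcongr
    calc |y - w| ^ i = i.factorial / (b - a) ^ i * (((b - a) * |y - w|) ^ i / i.factorial) := by
          have := i.factorial_ne_zero
          rw [mul_pow]
          field_simp
      _ ≤ _ := by gcongr

lemma exists_pow_le_mul_inv_pow_four {r : ℝ} (h0 : 0 ≤ r) (h1 : r < 1) :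
    ∃ K, 0 ≤ K ∧ ∀ n : ℕ, 1 ≤ n → r ^ n ≤ K * ((n : ℝ)⁻¹) ^ 4 := by
  have h := tendsto_pow_const_mul_const_pow_of_abs_lt_one 4 (r := r) (by rwa [abs_of_nonneg h0])
  obtain ⟨K, hK⟩ := h.bddAbove_range
  refine ⟨K, ?_, fun n hn => ?_⟩
  · exact le_trans (by positivity) (hK ⟨1, rfl⟩)
  · have := hK ⟨n, rfl⟩
    have hn' : (0 : ℝ) < n := by exact_mod_cast hn
    rw [inv_pow, ← div_eq_mul_inv, le_div_iff₀ (by positivity)]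
    simpa [mul_comm] using this

lemma abs_expPoly_le {c₂ c₃ c₄ x u : ℝ} (hx0 : 0 ≤ x) (hx : x ≤ 1) :
    |expPoly c₂ c₃ c₄ x u| ≤ (1 + |c₂| + |c₃| + |c₄| + |c₂| ^ 2 + |c₂| * |c₃| + |c₂| ^ 3) *
      (1 + |u| ^ 8) := by
  have hp : ∀ i ≤ 8, |u| ^ i ≤ 1 + |u| ^ 8 := fun i hi => pow_le_one_add_pow (abs_nonneg _) hi
  have key : ∀ c : ℝ, ∀ i ≤ 8, ∀ j : ℕ, |c * u ^ i * x ^ j| ≤ |c| * (1 + |u| ^ 8) := by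
    intro c i hi j
    rw [abs_mul, abs_mul, abs_pow, abs_pow, abs_of_nonneg hx0]
    calc |c| * |u| ^ i * x ^ j ≤ |c| * |u| ^ i * 1 := by
          gcongr; exact pow_le_one₀ hx0 hx
      _ ≤ |c| * (1 + |u| ^ 8) := by rw [mul_one]; gcongr; exact hp i hi
  have e : expPoly c₂ c₃ c₄ x u = 1 * u ^ 0 * x ^ 0 + c₂ * u ^ 2 * x ^ 1 + c₃ * u ^ 3 * x ^ 2
      + c₂ ^ 2 / 2 * u ^ 4 * x ^ 2 + c₄ * u ^ 4 * x ^ 3 + c₂ * c₃ * u ^ 5 * x ^ 3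
      + c₂ ^ 3 / 6 * u ^ 6 * x ^ 3 := by rw [expPoly]; ring
  have k0 := abs_le.1 (key 1 0 (by norm_num) 0)
  have k1 := abs_le.1 (key c₂ 2 (by norm_num) 1)
  have k2 := abs_le.1 (key c₃ 3 (by norm_num) 2)
  have k3 := abs_le.1 (key (c₂ ^ 2 / 2) 4 (by norm_num) 2)
  have k4 := abs_le.1 (key c₄ 4 (by norm_num) 3)
  have k5 := abs_le.1 (key (c₂ * c₃) 5 (by norm_num) 3)
  have k6 := abs_le.1 (key (c₂ ^ 3 / 6) 6 (by norm_num) 3)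
  rw [abs_div, abs_pow] at k3 k6
  rw [abs_mul] at k5
  rw [abs_one] at k0
  norm_num at k3 k6
  have n2 : 0 ≤ |c₂| ^ 2 * (1 + |u| ^ 8) := by positivity
  have n3 : 0 ≤ |c₂| ^ 3 * (1 + |u| ^ 8) := by positivity
  rw [← sq_abs c₂] at k3
  rw [e, abs_le]
  constructor <;> nlinarith

/-- Laplace type expansion of integrals of functions that look like
`exp (c₂ u² / n + c₃ u³ / n² + c₄ u⁴ / n³)` with `u = y - w` for `|u| ≤ ε n` and are exponentially
small elsewhere. -/
theorem abs_integral_sub_integral_expPoly_le {P : Measure ℝ} [IsProbabilityMeasure P]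
    {w c₂ c₃ c₄ : ℝ} {e : ℕ → ℝ → ℝ} {n₀ : ℕ} (hn₀ : 1 ≤ n₀)
    (hexp : ∃ b > 0, Integrable (fun y => Real.exp (b * |y - w|)) P)
    (hint : ∀ n ≥ n₀, Integrable (e n) P)
    (hloc : ∃ ε > 0, ∃ C ≥ 0, ∀ n : ℕ, n ≥ n₀ → ∀ᵐ y ∂P, |y - w| ≤ ε * n →
      ∃ z, e n y = Real.exp z ∧
        |z - (c₂ * (y - w) ^ 2 * (n : ℝ)⁻¹ + c₃ * (y - w) ^ 3 * (n : ℝ)⁻¹ ^ 2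
          + c₄ * (y - w) ^ 4 * (n : ℝ)⁻¹ ^ 3)| ≤ C * |y - w| ^ 5 * (n : ℝ)⁻¹ ^ 4)
    (htail : ∀ ε > 0, ∃ r : ℝ, 0 ≤ r ∧ r < 1 ∧ ∃ G : ℝ → ℝ, Integrable G P ∧
      ∀ n : ℕ, n ≥ n₀ → ∀ᵐ y ∂P, ε * n < |y - w| → |e n y| ≤ r ^ n * G y) :
    ∃ K, ∀ n : ℕ, n ≥ n₀ →
      |∫ y, e n y ∂P - ∫ y, expPoly c₂ c₃ c₄ (n : ℝ)⁻¹ (y - w) ∂P| ≤ K * (n : ℝ)⁻¹ ^ 4 := by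
  obtain ⟨b, hb, hb'⟩ := hexp
  obtain ⟨ε₀, hε₀, C, hC, hloc⟩ := hloc
  set B := |c₂| + |c₃| + |c₄| + C with hB
  have hB0 : 0 ≤ B := by positivity
  -- The window is shrunk until the rate εB lies below the exponential moment b available under P.
  obtain ⟨ε, hε, hεε₀, hε1, hεB⟩ : ∃ ε > 0, ε ≤ ε₀ ∧ ε ≤ 1 ∧ ε * B < b := by
    refine ⟨min (min ε₀ 1) (b / (2 * (B + 1))), by positivity, ?_, ?_, ?_⟩
    · exact (min_le_left _ _).trans (min_le_left _ _)
    · exact (min_le_left _ _).trans (min_le_right _ _)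
    · calc _ ≤ b / (2 * (B + 1)) * B := by gcongr; exact min_le_right _ _
        _ < b := by
          rw [div_mul_eq_mul_div, div_lt_iff₀ (by positivity)]
          nlinarith
  obtain ⟨r, hr0, hr1, G, hG, htail⟩ := htail ε hε
  obtain ⟨K₃, hK₃, hr⟩ := exists_pow_le_mul_inv_pow_four hr0 hr1
  set K₁ := C + 2 * B ^ 2 + 2 * B ^ 3 + B ^ 4
  set K₂ := 1 + |c₂| + |c₃| + |c₄| + |c₂| ^ 2 + |c₂| * |c₃| + |c₂| ^ 3
  have hpow : ∀ i, Integrable (fun y => |y - w| ^ i) P := fun i => by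
    simpa using integrable_pow_mul_exp_abs hb hb' i
  -- An n-free dominating function. Its three terms bound the local error, the polynomial outside
  -- the window, and the integrand outside the window.
  set H : ℝ → ℝ := fun y => K₁ * (1 + |y - w| ^ 8) * Real.exp (ε * B * |y - w|)
    + K₂ * (1 + |y - w| ^ 8) * (|y - w| / ε) ^ 4 + K₃ * |G y| with hH
  have hHint : Integrable H P := by
    have i1 := ((integrable_pow_mul_exp_abs hεB hb' 0).add
      (integrable_pow_mul_exp_abs hεB hb' 8)).const_mul K₁
    have i2 := ((hpow 4).add (hpow 12)).const_mul (K₂ / ε ^ 4)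
    refine ((i1.add i2).add (hG.abs.const_mul K₃)).congr (ae_of_all _ fun y => ?_)
    simp only [hH, Pi.add_apply, pow_zero]
    ring
  have hT : ∀ x, Integrable (fun y => expPoly c₂ c₃ c₄ x (y - w)) P := by
    intro x
    have hq : ∀ i, Integrable (fun y => (y - w) ^ i) P := fun i =>
      (hpow i).mono' (by fun_prop) (ae_of_all _ fun y => by simp)
    have := ((((hq 0).const_mul 1).add ((hq 2).const_mul (c₂ * x))).add
      (((hq 3).const_mul (c₃ * x ^ 2)).add ((hq 4).const_mul (c₂ ^ 2 / 2 * x ^ 2)))).add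
      ((((hq 4).const_mul (c₄ * x ^ 3)).add ((hq 5).const_mul (c₂ * c₃ * x ^ 3))).add
      ((hq 6).const_mul (c₂ ^ 3 / 6 * x ^ 3)))
    refine this.congr (ae_of_all _ fun y => ?_)
    simp only [Pi.add_apply, expPoly]
    ring
  refine ⟨∫ y, H y ∂P, fun n hn => ?_⟩
  have hn1 : (1 : ℝ) ≤ n := by exact_mod_cast hn₀.trans hn
  set x := (n : ℝ)⁻¹ with hx
  have hx0 : 0 < x := by positivity
  have hx1 : x ≤ 1 := inv_le_one_of_one_le₀ hn1
  rw [← integral_sub (hint n hn) (hT x), ← Real.norm_eq_abs]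
  refine (norm_integral_le_of_norm_le (g := fun y => x ^ 4 * H y) (hHint.const_mul (x ^ 4)) ?_).trans ?_
  · filter_upwards [hloc n hn, htail n hn] with y hy hy'
    rw [Real.norm_eq_abs]
    have hnn : 0 ≤ K₁ * (1 + |y - w| ^ 8) * Real.exp (ε * B * |y - w|) := by positivity
    have hnn2 : 0 ≤ K₂ * (1 + |y - w| ^ 8) * (|y - w| / ε) ^ 4 := by positivity
    have hnn3 : 0 ≤ K₃ * |G y| := by positivity
    have hx4 : 0 ≤ x ^ 4 := by positivity
    rcases le_or_gt |y - w| (ε * n) with hyn | hyn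
    · obtain ⟨z, hz, hzz⟩ := hy (hyn.trans (by gcongr))
      have hxu : |x * (y - w)| ≤ ε := by
        rw [abs_mul, abs_of_pos hx0, hx, inv_mul_le_iff₀ (by positivity)]
        linarith
      rw [hz]
      refine (abs_exp_sub_expPoly_le hx0 hC hε1 hxu hzz hB).trans ?_
      gcongr
      simp only [hH]
      linarith
    · have h1 := hy' hyn
      have h2 := abs_expPoly_le (c₂ := c₂) (c₃ := c₃) (c₄ := c₄) (u := y - w) hx0.le hx1
      -- Outside the window |y - w| / (εn) exceeds 1, so its fourth power can be inserted to gain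
      -- x⁴.
      have h3 : 1 ≤ x ^ 4 * (|y - w| / ε) ^ 4 := by
        rw [← mul_pow]
        apply one_le_pow₀
        rw [hx, ← div_eq_inv_mul, le_div_iff₀ (by positivity), le_div_iff₀ hε]
        linarith
      have h4 : r ^ n * G y ≤ x ^ 4 * (K₃ * |G y|) := by
        calc r ^ n * G y ≤ r ^ n * |G y| := by gcongr; exact le_abs_self _
          _ ≤ (K₃ * x ^ 4) * |G y| := by gcongr; exact hr n (hn₀.trans hn)
          _ = _ := by ring
      have h5 : K₂ * (1 + |y - w| ^ 8) ≤
          x ^ 4 * (K₂ * (1 + |y - w| ^ 8) * (|y - w| / ε) ^ 4) := by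
        have : 0 ≤ K₂ * (1 + |y - w| ^ 8) := by positivity
        exact (le_mul_of_one_le_right this h3).trans_eq (by ring)
      have h6 := abs_sub (e n y) (expPoly c₂ c₃ c₄ x (y - w))
      have h7 := mul_nonneg hx4 hnn
      simp only [hH, mul_add (x ^ 4)]
      linarith only [h1, h2, h4, h5, h6, h7]
  · exact (integral_const_mul _ _).trans_le (mul_comm _ _).le

/-! ### Taylor expansion of the Legendre transform -/

lemma exists_taylor_bound {f : ℝ → ℝ} {t : ℝ} (hf : AnalyticAt ℝ f t) (n : ℕ) :
    ∃ C η : ℝ, 0 < η ∧ ∀ τ, |τ| < η →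
      |f (t + τ) - ∑ i ∈ Finset.range n, iteratedDeriv i f t / i.factorial * τ ^ i|
        ≤ C * |τ| ^ n := by
  have h := hf.hasFPowerSeriesAt.isBigO_sub_partialSum_pow n
  obtain ⟨C, hC⟩ := h.bound
  obtain ⟨η, hη, hη'⟩ := Metric.eventually_nhds_iff.1 hC
  refine ⟨C, η, hη, fun τ hτ => ?_⟩
  have := hη' (y := τ) (by simpa using hτ)
  simp only [FormalMultilinearSeries.partialSum, FormalMultilinearSeries.ofScalars_apply_eq,
    smul_eq_mul, Real.norm_eq_abs, abs_pow, abs_abs] at this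
  exact this

/-- The remainder of the Legendre transform after its fourth order expansion, with
`h = τ (a + b τ / 2 + c τ² / 6 + ρ τ³)`, is divisible by `τ⁵`. -/
lemma exists_legendre_remainder {a : ℝ} (ha : 0 < a) (b c : ℝ) :
    ∃ Q : ℝ × ℝ × ℝ → ℝ, Continuous Q ∧ ∀ τ ρ ρ' : ℝ,
      τ * (τ * (a + b / 2 * τ + c / 6 * τ ^ 2 + ρ * τ ^ 3))
        - (a / 2 * τ ^ 2 + b / 6 * τ ^ 3 + c / 24 * τ ^ 4 + ρ' * τ ^ 5)
        - (1 / (2 * a) * (τ * (a + b / 2 * τ + c / 6 * τ ^ 2 + ρ * τ ^ 3)) ^ 2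
          + -b / (6 * a ^ 3) * (τ * (a + b / 2 * τ + c / 6 * τ ^ 2 + ρ * τ ^ 3)) ^ 3
          + (3 * b ^ 2 / a ^ 5 - c / a ^ 4) / 24
            * (τ * (a + b / 2 * τ + c / 6 * τ ^ 2 + ρ * τ ^ 3)) ^ 4)
      = τ ^ 5 * Q (τ, ρ, ρ') := by
  -- Horner pieces of h = τ(a + τ g1) with g1 = b/2 + τ g2. The three coefficients in the statement
  -- are those that cancel the orders τ², τ³ and τ⁴.
  let g2 : ℝ × ℝ × ℝ → ℝ := fun p => c / 6 + p.2.1 * p.1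
  let g1 : ℝ × ℝ × ℝ → ℝ := fun p => b / 2 + p.1 * g2 p
  have c2 : Continuous g2 := by fun_prop
  have c1 : Continuous g1 := by fun_prop
  refine ⟨fun p => p.2.1 - p.2.2
    - (1 / (2 * a) * (2 * a * p.2.1 + b * g2 p + p.1 * g2 p ^ 2)
      + -b / (6 * a ^ 3) * (3 * a ^ 2 * g2 p + 3 * a * g1 p ^ 2 + p.1 * g1 p ^ 3)
      + (3 * b ^ 2 / a ^ 5 - c / a ^ 4) / 24 * (g1 p * (4 * a ^ 3 + 6 * a ^ 2 * p.1 * g1 p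
        + 4 * a * p.1 ^ 2 * g1 p ^ 2 + p.1 ^ 3 * g1 p ^ 3))), by fun_prop, fun τ ρ ρ' => ?_⟩
  simp only [g1, g2]
  field_simp
  ring

/-- Fourth order expansion of the Legendre transform `h ↦ τ h - (f (t + τ) - f t - τ f' t)`, where
`h = f' (t + τ) - f' t`. -/
theorem exists_legendre_expansion {f : ℝ → ℝ} {t : ℝ} (hf : AnalyticAt ℝ f t)
    (hpos : 0 < iteratedDeriv 2 f t) :
    ∃ C η : ℝ, 0 ≤ C ∧ 0 < η ∧ ∀ τ, |τ| < η → ∀ h, h = deriv f (t + τ) - deriv f t →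
      |τ * h - (f (t + τ) - f t - τ * deriv f t)
        - (1 / (2 * iteratedDeriv 2 f t) * h ^ 2
          + -iteratedDeriv 3 f t / (6 * iteratedDeriv 2 f t ^ 3) * h ^ 3
          + (3 * iteratedDeriv 3 f t ^ 2 / iteratedDeriv 2 f t ^ 5
            - iteratedDeriv 4 f t / iteratedDeriv 2 f t ^ 4) / 24 * h ^ 4)|
        ≤ C * |h| ^ 5 := by
  obtain ⟨C₁, η₁, hη₁, h₁⟩ := exists_taylor_bound hf 5
  obtain ⟨C₂, η₂, hη₂, h₂⟩ := exists_taylor_bound hf.deriv 4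
  simp only [← iteratedDeriv_succ', Finset.sum_range_succ, Finset.sum_range_zero, Nat.factorial,
    iteratedDeriv_zero, iteratedDeriv_one] at h₁ h₂
  norm_num at h₁ h₂
  generalize iteratedDeriv 2 f t = a at *
  generalize iteratedDeriv 3 f t = b at *
  generalize iteratedDeriv 4 f t = c at *
  obtain ⟨Q, hQ, hQe⟩ := exists_legendre_remainder hpos b c
  set C₀ := max |C₁| |C₂| with hC₀
  -- The Taylor remainders ρ and ρ' vary with τ but stay in a fixed interval, so continuity of Q
  -- gives a uniform bound.
  have hcompact : IsCompact (Set.Icc (-1 : ℝ) 1 ×ˢ Set.Icc (-C₀) C₀ ×ˢ Set.Icc (-C₀) C₀) :=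
    isCompact_Icc.prod (isCompact_Icc.prod isCompact_Icc)
  obtain ⟨M, hM⟩ := hcompact.exists_bound_of_continuousOn hQ.continuousOn
  set D := |b / 2| + |c / 6| + C₀ with hD
  have hC₀0 : 0 ≤ C₀ := (abs_nonneg _).trans (le_max_left _ _)
  have hD0 : 0 ≤ D := by positivity
  -- On this radius the higher terms of h/τ amount to at most a/2, so |τ| ≤ (2/a)|h|; this converts
  -- τ⁵ into h⁵.
  refine ⟨|M| * (2 / a) ^ 5, min (min η₁ η₂) (min 1 (a / (2 * (D + 1)))), by positivity,
    by positivity, fun τ hτ h hh => ?_⟩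
  rw [lt_min_iff, lt_min_iff, lt_min_iff] at hτ
  obtain ⟨⟨hτ1, hτ2⟩, hτ3, hτ4⟩ := hτ
  rcases eq_or_ne τ 0 with rfl | hτ0
  · have : h = 0 := by simpa using hh
    simp [this]
  have hτpos : 0 < |τ| := abs_pos.2 hτ0
  have e1 := h₁ τ hτ1
  have e2 := h₂ τ hτ2
  obtain ⟨ρ', hρ'⟩ : ∃ ρ', f (t + τ) - f t - τ * deriv f t =
      a / 2 * τ ^ 2 + b / 6 * τ ^ 3 + c / 24 * τ ^ 4 + ρ' * τ ^ 5 :=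
    ⟨(f (t + τ) - f t - τ * deriv f t - (a / 2 * τ ^ 2 + b / 6 * τ ^ 3 + c / 24 * τ ^ 4)) / τ ^ 5,
      by field_simp; ring⟩
  obtain ⟨ρ, hρ⟩ : ∃ ρ, h = τ * (a + b / 2 * τ + c / 6 * τ ^ 2 + ρ * τ ^ 3) :=
    ⟨(h - τ * (a + b / 2 * τ + c / 6 * τ ^ 2)) / τ ^ 4, by field_simp; ring⟩
  have hρ'C : |ρ'| ≤ C₀ := by
    have : |ρ'| * |τ| ^ 5 ≤ C₁ * |τ| ^ 5 := by
      convert e1 using 1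
      rw [← abs_pow, ← abs_mul]
      congr 1
      linear_combination -hρ'
    exact (le_of_mul_le_mul_right this (by positivity)).trans
      ((le_abs_self _).trans (le_max_left _ _))
  have hρC : |ρ| ≤ C₀ := by
    have : |ρ| * |τ| ^ 4 ≤ C₂ * |τ| ^ 4 := by
      convert e2 using 1
      rw [← abs_pow, ← abs_mul]
      congr 1
      linear_combination -hρ + hh
    exact (le_of_mul_le_mul_right this (by positivity)).trans
      ((le_abs_self _).trans (le_max_right _ _))
  have hQb : |Q (τ, ρ, ρ')| ≤ |M| :=
    (hM (τ, ρ, ρ') ⟨abs_le.1 hτ3.le, abs_le.1 hρC, abs_le.1 hρ'C⟩).trans (le_abs_self _)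
  have hτh : |τ| ≤ 2 / a * |h| := by
    have hg : |b / 2 + c / 6 * τ + ρ * τ ^ 2| ≤ D := by
      refine (abs_add_three _ _ _).trans ?_
      rw [abs_mul, abs_mul, hD, abs_pow]
      have i1 : |c / 6| * |τ| ≤ |c / 6| * 1 := by gcongr
      have i2 : |ρ| * |τ| ^ 2 ≤ C₀ * 1 ^ 2 := by gcongr
      linarith
    have hg' : |τ * (b / 2 + c / 6 * τ + ρ * τ ^ 2)| ≤ a / 2 := by
      rw [abs_mul]
      calc _ ≤ a / (2 * (D + 1)) * D := by gcongr
        _ ≤ a / 2 := by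
          rw [div_mul_eq_mul_div, div_le_div_iff₀ (by positivity) two_pos]
          nlinarith
    have : a / 2 ≤ |a + b / 2 * τ + c / 6 * τ ^ 2 + ρ * τ ^ 3| := by
      have e : a + b / 2 * τ + c / 6 * τ ^ 2 + ρ * τ ^ 3
        = a + τ * (b / 2 + c / 6 * τ + ρ * τ ^ 2) := by ring
      rw [e]
      have := (abs_le.1 hg').1
      exact le_trans (by linarith) (le_abs_self _)
    rw [hρ, abs_mul]
    calc |τ| = 2 / a * (|τ| * (a / 2)) := by field_simp
      _ ≤ _ := by gcongr
  have := hQe τ ρ ρ'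
  rw [← hρ, ← hρ'] at this
  rw [this, abs_mul, abs_pow]
  calc |τ| ^ 5 * |Q (τ, ρ, ρ')| ≤ (2 / a * |h|) ^ 5 * |M| := by gcongr
    _ = _ := by ring

/-! ### Inner points of the convex hull of the support -/

/-- The points that have mass of `ν` on both sides. -/
def innerCore (ν : Measure ℝ) : Set ℝ := {w | ν (Set.Iio w) ≠ 0 ∧ ν (Set.Ioi w) ≠ 0}

section Core

variable {ν : Measure ℝ}

/-- An open ray is a countable union of smaller ones, so positive mass survives when the end point
moves slightly. -/
lemma isOpen_innerCore : IsOpen (innerCore ν) := by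
  have key : ∀ w ∈ innerCore ν, ∃ a b, a < w ∧ w < b ∧ Set.Ioo a b ⊆ innerCore ν := by
    rintro w ⟨h1, h2⟩
    obtain ⟨a, ha, ha'⟩ : ∃ a < w, ν (Set.Iio a) ≠ 0 := by
      by_contra! h
      refine h1 ?_
      refine measure_mono_null (t := ⋃ n : ℕ, Set.Iio (w - 1 / ((n : ℝ) + 1))) (fun x hx => ?_)
        (measure_iUnion_null fun n => h _ (by
          have : 0 < 1 / ((n : ℝ) + 1) := by positivity
          linarith))
      obtain ⟨n, hn⟩ := exists_nat_one_div_lt (show 0 < w - x from sub_pos.2 hx)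
      refine Set.mem_iUnion.2 ⟨n, ?_⟩
      simp only [Set.mem_Iio]
      linarith
    obtain ⟨b, hb, hb'⟩ : ∃ b > w, ν (Set.Ioi b) ≠ 0 := by
      by_contra! h
      refine h2 ?_
      refine measure_mono_null (t := ⋃ n : ℕ, Set.Ioi (w + 1 / ((n : ℝ) + 1))) (fun x hx => ?_)
        (measure_iUnion_null fun n => h _ (by
          have : 0 < 1 / ((n : ℝ) + 1) := by positivity
          linarith))
      obtain ⟨n, hn⟩ := exists_nat_one_div_lt (show 0 < x - w from sub_pos.2 hx)
      refine Set.mem_iUnion.2 ⟨n, ?_⟩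
      simp only [Set.mem_Ioi]
      linarith
    refine ⟨a, b, ha, hb, fun x hx => ⟨fun h => ha' ?_, fun h => hb' ?_⟩⟩
    · exact measure_mono_null (Set.Iio_subset_Iio hx.1.le) h
    · exact measure_mono_null (Set.Ioi_subset_Ioi hx.2.le) h
  rw [isOpen_iff_mem_nhds]
  intro w hw
  obtain ⟨a, b, ha, hb, h⟩ := key w hw
  exact Filter.mem_of_superset (Ioo_mem_nhds ha hb) h

lemma ordConnected_innerCore : (innerCore ν).OrdConnected := by
  refine ⟨fun x hx y hy z hz => ⟨fun h => hx.1 ?_, fun h => hy.2 ?_⟩⟩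
  · exact measure_mono_null (Set.Iio_subset_Iio hz.1) h
  · exact measure_mono_null (Set.Ioi_subset_Ioi hz.2) h

/-- A convex combination of an inner point and a point of the support is an inner point. -/
lemma div_mem_innerCore {w y : ℝ} (hw : w ∈ innerCore ν) (hy : y ∈ ν.support) {t : ℝ}
    (ht : 0 < t) : (t * w + y) / (t + 1) ∈ innerCore ν := by
  have hs := (Measure.mem_support_iff_forall y).1 hy
  have ht1 : 0 < t + 1 := by linarith
  constructor
  · intro h
    rcases le_or_gt w y with hwy | hwy
    · refine hw.1 (measure_mono_null (Set.Iio_subset_Iio ?_) h)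
      rw [le_div_iff₀ ht1]; linarith
    · refine (hs (Set.Iio ((t * w + y) / (t + 1))) (Iio_mem_nhds ?_)).ne' h
      rw [lt_div_iff₀ ht1]; nlinarith
  · intro h
    rcases le_or_gt y w with hwy | hwy
    · refine hw.2 (measure_mono_null (Set.Ioi_subset_Ioi ?_) h)
      rw [div_le_iff₀ ht1]; linarith
    · refine (hs (Set.Ioi ((t * w + y) / (t + 1))) (Ioi_mem_nhds ?_)).ne' h
      rw [div_lt_iff₀ ht1]; nlinarith

/-- A measure concentrated at a point has no inner points. -/
lemma not_ae_eq_of_mem_innerCore {w : ℝ} (hw : w ∈ innerCore ν) (c : ℝ) :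
    ¬ ∀ᵐ x ∂ν, x = c := by
  intro h
  rcases le_or_gt w c with hwc | hwc
  · refine hw.1 (measure_mono_null ?_ h)
    intro x hx
    exact (lt_of_lt_of_le hx hwc).ne
  · refine hw.2 (measure_mono_null ?_ h)
    intro x hx
    exact (hwc.trans hx).ne'

end Core

/-! ### Exponentially tilted measures and their cumulants -/

section Family

variable {ν : Measure ℝ}

lemma integrable_exp_mul {t : ℝ} (ht : t ∈ integrableExpSet id ν) :
    Integrable (fun x => Real.exp (t * x)) ν := ht

lemma isProbabilityMeasure_tilt [NeZero ν] {t : ℝ} (ht : t ∈ integrableExpSet id ν) :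
    IsProbabilityMeasure (ν.tilted fun x => t * x) :=
  isProbabilityMeasure_tilted (integrable_exp_mul ht)

lemma integral_exp_mul [NeZero ν] {t : ℝ} (ht : t ∈ integrableExpSet id ν) :
    ∫ x, Real.exp (t * x) ∂ν = Real.exp (cgf id ν t) :=
  (exp_cgf (X := id) ht).symm

lemma integrable_exp_tilt {s t : ℝ} (hs : s ∈ integrableExpSet id ν)
    (ht : t ∈ integrableExpSet id ν) :
    Integrable (fun x => Real.exp ((s - t) * x)) (ν.tilted fun x => t * x) := by
  rw [integrable_tilted_iff (integrable_exp_mul ht)]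
  refine (integrable_exp_mul hs).congr (ae_of_all _ fun x => ?_)
  simp only [smul_eq_mul, ← Real.exp_add]
  congr 1
  ring

/-- Gibbs' inequality: the parameter with mean `w` maximizes `s ↦ s w - A s`. -/
lemma sub_mul_mean_le [NeZero ν] {s t w : ℝ} (hs : s ∈ integrableExpSet id ν)
    (ht : t ∈ integrableExpSet id ν) (hi : Integrable id (ν.tilted fun x => t * x))
    (hw : ∫ x, x ∂(ν.tilted fun x => t * x) = w) :
    (s - t) * w ≤ cgf id ν s - cgf id ν t := by
  have := isProbabilityMeasure_tilt ht
  set P := ν.tilted fun x => t * x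
  set B := cgf id ν s - cgf id ν t with hB
  have h1 : ∫ x, Real.exp ((s - t) * x) ∂P = Real.exp B := by
    rw [integral_exp_tilted (fun x => t * x) (fun x => (s - t) * x), integral_exp_mul ht, hB,
      Real.exp_sub, ← integral_exp_mul hs]
    congr 2
    ext x
    simp only [Pi.add_apply]
    congr 1
    ring
  have hi' : Integrable (fun x : ℝ => x) P := hi
  -- Integrate 1 + z ≤ exp z with z = (s - t)x - B, where B makes the right side integrate to 1.
  -- Only the mean at t must exist; t need not be an interior parameter.
  have h2 : ∫ x, ((s - t) * x - B + 1) ∂P ≤ ∫ x, Real.exp ((s - t) * x) * Real.exp (-B) ∂P := by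
    refine integral_mono (((hi'.const_mul _).sub (integrable_const B)).add (integrable_const 1))
      ((integrable_exp_tilt hs ht).mul_const _) fun x => ?_
    simp only [← Real.exp_add]
    have := Real.add_one_le_exp ((s - t) * x + -B)
    linarith
  have h3 : ∫ x, ((s - t) * x - B + 1) ∂P = (s - t) * w - B + 1 := by
    rw [integral_add (f := fun x => (s - t) * x - B) ((hi'.const_mul _).sub (integrable_const B))
      (integrable_const 1), integral_sub (hi'.const_mul _) (integrable_const B),
      integral_const_mul, hw]
    simp
  rw [integral_mul_const, h1, ← Real.exp_add, add_neg_cancel, Real.exp_zero, h3] at h2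
  linarith

lemma integrable_pow_tilt {t : ℝ} (ht : t ∈ interior (integrableExpSet id ν)) (i : ℕ) :
    Integrable (fun x => x ^ i) (ν.tilted fun x => t * x) := by
  rw [integrable_tilted_iff (integrable_exp_mul (interior_subset ht))]
  refine (integrable_pow_mul_exp_of_mem_interior_integrableExpSet ht i).congr
    (ae_of_all _ fun x => ?_)
  simp [mul_comm]

lemma integrable_id_tilt {t : ℝ} (ht : t ∈ interior (integrableExpSet id ν)) :
    Integrable id (ν.tilted fun x => t * x) := by
  have := integrable_pow_tilt ht 1
  simp only [pow_one] at this
  exact this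

lemma integral_tilt {t : ℝ} (ht : t ∈ interior (integrableExpSet id ν)) :
    ∫ x, x ∂(ν.tilted fun x => t * x) = deriv (cgf id ν) t :=
  integral_tilted_mul_self ht

lemma variance_tilt {t : ℝ} (ht : t ∈ interior (integrableExpSet id ν)) :
    variance id (ν.tilted fun x => t * x) = iteratedDeriv 2 (cgf id ν) t :=
  variance_tilted_mul ht

lemma hasDerivAt_cumulant {t : ℝ} (ht : t ∈ interior (integrableExpSet id ν)) (i : ℕ) :
    HasDerivAt (iteratedDeriv i (cgf id ν)) (iteratedDeriv (i + 1) (cgf id ν) t) t := by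
  rw [iteratedDeriv_succ]
  have := (analyticAt_cgf ht).iterated_deriv i
  rw [← iteratedDeriv_eq_iterate] at this
  exact this.differentiableAt.hasDerivAt

/-- A vanishing variance would concentrate the tilted measure, and hence ν, at one point, which an
inner point excludes. -/
lemma cumulant_two_pos [NeZero ν] {t w : ℝ} (hw : w ∈ innerCore ν)
    (ht : t ∈ interior (integrableExpSet id ν)) : 0 < iteratedDeriv 2 (cgf id ν) t := by
  have := isProbabilityMeasure_tilt (interior_subset ht)
  rw [← variance_tilt ht]
  refine (variance_nonneg _ _).lt_of_ne fun h => ?_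
  have hm : MemLp id 2 (ν.tilted fun x => t * x) := memLp_tilted_mul ht 2
  have he : eVar[id; ν.tilted fun x => t * x] = 0 := by
    rw [← hm.ofReal_variance_eq, ← h, ENNReal.ofReal_zero]
  rw [evariance_eq_zero_iff aemeasurable_id] at he
  exact not_ae_eq_of_mem_innerCore hw _
    ((absolutelyContinuous_tilted (integrable_exp_mul (interior_subset ht))).ae_le he)

lemma convex_interior : Convex ℝ (interior (integrableExpSet id ν)) :=
  convex_integrableExpSet.interior

lemma strictMonoOn_mean [NeZero ν] {w : ℝ} (hw : w ∈ innerCore ν) :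
    StrictMonoOn (deriv (cgf id ν)) (interior (integrableExpSet id ν)) := by
  refine strictMonoOn_of_deriv_pos convex_interior ?_ fun t ht => ?_
  · intro t ht
    have := (hasDerivAt_cumulant ht 1).continuousAt
    rw [iteratedDeriv_one] at this
    exact this.continuousWithinAt
  · rw [interior_interior] at ht
    have := cumulant_two_pos hw ht
    rwa [iteratedDeriv_succ, iteratedDeriv_one] at this

lemma exists_integrable_exp_abs {t : ℝ} (ht : t ∈ interior (integrableExpSet id ν)) (w : ℝ) :
    ∃ b > 0, Integrable (fun y => Real.exp (b * |y - w|)) (ν.tilted fun x => t * x) := by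
  obtain ⟨b, hb, hball⟩ := Metric.isOpen_iff.1 isOpen_interior t ht
  have hp : t + b / 2 ∈ integrableExpSet id ν := interior_subset (hball (by
    rw [Metric.mem_ball, Real.dist_eq]; simp [abs_of_pos (half_pos hb), hb]))
  have hm : t - b / 2 ∈ integrableExpSet id ν := interior_subset (hball (by
    rw [Metric.mem_ball, Real.dist_eq]; simp [abs_of_pos (half_pos hb), hb]))
  refine ⟨b / 2, half_pos hb, ?_⟩
  rw [integrable_tilted_iff (integrable_exp_mul (interior_subset ht))]
  have := (integrable_exp_mul_abs_add (X := id) hp hm).const_mul (Real.exp (b / 2 * |w|))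
  refine this.mono' (by fun_prop) (ae_of_all _ fun y => ?_)
  rw [Real.norm_of_nonneg (by positivity), smul_eq_mul, ← Real.exp_add, ← Real.exp_add]
  refine Real.exp_le_exp.2 ?_
  have : b / 2 * |y - w| ≤ b / 2 * (|y| + |w|) := by gcongr; exact abs_sub y w
  simp only [id]
  linarith

end Family

/-! ### Moments in terms of cumulants -/

section Moments

variable {ν : Measure ℝ}

/-- Moments of the tilted measure satisfy the recursion `m (i+1) = m i ' + m 1 m i`. -/
lemma hasDerivAt_moment [NeZero ν] {t : ℝ} (ht : t ∈ interior (integrableExpSet id ν)) (i : ℕ) :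
    HasDerivAt (fun s => iteratedDeriv i (mgf id ν) s / mgf id ν s)
      (iteratedDeriv (i + 1) (mgf id ν) t / mgf id ν t
        - iteratedDeriv 1 (cgf id ν) t * (iteratedDeriv i (mgf id ν) t / mgf id ν t)) t := by
  have h0 : mgf id ν t ≠ 0 := (mgf_pos' (X := id) (NeZero.ne ν) (integrable_exp_mul (interior_subset ht))).ne'
  have h1 := hasDerivAt_iteratedDeriv_mgf ht i
  have h2 := hasDerivAt_mgf ht
  refine (h1.div h2 h0).congr_deriv ?_
  rw [iteratedDeriv_one, deriv_cgf ht, iteratedDeriv_mgf ht (i + 1)]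
  field_simp

lemma integral_pow_tilt {t : ℝ} (ht : t ∈ interior (integrableExpSet id ν)) (i : ℕ) :
    ∫ x, x ^ i ∂(ν.tilted fun x => t * x) = iteratedDeriv i (mgf id ν) t / mgf id ν t := by
  have := integral_tilted_mul_eq_mgf (μ := ν) (X := id) (t := t) (fun x => x ^ i)
  simp only [id] at this
  rw [this, iteratedDeriv_mgf ht i, ← integral_div]
  congr 1
  ext x
  simp only [smul_eq_mul, id]
  ring

/-- Turns a formula for the i-th moment, valid on the whole open parameter set, into one for the
next moment by differentiation. -/
lemma moment_succ [NeZero ν] {i : ℕ} {q : ℝ → ℝ} {d t : ℝ}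
    (hq : ∀ s ∈ interior (integrableExpSet id ν), ∫ x, x ^ i ∂(ν.tilted fun x => s * x) = q s)
    (ht : t ∈ interior (integrableExpSet id ν)) (hd : HasDerivAt q d t) :
    ∫ x, x ^ (i + 1) ∂(ν.tilted fun x => t * x) = d + iteratedDeriv 1 (cgf id ν) t * q t := by
  have h := hasDerivAt_moment ht i
  have e : q =ᶠ[nhds t] (fun s => iteratedDeriv i (mgf id ν) s / mgf id ν s) :=
    Filter.eventuallyEq_of_mem (isOpen_interior.mem_nhds ht) fun s hs =>
      (hq s hs).symm.trans (integral_pow_tilt hs i)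
  have := hd.unique (h.congr_of_eventuallyEq e)
  rw [integral_pow_tilt ht, this, e.eq_of_nhds]
  ring


/-- The raw moments of the tilted measure in terms of cumulants. -/
lemma integral_pow_tilt_eq [NeZero ν] {k : ℕ → ℝ → ℝ}
    (hk : ∀ i, k i = iteratedDeriv i (cgf id ν)) {t : ℝ}
    (ht : t ∈ interior (integrableExpSet id ν)) :
    ∫ x, x ^ 1 ∂(ν.tilted fun x => t * x) = k 1 t ∧
    ∫ x, x ^ 2 ∂(ν.tilted fun x => t * x) = k 2 t + k 1 t ^ 2 ∧
    ∫ x, x ^ 3 ∂(ν.tilted fun x => t * x) = k 3 t + 3 * (k 1 t * k 2 t) + k 1 t ^ 3 ∧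
    ∫ x, x ^ 4 ∂(ν.tilted fun x => t * x) = k 4 t + 4 * (k 1 t * k 3 t) + 3 * k 2 t ^ 2
      + 6 * (k 1 t ^ 2 * k 2 t) + k 1 t ^ 4 ∧
    ∫ x, x ^ 5 ∂(ν.tilted fun x => t * x) = k 5 t + 5 * (k 1 t * k 4 t) + 10 * (k 2 t * k 3 t)
      + 10 * (k 1 t ^ 2 * k 3 t) + 15 * (k 1 t * k 2 t ^ 2) + 10 * (k 1 t ^ 3 * k 2 t)
      + k 1 t ^ 5 ∧
    ∫ x, x ^ 6 ∂(ν.tilted fun x => t * x) = k 6 t + 6 * (k 1 t * k 5 t) + 15 * (k 2 t * k 4 t)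
      + 15 * (k 1 t ^ 2 * k 4 t) + 10 * k 3 t ^ 2 + 60 * (k 1 t * k 2 t * k 3 t)
      + 20 * (k 1 t ^ 3 * k 3 t) + 15 * k 2 t ^ 3 + 45 * (k 1 t ^ 2 * k 2 t ^ 2)
      + 15 * (k 1 t ^ 4 * k 2 t) + k 1 t ^ 6 := by
  have d : ∀ i, ∀ s ∈ interior (integrableExpSet id ν), HasDerivAt (k i) (k (i + 1) s) s := by
    intro i s hs
    rw [hk, hk]
    exact hasDerivAt_cumulant hs i
  have m1 : ∀ s ∈ interior (integrableExpSet id ν),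
      ∫ x, x ^ 1 ∂(ν.tilted fun x => s * x) = k 1 s := by
    intro s hs
    simp only [pow_one, hk, iteratedDeriv_one]
    exact integral_tilt hs
  have m2 : ∀ s ∈ interior (integrableExpSet id ν),
      ∫ x, x ^ 2 ∂(ν.tilted fun x => s * x) = k 2 s + k 1 s ^ 2 := by
    intro s hs
    rw [moment_succ m1 hs (d 1 s hs), ← hk]
    ring
  have m3 : ∀ s ∈ interior (integrableExpSet id ν),
      ∫ x, x ^ 3 ∂(ν.tilted fun x => s * x) = k 3 s + 3 * (k 1 s * k 2 s) + k 1 s ^ 3 := by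
    intro s hs
    rw [moment_succ m2 hs ((d 2 s hs).add ((d 1 s hs).pow 2)), ← hk]
    norm_num
    ring
  have m4 : ∀ s ∈ interior (integrableExpSet id ν),
      ∫ x, x ^ 4 ∂(ν.tilted fun x => s * x) = k 4 s + 4 * (k 1 s * k 3 s) + 3 * k 2 s ^ 2
      + 6 * (k 1 s ^ 2 * k 2 s) + k 1 s ^ 4 := by
    intro s hs
    rw [moment_succ m3 hs (((d 3 s hs).add (((d 1 s hs).mul (d 2 s hs)).const_mul 3)).add
      ((d 1 s hs).pow 3)), ← hk]
    norm_num
    ring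
  have m5 : ∀ s ∈ interior (integrableExpSet id ν),
      ∫ x, x ^ 5 ∂(ν.tilted fun x => s * x) = k 5 s + 5 * (k 1 s * k 4 s) + 10 * (k 2 s * k 3 s)
      + 10 * (k 1 s ^ 2 * k 3 s) + 15 * (k 1 s * k 2 s ^ 2) + 10 * (k 1 s ^ 3 * k 2 s)
      + k 1 s ^ 5 := by
    intro s hs
    rw [moment_succ m4 hs (((((d 4 s hs).add (((d 1 s hs).mul (d 3 s hs)).const_mul 4)).add
      (((d 2 s hs).pow 2).const_mul 3)).add
      ((((d 1 s hs).pow 2).mul (d 2 s hs)).const_mul 6)).add ((d 1 s hs).pow 4)), ← hk]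
    norm_num
    ring
  refine ⟨m1 t ht, m2 t ht, m3 t ht, m4 t ht, m5 t ht, ?_⟩
  rw [moment_succ m5 ht (((((((d 5 t ht).add (((d 1 t ht).mul (d 4 t ht)).const_mul 5)).add
    (((d 2 t ht).mul (d 3 t ht)).const_mul 10)).add
    ((((d 1 t ht).pow 2).mul (d 3 t ht)).const_mul 10)).add
    (((d 1 t ht).mul ((d 2 t ht).pow 2)).const_mul 15)).add
    ((((d 1 t ht).pow 3).mul (d 2 t ht)).const_mul 10)).add ((d 1 t ht).pow 5)), ← hk]
  norm_num
  ring

/-- Central moments from raw moments. -/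
lemma integral_sub_pow_tilt {t : ℝ} (ht : t ∈ interior (integrableExpSet id ν)) (w : ℝ) (i : ℕ) :
    ∫ x, (x - w) ^ i ∂(ν.tilted fun x => t * x) = ∑ m ∈ Finset.range (i + 1),
      (∫ x, x ^ m ∂(ν.tilted fun x => t * x)) * (-w) ^ (i - m) * (i.choose m) := by
  simp_rw [sub_eq_add_neg, add_pow]
  rw [integral_finsetSum _ fun m _ =>
    ((integrable_pow_tilt ht m).mul_const _).mul_const _]
  simp_rw [integral_mul_const]

lemma integrable_sub_pow_tilt {t : ℝ} (ht : t ∈ interior (integrableExpSet id ν)) (w : ℝ) (i : ℕ) :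
    Integrable (fun x => (x - w) ^ i) (ν.tilted fun x => t * x) := by
  simp_rw [sub_eq_add_neg, add_pow]
  exact integrable_finsetSum _ fun m _ =>
    ((integrable_pow_tilt ht m).mul_const _).mul_const _

/-- Explains the form of `coeffTwo` and `coeffThree`: the inserted constants are the Legendre
coefficients, and the powers of y - k 1 become central moments written in cumulants. -/
lemma integral_expPoly_tilt [NeZero ν] {k : ℕ → ℝ → ℝ}
    (hk : ∀ i, k i = iteratedDeriv i (cgf id ν)) {t : ℝ}
    (ht : t ∈ interior (integrableExpSet id ν)) (hpos : 0 < k 2 t) (x : ℝ) :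
    ∫ y, expPoly (1 / (2 * k 2 t)) (-k 3 t / (6 * k 2 t ^ 3))
        ((3 * k 3 t ^ 2 / k 2 t ^ 5 - k 4 t / k 2 t ^ 4) / 24) x (y - k 1 t)
        ∂(ν.tilted fun x => t * x) =
      1 + 1 / 2 * x + coeffTwo (k 2 t) (k 3 t) (k 4 t) * x ^ 2
        + coeffThree (k 2 t) (k 3 t) (k 4 t) (k 5 t) (k 6 t) * x ^ 3 := by
  have := isProbabilityMeasure_tilt (interior_subset ht)
  obtain ⟨m1, m2, m3, m4, m5, m6⟩ := integral_pow_tilt_eq hk ht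
  have m0 : ∫ x, x ^ 0 ∂(ν.tilted fun x => t * x) = 1 := by simp
  have c2 : ∫ y, (y - k 1 t) ^ 2 ∂(ν.tilted fun x => t * x) = k 2 t := by
    rw [integral_sub_pow_tilt ht]
    simp only [Finset.sum_range_succ, Finset.sum_range_zero, m0, m1, m2]
    norm_num [Nat.choose]
    ring
  have c3 : ∫ y, (y - k 1 t) ^ 3 ∂(ν.tilted fun x => t * x) = k 3 t := by
    rw [integral_sub_pow_tilt ht]
    simp only [Finset.sum_range_succ, Finset.sum_range_zero, m0, m1, m2, m3]
    norm_num [Nat.choose]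
    ring
  have c4 : ∫ y, (y - k 1 t) ^ 4 ∂(ν.tilted fun x => t * x) = k 4 t + 3 * k 2 t ^ 2 := by
    rw [integral_sub_pow_tilt ht]
    simp only [Finset.sum_range_succ, Finset.sum_range_zero, m0, m1, m2, m3, m4]
    norm_num [Nat.choose]
    ring
  have c5 : ∫ y, (y - k 1 t) ^ 5 ∂(ν.tilted fun x => t * x) = k 5 t + 10 * k 2 t * k 3 t := by
    rw [integral_sub_pow_tilt ht]
    simp only [Finset.sum_range_succ, Finset.sum_range_zero, m0, m1, m2, m3, m4, m5]
    norm_num [Nat.choose]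
    ring
  have c6 : ∫ y, (y - k 1 t) ^ 6 ∂(ν.tilted fun x => t * x) =
      k 6 t + 10 * k 3 t ^ 2 + 15 * k 2 t * k 4 t + 15 * k 2 t ^ 3 := by
    rw [integral_sub_pow_tilt ht]
    simp only [Finset.sum_range_succ, Finset.sum_range_zero, m0, m1, m2, m3, m4, m5, m6]
    norm_num [Nat.choose]
    ring
  have i := integrable_sub_pow_tilt ht (k 1 t)
  rw [coeffTwo, coeffThree]
  generalize hC₂ : 1 / (2 * k 2 t) = C₂
  generalize -k 3 t / (6 * k 2 t ^ 3) = C₃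
  generalize (3 * k 3 t ^ 2 / k 2 t ^ 5 - k 4 t / k 2 t ^ 4) / 24 = C₄
  have e : ∀ y, expPoly C₂ C₃ C₄ x (y - k 1 t) = 1 + ∑ j : Fin 6,
      (![C₂ * x, C₃ * x ^ 2, C₂ ^ 2 / 2 * x ^ 2 + C₄ * x ^ 3, C₂ * C₃ * x ^ 3,
        C₂ ^ 3 / 6 * x ^ 3, 0] j) * (y - k 1 t) ^ ((j : ℕ) + 2) := by
    intro y
    rw [expPoly]
    simp [Fin.sum_univ_succ]
    ring
  simp_rw [e]
  rw [integral_add (integrable_const _) (integrable_finsetSum _ fun j _ => (i _).const_mul _),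
    integral_finsetSum _ fun j _ => (i _).const_mul _]
  simp_rw [integral_const_mul]
  simp [Fin.sum_univ_succ, c2, c3, c4, c5, c6]
  -- The coefficient of x is 1/2 for every member, so the first order carries no information about
  -- the family.
  have : C₂ * k 2 t = 1 / 2 := by rw [← hC₂]; field_simp
  linear_combination x * this

end Moments

/-! ### The profile likelihood -/

/-- The maximized likelihood `sup_{t ∈ T} exp (t s - n A t)` of `n` observations with sum `s`. -/
def profile (A : ℝ → ℝ) (T : Set ℝ) (n : ℕ) (s : ℝ) : ℝ≥0∞ :=
  ⨆ t ∈ T, ENNReal.ofReal (Real.exp (t * s - n * A t))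

section Profile

variable {A : ℝ → ℝ} {T : Set ℝ}

lemma measurable_profile {n : ℕ} {f : ℝ → ℝ} (hf : Continuous f) :
    Measurable (fun y => profile A T n (f y)) := by
  refine LowerSemicontinuous.measurable ?_
  refine lowerSemicontinuous_biSup fun t _ => Continuous.lowerSemicontinuous ?_
  exact ENNReal.continuous_ofReal.comp (by fun_prop)

lemma le_profile {n : ℕ} {s t : ℝ} (ht : t ∈ T) :
    ENNReal.ofReal (Real.exp (t * s - n * A t)) ≤ profile A T n s :=
  le_iSup₂ (f := fun t (_ : t ∈ T) => ENNReal.ofReal (Real.exp (t * s - n * A t))) t ht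

/-- The hypothesis `hg` is Gibbs' inequality for a member t with mean v = s/n, which is then the
maximum likelihood point. -/
lemma profile_eq {n : ℕ} {s t v : ℝ} (ht : t ∈ T) (hs : s = n * v)
    (hg : ∀ r ∈ T, (r - t) * v ≤ A r - A t) :
    profile A T n s = ENNReal.ofReal (Real.exp (t * s - n * A t)) := by
  refine le_antisymm (iSup₂_le fun r hr => ENNReal.ofReal_le_ofReal (Real.exp_le_exp.2 ?_))
    (le_profile ht)
  have := mul_le_mul_of_nonneg_left (hg r hr) (Nat.cast_nonneg (α := ℝ) n)
  rw [hs]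
  linarith

/-- For each t the exponent is monotone in s, in the direction given by the sign of t. This carries
finiteness of the integrals from the points a and b to every mean between them. -/
lemma profile_le_add {n : ℕ} {s₁ s s₂ : ℝ} (h₁ : s₁ ≤ s) (h₂ : s ≤ s₂) :
    profile A T n s ≤ profile A T n s₁ + profile A T n s₂ := by
  refine iSup₂_le fun t ht => ?_
  rcases le_total 0 t with h | h
  · refine le_trans (ENNReal.ofReal_le_ofReal (Real.exp_le_exp.2 ?_))
      ((le_profile ht).trans le_add_self)
    have := mul_le_mul_of_nonneg_left h₂ h
    linarith
  · refine le_trans (ENNReal.ofReal_le_ofReal (Real.exp_le_exp.2 ?_))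
      ((le_profile ht).trans le_self_add)
    have := mul_le_mul_of_nonpos_left h₁ h
    linarith

end Profile

/-! ### Divergence between members of the family -/

section Gap

variable {ν : Measure ℝ} {t₀ : ℝ}

lemma continuousAt_mean (ht : t₀ ∈ interior (integrableExpSet id ν)) :
    ContinuousAt (deriv (cgf id ν)) t₀ := by
  have := (hasDerivAt_cumulant ht 1).continuousAt
  rwa [iteratedDeriv_one] at this

lemma exists_mem_interior_of_mean_close (ht₀ : t₀ ∈ interior (integrableExpSet id ν)) {ε η : ℝ}
    (hε : 0 < ε) (hη : 0 < η) :
    ∃ a b, a < t₀ ∧ t₀ < b ∧ t₀ - η < a ∧ b < t₀ + η ∧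
      a ∈ interior (integrableExpSet id ν) ∧ b ∈ interior (integrableExpSet id ν) ∧
      |deriv (cgf id ν) a - deriv (cgf id ν) t₀| < ε ∧
      |deriv (cgf id ν) b - deriv (cgf id ν) t₀| < ε := by
  have h1 : ∀ᶠ t in nhds t₀, t ∈ interior (integrableExpSet id ν) ∧
      |deriv (cgf id ν) t - deriv (cgf id ν) t₀| < ε := by
    refine (isOpen_interior.eventually_mem ht₀).and ?_
    exact (continuousAt_mean ht₀).eventually (Metric.ball_mem_nhds _ hε)
  obtain ⟨d, hd, h⟩ := Metric.eventually_nhds_iff.1 h1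
  set c := min d η / 2 with hc
  have hc0 : 0 < c := by positivity
  have hcd : c < d := by
    have := min_le_left d η; rw [hc]; linarith
  have hcη : c < η := by
    have := min_le_right d η; rw [hc]; linarith
  have ha := @h (t₀ - c) (by rw [Real.dist_eq]; simpa [abs_of_pos hc0] using hcd)
  have hb := @h (t₀ + c) (by rw [Real.dist_eq]; simpa [abs_of_pos hc0] using hcd)
  exact ⟨t₀ - c, t₀ + c, by linarith, by linarith, by linarith, by linarith, ha.1, hb.1, ha.2, hb.2⟩

variable [NeZero ν]

lemma gibbs {s t : ℝ} (hs : s ∈ integrableExpSet id ν)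
    (ht : t ∈ interior (integrableExpSet id ν)) :
    (s - t) * deriv (cgf id ν) t ≤ cgf id ν s - cgf id ν t :=
  sub_mul_mean_le hs (interior_subset ht) (integrable_id_tilt ht) (integral_tilt ht)

/-- Gibbs' inequality at t₀ and at the midpoint r gives at least (t - r)(A' r - A' t₀), which is
positive because the mean is strictly increasing. -/
lemma bregman_pos (hw : deriv (cgf id ν) t₀ ∈ innerCore ν)
    (ht₀ : t₀ ∈ interior (integrableExpSet id ν)) {t : ℝ}
    (ht : t ∈ interior (integrableExpSet id ν)) (hne : t ≠ t₀) :
    0 < cgf id ν t - cgf id ν t₀ - (t - t₀) * deriv (cgf id ν) t₀ := by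
  have hmono := strictMonoOn_mean hw
  set r := (t + t₀) / 2 with hr
  have hrI : r ∈ interior (integrableExpSet id ν) := by
    have := convex_interior ht ht₀ (a := 1 / 2) (b := 1 / 2) (by norm_num) (by norm_num) (by norm_num)
    convert this using 1
    simp only [smul_eq_mul, hr]
    ring
  have g1 := gibbs (interior_subset ht) hrI
  have g2 := gibbs (interior_subset hrI) ht₀
  have : 0 < (t - r) * (deriv (cgf id ν) r - deriv (cgf id ν) t₀) := by
    rcases lt_or_gt_of_ne hne with h | h
    · have := hmono hrI ht₀ (by rw [hr]; linarith)
      exact mul_pos_of_neg_of_neg (by rw [hr]; linarith) (by linarith)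
    · have := hmono ht₀ hrI (by rw [hr]; linarith)
      exact mul_pos (by rw [hr]; linarith) (by linarith)
  linarith

/-- Past a point b > t₀ the tangent of A at b is steeper than the one at t₀, so the gap is at least
its value at b; likewise below t₀. This yields exponential decay outside the window of the Laplace
argument. -/
lemma exists_bregman_gap (hw : deriv (cgf id ν) t₀ ∈ innerCore ν)
    (ht₀ : t₀ ∈ interior (integrableExpSet id ν)) {ε : ℝ} (hε : 0 < ε) :
    ∃ δ > 0, ∀ τ ∈ interior (integrableExpSet id ν),
      ε < |deriv (cgf id ν) τ - deriv (cgf id ν) t₀| →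
      δ ≤ cgf id ν τ - cgf id ν t₀ - (τ - t₀) * deriv (cgf id ν) t₀ := by
  obtain ⟨a, b, ha, hb, -, -, haI, hbI, ha', hb'⟩ :=
    exists_mem_interior_of_mean_close ht₀ hε one_pos
  have hmono := strictMonoOn_mean hw
  have pa := bregman_pos hw ht₀ haI ha.ne
  have pb := bregman_pos hw ht₀ hbI hb.ne'
  refine ⟨_, lt_min pa pb, fun τ hτ h => ?_⟩
  rw [abs_lt] at ha' hb'
  rcases lt_abs.1 h with h | h
  · have hτb : b < τ := (hmono.lt_iff_lt hbI hτ).1 (by linarith)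
    refine (min_le_right _ _).trans ?_
    have g := gibbs (interior_subset hτ) hbI
    have := hmono ht₀ hbI hb
    nlinarith
  · have hτa : τ < a := (hmono.lt_iff_lt hτ haI).1 (by linarith)
    refine (min_le_left _ _).trans ?_
    have g := gibbs (interior_subset hτ) haI
    have := hmono haI ht₀ ha
    nlinarith

/-- Monotonicity of the mean turns the condition that τ is near t₀ into one on h, which is what the
Laplace argument controls. -/
lemma exists_local_expansion (hw : deriv (cgf id ν) t₀ ∈ innerCore ν)
    (ht₀ : t₀ ∈ interior (integrableExpSet id ν)) {k : ℕ → ℝ → ℝ}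
    (hk : ∀ i, k i = iteratedDeriv i (cgf id ν)) :
    ∃ ε > 0, ∃ C ≥ 0, ∀ τ ∈ interior (integrableExpSet id ν), ∀ h,
      h = deriv (cgf id ν) τ - deriv (cgf id ν) t₀ → |h| ≤ ε →
      |(τ - t₀) * h - (cgf id ν τ - cgf id ν t₀ - (τ - t₀) * deriv (cgf id ν) t₀)
        - (1 / (2 * k 2 t₀) * h ^ 2 + -k 3 t₀ / (6 * k 2 t₀ ^ 3) * h ^ 3
          + (3 * k 3 t₀ ^ 2 / k 2 t₀ ^ 5 - k 4 t₀ / k 2 t₀ ^ 4) / 24 * h ^ 4)| ≤ C * |h| ^ 5 := by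
  simp only [hk]
  obtain ⟨C, η, hC, hη, h⟩ := exists_legendre_expansion (analyticAt_cgf ht₀) (cumulant_two_pos hw ht₀)
  obtain ⟨a, b, ha, hb, ha1, hb1, haI, hbI, -, -⟩ :=
    exists_mem_interior_of_mean_close ht₀ one_pos hη
  have hmono := strictMonoOn_mean hw
  have ma := hmono haI ht₀ ha
  have mb := hmono ht₀ hbI hb
  set w := deriv (cgf id ν) t₀
  refine ⟨min (w - deriv (cgf id ν) a) (deriv (cgf id ν) b - w), lt_min (by linarith)
    (by linarith), C, hC, fun τ hτ u hu huε => ?_⟩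
  have h1 := (abs_le.1 (huε.trans (min_le_left _ _))).1
  have h2 := (abs_le.1 (huε.trans (min_le_right _ _))).2
  have hτa : a ≤ τ := (hmono.le_iff_le haI hτ).1 (by linarith)
  have hτb : τ ≤ b := (hmono.le_iff_le hτ hbI).1 (by linarith)
  have := h (τ - t₀) (abs_lt.2 ⟨by linarith, by linarith⟩) u (by rw [hu]; congr 2; ring)
  rwa [add_sub_cancel] at this

end Gap

/-! ### Expansion of the normalized Shtarkov integral -/

section Asymptotics

variable {ν : Measure ℝ} [NeZero ν] {T : Set ℝ} {t₀ a b : ℝ} {m : ℕ}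

/-- Expansion of the normalized Shtarkov integral given `n - 1` observations with fixed mean. -/
theorem exists_shtarkov_expansion (hT : T ⊆ integrableExpSet id ν)
    (hsurj : ∀ v ∈ innerCore ν, ∃ τ ∈ T, τ ∈ interior (integrableExpSet id ν) ∧
      deriv (cgf id ν) τ = v)
    (ht₀ : t₀ ∈ interior (integrableExpSet id ν))
    (hw : deriv (cgf id ν) t₀ ∈ innerCore ν)
    (ha : a ≤ deriv (cgf id ν) t₀) (hb : deriv (cgf id ν) t₀ ≤ b)
    (hfa : ∫⁻ y, profile (cgf id ν) T (m + 1) (m * a + y) ∂ν ≠ ∞)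
    (hfb : ∫⁻ y, profile (cgf id ν) T (m + 1) (m * b + y) ∂ν ≠ ∞)
    {k : ℕ → ℝ → ℝ} (hk : ∀ i, k i = iteratedDeriv i (cgf id ν)) :
    ∃ K, ∀ n : ℕ, m + 2 ≤ n →
      |(∫⁻ y, profile (cgf id ν) T n ((n - 1) * deriv (cgf id ν) t₀ + y) ∂ν).toReal
          * Real.exp (-((n - 1) * (t₀ * deriv (cgf id ν) t₀ - cgf id ν t₀)))
        - (1 + 1 / 2 * (n : ℝ)⁻¹ + coeffTwo (k 2 t₀) (k 3 t₀) (k 4 t₀) * (n : ℝ)⁻¹ ^ 2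
          + coeffThree (k 2 t₀) (k 3 t₀) (k 4 t₀) (k 5 t₀) (k 6 t₀) * (n : ℝ)⁻¹ ^ 3)|
        ≤ K * (n : ℝ)⁻¹ ^ 4 := by
  have hP := isProbabilityMeasure_tilt (interior_subset ht₀)
  have hkpos : 0 < k 2 t₀ := by rw [hk]; exact cumulant_two_pos hw ht₀
  obtain ⟨ε, hε, C, hC, hloc⟩ := exists_local_expansion hw ht₀ hk
  have hgap := fun {ε : ℝ} (hε : 0 < ε) => exists_bregman_gap hw ht₀ hε
  have hk1 : deriv (cgf id ν) t₀ = k 1 t₀ := by rw [hk, iteratedDeriv_one]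
  have hpoly := integral_expPoly_tilt hk ht₀ hkpos
  rw [← hk1] at hpoly
  set w := deriv (cgf id ν) t₀
  set A := cgf id ν with hA
  -- the maximum likelihood point and the value of the profile
  have hmle : ∀ n : ℕ, 2 ≤ n → ∀ y ∈ ν.support, ∃ τ ∈ T, τ ∈ interior (integrableExpSet id ν) ∧
      deriv A τ = w + (y - w) / n ∧ profile A T n ((n - 1) * w + y) =
        ENNReal.ofReal (Real.exp (τ * ((n - 1) * w + y) - n * A τ)) := by
    intro n hn y hy
    have hn' : (2 : ℝ) ≤ n := by exact_mod_cast hn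
    -- Averaging n - 1 observations of inner mean w with one point of the support gives an inner
    -- point, so a maximum likelihood parameter exists.
    have hv := div_mem_innerCore hw hy (t := (n : ℝ) - 1) (by linarith)
    have e : ((n - 1) * w + y) / ((n : ℝ) - 1 + 1) = w + (y - w) / n := by
      have : (n : ℝ) ≠ 0 := by linarith
      rw [sub_add_cancel]; field_simp; ring
    rw [e] at hv
    obtain ⟨τ, hτT, hτI, hτ⟩ := hsurj _ hv
    refine ⟨τ, hτT, hτI, hτ, profile_eq hτT (v := w + (y - w) / n) ?_ fun r hr => ?_⟩
    · have : (n : ℝ) ≠ 0 := by linarith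
      field_simp; ring
    · rw [← hτ]; exact gibbs (hT hr) hτI
  have hbase : ∫⁻ y, profile A T (m + 1) (m * w + y) ∂ν ≠ ∞ := by
    refine ne_top_of_le_ne_top (ENNReal.add_ne_top.2 ⟨hfa, hfb⟩) ?_
    rw [← lintegral_add_left (measurable_profile (by fun_prop))]
    refine lintegral_mono fun y => profile_le_add ?_ ?_
    · gcongr
    · gcongr
  -- comparison with the base length
  have hcomp : ∀ n : ℕ, m + 2 ≤ n → ∀ τ ∈ T, ∀ y, ∀ δ ≤ A τ - A t₀ - (τ - t₀) * w,
      ENNReal.ofReal (Real.exp (τ * ((n - 1) * w + y) - n * A τ)) ≤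
        profile A T (m + 1) (m * w + y) *
          ENNReal.ofReal (Real.exp ((n - 1 - m) * (t₀ * w - A t₀ - δ))) := by
    intro n hn τ hτ y δ hδ
    refine le_trans ?_ (mul_le_mul_left (le_profile hτ) _)
    rw [← ENNReal.ofReal_mul (by positivity), ← Real.exp_add]
    -- The n - 1 - m observations beyond the base length have mean w; each contributes τw - Aτ,
    -- which is at most t₀w - A t₀ - δ.
    refine ENNReal.ofReal_le_ofReal (Real.exp_le_exp.2 ?_)
    have hn' : (m : ℝ) + 2 ≤ n := by exact_mod_cast hn
    push_cast
    nlinarith [mul_le_mul_of_nonneg_left hδ (show (0 : ℝ) ≤ n - 1 - m by linarith)]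
  have hfin : ∀ n : ℕ, m + 2 ≤ n →
      ∫⁻ y, profile A T n ((n - 1) * w + y) ∂ν ≠ ∞ := by
    intro n hn
    refine ne_top_of_le_ne_top (ENNReal.mul_ne_top hbase
      (ENNReal.ofReal_ne_top (r := Real.exp ((n - 1 - m) * (t₀ * w - A t₀ - 0))))) ?_
    rw [← lintegral_mul_const _ (measurable_profile (by fun_prop))]
    refine lintegral_mono_ae ?_
    filter_upwards [Measure.support_mem_ae (μ := ν)] with y hy
    obtain ⟨τ, hτT, hτI, hτ, he⟩ := hmle n (by omega) y hy
    rw [he]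
    refine hcomp n hn τ hτT y 0 ?_
    have := gibbs (interior_subset hτI) ht₀
    linarith
  -- Likelihood ratio of the maximizing member to t₀. Its expectation under t₀ is the normalized
  -- Shtarkov integral.
  set e : ℕ → ℝ → ℝ := fun n y =>
    Real.exp (-(t₀ * ((n - 1) * w + y)) + n * A t₀) * (profile A T n ((n - 1) * w + y)).toReal
    with he
  have htilt : ∀ n : ℕ, ∀ y, Real.exp (t₀ * y) • e n y =
      Real.exp (-((n - 1) * (t₀ * w - A t₀))) * Real.exp (A t₀) *
        (profile A T n ((n - 1) * w + y)).toReal := by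
    intro n y
    simp only [he, smul_eq_mul]
    rw [← mul_assoc, ← Real.exp_add, ← Real.exp_add]
    congr 2
    ring
  have hprofint : ∀ n : ℕ, ∫⁻ y, profile A T n ((n - 1) * w + y) ∂ν ≠ ∞ →
      Integrable (e n) (ν.tilted fun x => t₀ * x) := by
    intro n hn
    rw [integrable_tilted_iff (integrable_exp_mul (interior_subset ht₀))]
    simp_rw [htilt n]
    exact (integrable_toReal_of_lintegral_ne_top
      (measurable_profile (by fun_prop)).aemeasurable hn).const_mul _
  have hval : ∀ n : ℕ, m + 2 ≤ n → ∫ y, e n y ∂(ν.tilted fun x => t₀ * x) =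
      (∫⁻ y, profile A T n ((n - 1) * w + y) ∂ν).toReal
          * Real.exp (-((n - 1) * (t₀ * w - A t₀))) := by
    intro n hn
    rw [integral_tilted, integral_exp_mul (interior_subset ht₀),
      ← integral_toReal (measurable_profile (by fun_prop)).aemeasurable
        (ae_lt_top (measurable_profile (by fun_prop)) (hfin n hn)), mul_comm, ← integral_const_mul]
    refine integral_congr_ae (ae_of_all _ fun y => ?_)
    have := htilt n y
    simp only [smul_eq_mul] at this ⊢
    rw [div_mul_eq_mul_div, this, ← hA]
    field_simp
  have hac : ν.tilted (fun x => t₀ * x) ≪ ν := tilted_absolutelyContinuous _ _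
  have hex : ∃ K, ∀ n : ℕ, n ≥ m + 2 → |∫ y, e n y ∂(ν.tilted fun x => t₀ * x)
      - ∫ y, expPoly (1 / (2 * k 2 t₀)) (-k 3 t₀ / (6 * k 2 t₀ ^ 3))
        ((3 * k 3 t₀ ^ 2 / k 2 t₀ ^ 5 - k 4 t₀ / k 2 t₀ ^ 4) / 24) (n : ℝ)⁻¹ (y - w)
        ∂(ν.tilted fun x => t₀ * x)| ≤ K * (n : ℝ)⁻¹ ^ 4 := by
    refine abs_integral_sub_integral_expPoly_le
      (by omega) (exists_integrable_exp_abs ht₀ w) (fun n hn => hprofint n (hfin n hn)) ?_ ?_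
    · refine ⟨ε, hε, C, hC, fun n hn => ?_⟩
      filter_upwards [hac.ae_le (Measure.support_mem_ae (μ := ν))] with y hy hyn
      have hn0 : (0 : ℝ) < n := by
        have : 0 < n := by omega
        exact_mod_cast this
      obtain ⟨τ, hτT, hτI, hτ, hpe⟩ := hmle n (by omega) y hy
      have hh := hloc τ hτI ((y - w) / n) (by rw [hτ]; ring) (by
        rw [abs_div, abs_of_pos hn0, div_le_iff₀ hn0]; exact hyn)
      -- This exponent is n times the divergence at h = (y - w)/n, so a term hⁱ becomes (y - w)ⁱ /
      -- n^(i-1).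
      refine ⟨-(t₀ * ((n - 1) * w + y)) + n * A t₀ + (τ * ((n - 1) * w + y) - n * A τ), ?_, ?_⟩
      · simp only [he]
        rw [hpe, ENNReal.toReal_ofReal (by positivity), ← Real.exp_add]
      · have := mul_le_mul_of_nonneg_left hh hn0.le
        rw [← abs_of_pos hn0, ← abs_mul, abs_of_pos hn0] at this
        refine le_of_eq_of_le (congrArg abs ?_) (this.trans_eq ?_)
        · field_simp
          ring
        · rw [abs_div, abs_of_pos hn0]
          field_simp
    · intro ε hε
      obtain ⟨δ, hδ, hgap⟩ := hgap hε
      -- The comparison leaves exp(-δ(n - 1 - m)) times the ratio at length m + 1; the part of the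
      -- exponent not depending on n goes into G.
      refine ⟨Real.exp (-δ), (Real.exp_pos _).le, by simpa using hδ,
        fun y => Real.exp (δ * (m + 1)) * e (m + 1) y, ?_, fun n hn => ?_⟩
      · refine (hprofint (m + 1) ?_).const_mul _
        simpa using hbase
      have hbase' := ae_lt_top (measurable_profile (by fun_prop)) hbase
      filter_upwards [hac.ae_le (Measure.support_mem_ae (μ := ν)), hac.ae_le hbase'] with y hy hyb hyn
      have hn0 : (0 : ℝ) < n := by
        have : 0 < n := by omega
        exact_mod_cast this
      obtain ⟨τ, hτT, hτI, hτ, hpe⟩ := hmle n (by omega) y hy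
      have hd := hgap τ hτI (by
        rw [hτ, add_sub_cancel_left, abs_div, abs_of_pos hn0, lt_div_iff₀ hn0]; exact hyn)
      have hc := hcomp n hn τ hτT y δ hd
      rw [← hpe] at hc
      have hc' := ENNReal.toReal_mono (ENNReal.mul_ne_top hyb.ne ENNReal.ofReal_ne_top) hc
      rw [ENNReal.toReal_mul, ENNReal.toReal_ofReal (by positivity)] at hc'
      have hen : 0 ≤ e n y := by simp only [he]; positivity
      rw [abs_of_nonneg hen]
      simp only [he]
      refine (mul_le_mul_of_nonneg_left hc' (Real.exp_pos _).le).trans_eq ?_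
      push_cast
      rw [add_sub_cancel_right, ← Real.exp_nat_mul, mul_comm (ENNReal.toReal _), ← mul_assoc,
        ← mul_assoc, ← mul_assoc, ← Real.exp_add, ← Real.exp_add, ← Real.exp_add]
      congr 2
      ring
  obtain ⟨K, hK⟩ := hex
  refine ⟨K, fun n hn => ?_⟩
  rw [← hval n hn, ← hpoly]
  exact hK n hn

end Asymptotics

/-! ### Constancy of the coefficients -/

/-- Coefficients of asymptotic expansions agree if the sequences agree infinitely often. -/
lemma coeff_eq_of_frequently_eq {x y : ℕ → ℝ} {c f g f' g' K K' : ℝ} {n₀ : ℕ}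
    (hx : ∀ n : ℕ, n₀ ≤ n →
      |x n - (1 + c * (n : ℝ)⁻¹ + f * (n : ℝ)⁻¹ ^ 2 + g * (n : ℝ)⁻¹ ^ 3)| ≤ K * (n : ℝ)⁻¹ ^ 4)
    (hy : ∀ n : ℕ, n₀ ≤ n →
      |y n - (1 + c * (n : ℝ)⁻¹ + f' * (n : ℝ)⁻¹ ^ 2 + g' * (n : ℝ)⁻¹ ^ 3)| ≤ K' * (n : ℝ)⁻¹ ^ 4)
    (hxy : ∃ᶠ n in Filter.atTop, x n = y n) : f = f' ∧ g = g' := by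
  have h0 : Filter.Tendsto (fun n : ℕ => (n : ℝ)⁻¹) Filter.atTop (nhds 0) :=
    tendsto_inv_atTop_nhds_zero_nat
  have hd : ∃ᶠ n : ℕ in Filter.atTop, 0 < (n : ℝ)⁻¹ ∧
      |(f - f') * (n : ℝ)⁻¹ ^ 2 + (g - g') * (n : ℝ)⁻¹ ^ 3| ≤ (K + K') * (n : ℝ)⁻¹ ^ 4 := by
    refine (hxy.and_eventually (Filter.eventually_ge_atTop (max n₀ 1))).mono ?_
    rintro n ⟨hn, hn'⟩
    have hn1 : (0 : ℝ) < n := by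
      have : 0 < n := lt_of_lt_of_le one_pos ((le_max_right _ _).trans hn')
      exact_mod_cast this
    refine ⟨by positivity, ?_⟩
    have h1 := abs_le.1 (hx n ((le_max_left _ _).trans hn'))
    have h2 := abs_le.1 (hy n ((le_max_left _ _).trans hn'))
    rw [hn] at h1
    rw [abs_le]
    constructor <;> nlinarith
  have hf : f = f' := by
    have hl : Filter.Tendsto (fun n : ℕ => |(f - f') + (g - g') * (n : ℝ)⁻¹|
        - (K + K') * (n : ℝ)⁻¹ ^ 2) Filter.atTop (nhds (|f - f' + (g - g') * 0| - (K + K') * 0 ^ 2)) :=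
      ((h0.const_mul _).const_add _).abs.sub ((h0.pow 2).const_mul _)
    have := le_of_tendsto_of_frequently hl (b := 0) (hd.mono fun n ⟨hn, h⟩ => by
      have e : (f - f') * (n : ℝ)⁻¹ ^ 2 + (g - g') * (n : ℝ)⁻¹ ^ 3
        = (n : ℝ)⁻¹ ^ 2 * ((f - f') + (g - g') * (n : ℝ)⁻¹) := by ring
      rw [e, abs_mul, abs_of_pos (pow_pos hn 2)] at h
      have : |(f - f') + (g - g') * (n : ℝ)⁻¹| ≤ (K + K') * (n : ℝ)⁻¹ ^ 2 :=
        le_of_mul_le_mul_left (h.trans_eq (by ring)) (pow_pos hn 2)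
      linarith)
    have h3 : |f - f'| ≤ 0 := by simpa using this
    exact sub_eq_zero.1 (abs_nonpos_iff.1 h3)
  refine ⟨hf, ?_⟩
  have hl : Filter.Tendsto (fun n : ℕ => |g - g'| - (K + K') * (n : ℝ)⁻¹) Filter.atTop
      (nhds (|g - g'| - (K + K') * 0)) :=
    (h0.const_mul _).const_sub _
  have := le_of_tendsto_of_frequently hl (b := 0) (hd.mono fun n ⟨hn, h⟩ => by
    rw [hf, sub_self, zero_mul, zero_add, abs_mul, abs_of_pos (pow_pos hn 3)] at h
    have : |g - g'| ≤ (K + K') * (n : ℝ)⁻¹ :=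
      le_of_mul_le_mul_right (h.trans_eq (by ring)) (pow_pos hn 3)
    linarith)
  have h3 : |g - g'| ≤ 0 := by simpa using this
  exact sub_eq_zero.1 (abs_nonpos_iff.1 h3)

/-- The parameters whose mean is an inner point. -/
def innerParam (ν : Measure ℝ) : Set ℝ :=
  {t | t ∈ interior (integrableExpSet id ν) ∧ deriv (cgf id ν) t ∈ innerCore ν}

section Grid

variable {ν : Measure ℝ}

lemma isOpen_innerParam : IsOpen (innerParam ν) := by
  have : ContinuousOn (deriv (cgf id ν)) (interior (integrableExpSet id ν)) :=
    fun t ht => (continuousAt_mean ht).continuousWithinAt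
  exact this.isOpen_inter_preimage isOpen_interior isOpen_innerCore

variable [NeZero ν]

lemma convex_innerParam : Convex ℝ (innerParam ν) := by
  refine Set.OrdConnected.convex ⟨fun x hx y hy z hz => ?_⟩
  have hz' : z ∈ interior (integrableExpSet id ν) :=
    convex_interior.ordConnected.out hx.1 hy.1 hz
  have hm := (strictMonoOn_mean hx.2).monotoneOn
  exact ⟨hz', ordConnected_innerCore.out hx.2 hy.2 ⟨hm hx.1 hz' hz.1, hm hz' hy.1 hz.2⟩⟩

/-- Parameters whose mean is a rational convex combination of `a` and `b` are dense. -/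
lemma exists_rat_mean {t a b : ℝ} (ht : t ∈ innerParam ν) (ha : a < deriv (cgf id ν) t)
    (hb : deriv (cgf id ν) t < b) {U : Set ℝ} (hU : U ∈ nhds t) :
    ∃ x ∈ U, x ∈ innerParam ν ∧ ∃ q : ℚ, 0 < q ∧ q < 1 ∧
      deriv (cgf id ν) x = q * a + (1 - q) * b := by
  have hab : 0 < b - a := by linarith
  have hev : ∀ᶠ s in nhds t, s ∈ U ∧ s ∈ innerParam ν ∧ deriv (cgf id ν) s ∈ Set.Ioo a b := by
    filter_upwards [hU, isOpen_innerParam.mem_nhds ht,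
      (continuousAt_mean ht.1).preimage_mem_nhds (Ioo_mem_nhds ha hb)] with s h1 h2 h3
    exact ⟨h1, h2, h3⟩
  obtain ⟨d, hd, h⟩ := Metric.eventually_nhds_iff.1 hev
  have hball : ∀ s ∈ Set.Icc t (t + d / 2), s ∈ U ∧ s ∈ innerParam ν ∧
      deriv (cgf id ν) s ∈ Set.Ioo a b := fun s hs => h (by
    rw [Real.dist_eq, abs_lt]; constructor <;> linarith [hs.1, hs.2])
  have htd : t ≤ t + d / 2 := by linarith
  have e := hball _ (Set.right_mem_Icc.2 htd)
  have hlt : deriv (cgf id ν) t < deriv (cgf id ν) (t + d / 2) :=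
    strictMonoOn_mean ht.2 ht.1 e.2.1.1 (by linarith)
  -- A mean μ has weight (b - μ)/(b - a) on a. A rational weight between those of two nearby means
  -- is attained by the intermediate value theorem.
  obtain ⟨q, hq1, hq2⟩ := exists_rat_btwn (show (b - deriv (cgf id ν) (t + d / 2)) / (b - a) <
    (b - deriv (cgf id ν) t) / (b - a) by gcongr)
  rw [div_lt_iff₀ hab] at hq1
  rw [lt_div_iff₀ hab] at hq2
  have hcont : ContinuousOn (deriv (cgf id ν)) (Set.Icc t (t + d / 2)) :=
    fun s hs => (continuousAt_mean (hball s hs).2.1.1).continuousWithinAt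
  obtain ⟨x, hx, hxe⟩ := intermediate_value_Icc htd hcont
    (show (q : ℝ) * a + (1 - q) * b ∈ _ from ⟨by nlinarith, by nlinarith⟩)
  refine ⟨x, (hball x hx).1, (hball x hx).2.1, q, ?_, ?_, hxe⟩
  · have := e.2.2.2
    have : (0 : ℝ) < q := by
      by_contra hq
      nlinarith
    exact_mod_cast this
  · have : (q : ℝ) < 1 := by
      by_contra hq
      nlinarith
    exact_mod_cast this

/-- The normalized maximized likelihood of the next outcome is constant along convex combinations
of `a` and `b`. -/
def GridInvariant (ν : Measure ℝ) (T : Set ℝ) (m : ℕ) (a b : ℝ) : Prop :=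
  ∀ t : ℕ, m + 1 ≤ t → ∀ i j : ℕ, 0 < i → i < t → 0 < j → j < t →
    profile (cgf id ν) T t (i * a + (t - i) * b)
        * ∫⁻ y, profile (cgf id ν) T (t + 1) (j * a + (t - j) * b + y) ∂ν =
      profile (cgf id ν) T t (j * a + (t - j) * b)
        * ∫⁻ y, profile (cgf id ν) T (t + 1) (i * a + (t - i) * b + y) ∂ν

variable {T : Set ℝ} {m : ℕ}

lemma coeff_eq_of_rat_mean (hT : T ⊆ integrableExpSet id ν)
    (hsurj : ∀ v ∈ innerCore ν, ∃ τ ∈ T, τ ∈ interior (integrableExpSet id ν) ∧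
      deriv (cgf id ν) τ = v)
    {a b : ℝ} (hab : a < b)
    (hfa : ∫⁻ y, profile (cgf id ν) T (m + 1) (m * a + y) ∂ν ≠ ∞)
    (hfb : ∫⁻ y, profile (cgf id ν) T (m + 1) (m * b + y) ∂ν ≠ ∞)
    (hgrid : GridInvariant ν T m a b)
    {k : ℕ → ℝ → ℝ} (hk : ∀ i, k i = iteratedDeriv i (cgf id ν))
    {x y : ℝ} (hx : x ∈ innerParam ν) (hy : y ∈ innerParam ν) {p q : ℚ}
    (hp0 : 0 < p) (hp1 : p < 1) (hq0 : 0 < q) (hq1 : q < 1)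
    (hxp : deriv (cgf id ν) x = p * a + (1 - p) * b)
    (hyq : deriv (cgf id ν) y = q * a + (1 - q) * b) :
    coeffTwo (k 2 x) (k 3 x) (k 4 x) = coeffTwo (k 2 y) (k 3 y) (k 4 y) ∧
      coeffThree (k 2 x) (k 3 x) (k 4 x) (k 5 x) (k 6 x) =
        coeffThree (k 2 y) (k 3 y) (k 4 y) (k 5 y) (k 6 y) := by
  have hbound : ∀ {r : ℚ}, 0 < r → r < 1 → a ≤ r * a + (1 - r) * b ∧ r * a + (1 - r) * b ≤ b := by
    intro r h0 h1
    have h0' : (0 : ℝ) < r := by exact_mod_cast h0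
    have h1' : (r : ℝ) < 1 := by exact_mod_cast h1
    constructor <;> nlinarith
  obtain ⟨K, hK⟩ := exists_shtarkov_expansion hT hsurj hx.1 hx.2 (hxp ▸ (hbound hp0 hp1).1)
    (hxp ▸ (hbound hp0 hp1).2) hfa hfb hk
  obtain ⟨K', hK'⟩ := exists_shtarkov_expansion hT hsurj hy.1 hy.2 (hyq ▸ (hbound hq0 hq1).1)
    (hyq ▸ (hbound hq0 hq1).2) hfa hfb hk
  refine coeff_eq_of_frequently_eq hK hK' ?_
  rw [Filter.frequently_atTop]
  intro N
  -- With this sample size both pt and qt are natural numbers, so both means are realized by samples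
  -- from {a, b}; t is arbitrarily large.
  set t := p.den * q.den * (N + m + 1) with ht
  have hnat : ∀ {r : ℚ}, 0 < r → r < 1 → ∀ e : ℕ, 0 < e → ∃ i : ℕ,
      (i : ℝ) = r * (r.den * e : ℕ) ∧ 0 < i ∧ i < r.den * e := by
    intro r h0 h1 e he
    have hi : ((r.num.toNat * e : ℕ) : ℝ) = r * (r.den * e : ℕ) := by
      have h2 : ((r.num.toNat : ℤ) : ℝ) = (r.num : ℝ) := by
        rw [Int.toNat_of_nonneg (Rat.num_nonneg.2 h0.le)]
      have h3 : (r : ℝ) * r.den = r.num := by exact_mod_cast Rat.mul_den_eq_num r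
      push_cast at h2 ⊢
      rw [h2, ← h3]
      ring
    have hpos : (0 : ℝ) < (r.den * e : ℕ) := by exact_mod_cast Nat.mul_pos r.den_pos he
    have h0' : (0 : ℝ) < r := by exact_mod_cast h0
    have h1' : (r : ℝ) < 1 := by exact_mod_cast h1
    refine ⟨_, hi, ?_, ?_⟩
    · have : (0 : ℝ) < ((r.num.toNat * e : ℕ) : ℝ) := by rw [hi]; positivity
      exact_mod_cast this
    · have : ((r.num.toNat * e : ℕ) : ℝ) < (r.den * e : ℕ) := by rw [hi]; nlinarith
      exact_mod_cast this
  have ht1 : N + m + 1 ≤ t := by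
    rw [ht]
    exact Nat.le_mul_of_pos_left _ (Nat.mul_pos p.den_pos q.den_pos)
  obtain ⟨i, hi, hi0, hit⟩ := hnat hp0 hp1 (q.den * (N + m + 1)) (Nat.mul_pos q.den_pos (by omega))
  obtain ⟨j, hj, hj0, hjt⟩ := hnat hq0 hq1 (p.den * (N + m + 1)) (Nat.mul_pos p.den_pos (by omega))
  have e1 : p.den * (q.den * (N + m + 1)) = t := by rw [ht]; ring
  have e2 : q.den * (p.den * (N + m + 1)) = t := by rw [ht]; ring
  rw [e1] at hi hit
  rw [e2] at hj hjt
  have hg := hgrid t (by omega) i j hi0 hit hj0 hjt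
  have s1 : (i : ℝ) * a + (t - i) * b = t * deriv (cgf id ν) x := by rw [hi, hxp]; ring
  have s2 : (j : ℝ) * a + (t - j) * b = t * deriv (cgf id ν) y := by rw [hj, hyq]; ring
  have hprof : ∀ z ∈ innerParam ν, profile (cgf id ν) T t (t * deriv (cgf id ν) z) =
      ENNReal.ofReal (Real.exp (t * (z * deriv (cgf id ν) z - cgf id ν z))) := by
    intro z hz
    obtain ⟨τ, hτT, hτI, hτ⟩ := hsurj _ hz.2
    have : τ = z := (strictMonoOn_mean hz.2).injOn hτI hz.1 hτ
    subst this
    rw [profile_eq hτT rfl fun r hr => gibbs (hT hr) hτI]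
    congr 2
    ring
  rw [s1, s2, hprof x hx, hprof y hy] at hg
  -- The expansion is indexed by the length after the next outcome, so t past observations
  -- correspond to n = t + 1.
  refine ⟨t + 1, by omega, ?_⟩
  have hg' := congrArg ENNReal.toReal hg
  rw [ENNReal.toReal_mul, ENNReal.toReal_mul, ENNReal.toReal_ofReal (by positivity),
    ENNReal.toReal_ofReal (by positivity)] at hg'
  push_cast
  simp only [add_sub_cancel_right]
  rw [Real.exp_neg, Real.exp_neg, ← div_eq_mul_inv, ← div_eq_mul_inv,
    div_eq_div_iff (by positivity) (by positivity)]
  linarith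

/-- Invariance along the grids spanned by sufficiently many pairs of points determines the form of
the variance function. -/
theorem variance_form_of_gridInvariant (hT : T ⊆ integrableExpSet id ν)
    (hsurj : ∀ v ∈ innerCore ν, ∃ τ ∈ T, τ ∈ interior (integrableExpSet id ν) ∧
      deriv (cgf id ν) τ = v)
    (hgrid : ∀ u ∈ innerCore ν, ∀ v ∈ innerCore ν, ∃ a b, a < u ∧ a < v ∧ u < b ∧ v < b ∧
      ∫⁻ y, profile (cgf id ν) T (m + 1) (m * a + y) ∂ν ≠ ∞ ∧
      ∫⁻ y, profile (cgf id ν) T (m + 1) (m * b + y) ∂ν ≠ ∞ ∧ GridInvariant ν T m a b) :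
    ∃ c l : ℝ, (∀ t ∈ innerParam ν,
        iteratedDeriv 2 (cgf id ν) t = (c * deriv (cgf id ν) t + l) ^ 2) ∨
      (∀ t ∈ innerParam ν, 0 ≤ c * deriv (cgf id ν) t + l ∧
        iteratedDeriv 2 (cgf id ν) t = (c * deriv (cgf id ν) t + l) ^ (3 / 2 : ℝ)) := by
  obtain ⟨k, hk⟩ : ∃ k : ℕ → ℝ → ℝ, ∀ i, k i = iteratedDeriv i (cgf id ν) := ⟨_, fun _ => rfl⟩
  have hpos : ∀ t ∈ innerParam ν, 0 < k 2 t := fun t ht => by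
    rw [hk]; exact cumulant_two_pos ht.2 ht.1
  have hcont : ∀ t ∈ innerParam ν, ∀ i, ContinuousAt (k i) t := fun t ht i => by
    rw [hk]; exact (hasDerivAt_cumulant ht.1 i).continuousAt
  set r : ℝ → ℝ × ℝ := fun t => (coeffTwo (k 2 t) (k 3 t) (k 4 t),
    coeffThree (k 2 t) (k 3 t) (k 4 t) (k 5 t) (k 6 t)) with hr
  have hrc : ∀ t ∈ innerParam ν, ContinuousAt r t := by
    intro t ht
    have h2 := hcont t ht 2
    have h3 := hcont t ht 3
    have h4 := hcont t ht 4
    have h5 := hcont t ht 5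
    have h6 := hcont t ht 6
    have h0 := (hpos t ht).ne'
    simp only [hr, coeffTwo, coeffThree]
    fun_prop (disch := positivity)
  have hconst : ∀ x ∈ innerParam ν, ∀ y ∈ innerParam ν, r x = r y := by
    intro x hx y hy
    -- If the coefficients differed at x and y, they would differ throughout two neighbourhoods,
    -- each of which contains a parameter of rational weight.
    by_contra hne
    obtain ⟨U, V, hU, hV, hxU, hyV, hUV⟩ := t2_separation hne
    obtain ⟨a, b, hax, hay, hxb, hyb, hfa, hfb, hg⟩ := hgrid _ hx.2 _ hy.2
    obtain ⟨x', hx'U, hx', p, hp0, hp1, hp⟩ := exists_rat_mean hx hax hxb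
      ((hrc x hx).preimage_mem_nhds (hU.mem_nhds hxU))
    obtain ⟨y', hy'V, hy', q, hq0, hq1, hq⟩ := exists_rat_mean hy hay hyb
      ((hrc y hy).preimage_mem_nhds (hV.mem_nhds hyV))
    have := coeff_eq_of_rat_mean hT hsurj (hax.trans hxb) hfa hfb hg hk hx' hy' hp0 hp1 hq0 hq1 hp hq
    have e : r x' = r y' := Prod.ext this.1 this.2
    exact Set.disjoint_left.1 hUV hx'U (e ▸ hy'V)
  rcases (innerParam ν).eq_empty_or_nonempty with he | ⟨t₀, ht₀⟩
  · exact ⟨0, 0, Or.inl (by simp [he])⟩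
  have := variance_form isOpen_innerParam convex_innerParam (k := k)
    (fun t ht i => by rw [hk, hk]; exact hasDerivAt_cumulant ht.1 i) hpos
    (fun t ht => congrArg Prod.fst (hconst t ht t₀ ht₀))
    (fun t ht => congrArg Prod.snd (hconst t ht t₀ ht₀))
  simpa only [hk, iteratedDeriv_one] using this

end Grid

/-! ### Boundary points with positive mass -/

section Endpoint

variable {ν : Measure ℝ} {w σ : ℝ}

/-- The support lies on one side of w, so the factor exp(-σrx) is bounded by its value at w and
preserves integrability. -/
lemma sub_mem_interior (hae : ∀ᵐ x ∂ν, 0 ≤ σ * (x - w)) {t : ℝ}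
    (ht : t ∈ interior (integrableExpSet id ν)) {r : ℝ} (hr : 0 ≤ r) :
    t - σ * r ∈ interior (integrableExpSet id ν) := by
  have hsub : (fun s => s + σ * r) ⁻¹' interior (integrableExpSet id ν) ⊆
      integrableExpSet id ν := by
    intro s hs
    have h := (integrable_exp_mul (interior_subset hs)).const_mul (Real.exp (-(σ * r * w)))
    refine h.mono' (by fun_prop) ?_
    filter_upwards [hae] with x hx
    rw [Real.norm_of_nonneg (Real.exp_pos _).le, ← Real.exp_add]
    refine Real.exp_le_exp.2 ?_
    simp only [id]
    nlinarith [mul_nonneg hr hx]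
  have hopen : IsOpen ((fun s => s + σ * r) ⁻¹' interior (integrableExpSet id ν)) :=
    isOpen_interior.preimage (by fun_prop)
  exact interior_maximal hsub hopen (by simpa using ht)

variable [NeZero ν]

lemma mul_le_mul_cgf_atom {t : ℝ} (ht : t ∈ integrableExpSet id ν) :
    ENNReal.ofReal (Real.exp (t * w - cgf id ν t)) * ν {w} ≤ 1 := by
  have h := measure_mono (μ := ν.tilted fun x => t * x) (Set.subset_univ {w})
  have := isProbabilityMeasure_tilt ht
  rw [measure_univ, tilted_apply' _ _ (measurableSet_singleton w), lintegral_singleton,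
    integral_exp_mul ht, ← Real.exp_sub] at h
  exact h

lemma atom_ne_top {t : ℝ} (ht : t ∈ integrableExpSet id ν) : ν {w} ≠ ∞ := by
  intro h
  have := mul_le_mul_cgf_atom (w := w) ht
  rw [h, ENNReal.mul_top (by simp [Real.exp_pos])] at this
  exact absurd this (by simp)

lemma mean_side (hae : ∀ᵐ x ∂ν, 0 ≤ σ * (x - w)) {t : ℝ}
    (ht : t ∈ interior (integrableExpSet id ν)) : 0 ≤ σ * (deriv (cgf id ν) t - w) := by
  have := isProbabilityMeasure_tilt (interior_subset ht)
  have hi : Integrable (fun x : ℝ => x) (ν.tilted fun x => t * x) := integrable_id_tilt ht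
  have h : 0 ≤ ∫ x, σ * (x - w) ∂(ν.tilted fun x => t * x) :=
    integral_nonneg_of_ae ((tilted_absolutelyContinuous _ _).ae_le hae)
  rw [integral_const_mul, integral_sub hi (integrable_const _), integral_tilt ht] at h
  simpa using h

/-- The new mean lies strictly between the old one and w, strictly because a still larger shift does
not pass w. The atom gives mass on the side of w. -/
lemma sub_mem_innerParam (hσ : σ = 1 ∨ σ = -1) (hae : ∀ᵐ x ∂ν, 0 ≤ σ * (x - w))
    (hatom : ν {w} ≠ 0) {t : ℝ} (ht : t ∈ innerParam ν) {r : ℝ} (hr : 0 < r) :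
    t - σ * r ∈ innerParam ν := by
  have h1 := sub_mem_interior hae ht.1 hr.le
  have h2 := sub_mem_interior hae ht.1 (show 0 ≤ r + 1 by linarith)
  have h3 := mean_side hae h2
  have hm := strictMonoOn_mean ht.2
  have hside : ∀ s : Set ℝ, w ∈ s → ν s ≠ 0 := fun s hs h0 =>
    hatom (measure_mono_null (Set.singleton_subset_iff.2 hs) h0)
  refine ⟨h1, ?_, ?_⟩
  · rcases hσ with rfl | rfl
    · have h4 := hm h2 h1 (by linarith)
      exact hside _ (show w < _ by linarith)
    · have h4 := hm ht.1 h1 (by linarith)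
      exact fun h0 => ht.2.1 (measure_mono_null (Set.Iio_subset_Iio h4.le) h0)
  · rcases hσ with rfl | rfl
    · have h4 := hm h1 ht.1 (by linarith)
      exact fun h0 => ht.2.2 (measure_mono_null (Set.Ioi_subset_Ioi h4.le) h0)
    · have h4 := hm h1 h2 (by linarith)
      exact hside _ (show _ < w by linarith)

/-- Near a boundary point with positive mass the second moment about that point vanishes. -/
lemma second_moment_le (hσ : σ = 1 ∨ σ = -1) (hae : ∀ᵐ x ∂ν, 0 ≤ σ * (x - w))
    (hatom : ν {w} ≠ 0) {t : ℝ} (ht : t ∈ interior (integrableExpSet id ν)) :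
    ∃ C, ∀ r : ℝ, 0 < r →
      ∫ x, (x - w) ^ 2 ∂(ν.tilted fun x => (t - σ * r) * x) ≤ C / r ^ 2 := by
  set c := (ν {w}).toReal with hc
  have hc0 : 0 < c := ENNReal.toReal_pos hatom (atom_ne_top (interior_subset ht))
  -- From z²/2 ≤ exp z at z = rσ(x - w): this exponential exactly undoes the shift of the parameter.
  -- The atom, of mass c, bounds the normalizing constant.
  refine ⟨∫ x, 2 / c * Real.exp (-(t * w)) * Real.exp (t * x) ∂ν, fun r hr => ?_⟩
  have h1 := sub_mem_interior hae ht hr.le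
  have hσ2 : σ ^ 2 = 1 := by rcases hσ with rfl | rfl <;> norm_num
  rw [integral_tilted, integral_exp_mul (interior_subset h1), ← integral_div]
  refine integral_mono_ae ?_ ?_ ?_
  · have := (integrable_tilted_iff (integrable_exp_mul (interior_subset h1)) _).1
      (integrable_sub_pow_tilt h1 w 2)
    refine (this.div_const (Real.exp (cgf id ν (t - σ * r)))).congr (ae_of_all _ fun x => ?_)
    simp only [smul_eq_mul]
    ring
  · exact ((integrable_exp_mul (interior_subset ht)).const_mul _).div_const _
  · filter_upwards [hae] with x hx
    have ha := mul_le_mul_cgf_atom (w := w) (interior_subset h1)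
    have ha' := ENNReal.toReal_mono ENNReal.one_ne_top ha
    rw [ENNReal.toReal_mul, ENNReal.toReal_ofReal (by positivity), ENNReal.toReal_one] at ha'
    have hz := Real.pow_div_factorial_le_exp (r * (σ * (x - w))) (by positivity) 2
    have hz' : (x - w) ^ 2 ≤ 2 / r ^ 2 * Real.exp (r * (σ * (x - w))) := by
      have e : (r * (σ * (x - w))) ^ 2 / (Nat.factorial 2 : ℕ) = r ^ 2 / 2 * (x - w) ^ 2 := by
        rw [mul_pow, mul_pow, hσ2]; norm_num; ring
      rw [e] at hz
      calc (x - w) ^ 2 = 2 / r ^ 2 * (r ^ 2 / 2 * (x - w) ^ 2) := by field_simp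
        _ ≤ _ := by gcongr
    have hA : Real.exp (-(cgf id ν (t - σ * r))) ≤ Real.exp (-((t - σ * r) * w)) / c := by
      rw [le_div_iff₀ hc0]
      calc _ = Real.exp (-((t - σ * r) * w)) *
            (Real.exp ((t - σ * r) * w - cgf id ν (t - σ * r)) * c) := by
              rw [← mul_assoc, ← Real.exp_add]; congr 2; ring
        _ ≤ Real.exp (-((t - σ * r) * w)) * 1 := by gcongr
        _ = _ := mul_one _
    simp only [smul_eq_mul]
    rw [div_eq_mul_inv (Real.exp _), ← Real.exp_neg]
    calc _ ≤ Real.exp ((t - σ * r) * x) * (Real.exp (-((t - σ * r) * w)) / c) *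
          (2 / r ^ 2 * Real.exp (r * (σ * (x - w)))) := by gcongr
      _ = 2 / c / r ^ 2 * (Real.exp ((t - σ * r) * x) * Real.exp (-((t - σ * r) * w)) *
          Real.exp (r * (σ * (x - w)))) := by ring
      _ = _ := by
        have e : Real.exp ((t - σ * r) * x) * Real.exp (-((t - σ * r) * w)) *
            Real.exp (r * (σ * (x - w))) = Real.exp (-(t * w)) * Real.exp (t * x) := by
          rw [← Real.exp_add, ← Real.exp_add, ← Real.exp_add]
          congr 1
          ring
        rw [e]
        ring

/-- At a boundary point with positive mass there are members of the family whose means tend to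
that point and whose variances tend to zero. -/
theorem exists_tendsto_boundary (hσ : σ = 1 ∨ σ = -1) (hae : ∀ᵐ x ∂ν, 0 ≤ σ * (x - w))
    (hatom : ν {w} ≠ 0) {t : ℝ} (ht : t ∈ innerParam ν) :
    ∃ s : ℕ → ℝ, (∀ n, s n ∈ innerParam ν) ∧
      Filter.Tendsto (fun n => deriv (cgf id ν) (s n)) Filter.atTop (nhds w) ∧
      Filter.Tendsto (fun n => iteratedDeriv 2 (cgf id ν) (s n)) Filter.atTop (nhds 0) := by
  obtain ⟨C, hC⟩ := second_moment_le hσ hae hatom ht.1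
  set s : ℕ → ℝ := fun n => t - σ * ((n : ℝ) + 1) with hs
  have hmem : ∀ n, s n ∈ innerParam ν := fun n =>
    sub_mem_innerParam hσ hae hatom ht (by positivity)
  -- The second moment about w is variance plus squared bias, so one bound handles both limits.
  have hmom : ∀ n, iteratedDeriv 2 (cgf id ν) (s n) + (deriv (cgf id ν) (s n) - w) ^ 2 ≤
      C / ((n : ℝ) + 1) ^ 2 := by
    intro n
    have hn := (hmem n).1
    have := isProbabilityMeasure_tilt (interior_subset hn)
    refine le_trans (le_of_eq ?_) (hC (n + 1) (by positivity))
    obtain ⟨m1, m2, -⟩ := integral_pow_tilt_eq (k := fun i => iteratedDeriv i (cgf id ν))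
      (fun _ => rfl) hn
    have e := integral_sub_pow_tilt hn w 2
    rw [e]
    simp only [Finset.sum_range_succ, Finset.sum_range_zero, m1, m2, iteratedDeriv_one]
    norm_num
    ring
  have hlim : Filter.Tendsto (fun n : ℕ => C / ((n : ℝ) + 1) ^ 2) Filter.atTop (nhds 0) := by
    have h := (tendsto_one_div_add_atTop_nhds_zero_nat (𝕜 := ℝ)).pow 2 |>.const_mul C
    simp only [ne_eq, OfNat.ofNat_ne_zero, not_false_eq_true, zero_pow, mul_zero] at h
    refine h.congr fun n => ?_
    rw [one_div, inv_pow, div_eq_mul_inv]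
  have h2 : ∀ n, 0 < iteratedDeriv 2 (cgf id ν) (s n) := fun n =>
    cumulant_two_pos ht.2 (hmem n).1
  refine ⟨s, hmem, ?_, ?_⟩
  · have hsq : Filter.Tendsto (fun n => (deriv (cgf id ν) (s n) - w) ^ 2) Filter.atTop (nhds 0) :=
      squeeze_zero (fun n => sq_nonneg _) (fun n => by linarith [hmom n, h2 n]) hlim
    have := (Real.continuous_sqrt.tendsto 0).comp hsq
    simp only [Function.comp_def, Real.sqrt_sq_eq_abs, Real.sqrt_zero] at this
    exact tendsto_sub_nhds_zero_iff.1 (tendsto_zero_iff_abs_tendsto_zero _ |>.2 this)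
  · exact squeeze_zero (fun n => (h2 n).le)
      (fun n => by nlinarith [hmom n, sq_nonneg (deriv (cgf id ν) (s n) - w)]) hlim

end Endpoint

/-! ### From SNML exchangeability to profile likelihoods -/

lemma ennreal_div_eq_div_iff {p q r v : ℝ≥0∞} (hq0 : q ≠ 0) (hqt : q ≠ ∞) (hv0 : v ≠ 0)
    (hvt : v ≠ ∞) : p / q = r / v ↔ p * v = r * q := by
  have e1 : p / q * (q * v) = p * v := by rw [← mul_assoc, ENNReal.div_mul_cancel hq0 hqt]
  have e2 : r / v * (q * v) = r * q := by
    rw [mul_comm q, ← mul_assoc, ENNReal.div_mul_cancel hv0 hvt]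
  rw [← e1, ← e2, ENNReal.mul_left_inj (mul_ne_zero hq0 hv0) (ENNReal.mul_ne_top hqt hvt)]

namespace NaturalExpFamily

variable (F : NaturalExpFamily)

/-- The real parameters of the family. -/
def realParam : Set ℝ := {t | (t : EReal) ∈ F.Θ}

instance : NeZero F.ref := ⟨F.ref_ne_zero⟩

lemma realParam_subset : F.realParam ⊆ integrableExpSet id F.ref := by
  intro t ht
  rcases F.subset_extNaturalSpace ht with ⟨s, hs, h⟩ | ⟨h, _⟩ | ⟨h, _⟩
  · rwa [EReal.coe_eq_coe_iff.1 hs]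
  · exact absurd h (EReal.coe_ne_bot t)
  · exact absurd h (EReal.coe_ne_top t)

lemma realParam_nonempty : F.realParam.Nonempty :=
  F.interior_nonempty.mono interior_subset

lemma relDensity_coe (ν : Measure ℝ) (t x : ℝ) :
    relDensity ν (t : EReal) x = ENNReal.ofReal (Real.exp (t * x - cgf id ν t)) := by
  simp [relDensity]

lemma lintegral_ref (f : ℝ → ℝ≥0∞) : ∫⁻ y, f y ∂F.ref = ∫⁻ y, F.h y * f y ∂F.lam := by
  rw [ref, lintegral_withDensity_eq_lintegral_mul_non_measurable _
    F.measurable_h.coe_nnreal_ennreal (ae_of_all _ fun _ => ENNReal.coe_lt_top)]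
  rfl

/-- The product of the values of the reference density. -/
def baseLik (n : ℕ) (x : ℕ → ℝ) : ℝ≥0∞ := ∏ i ∈ Finset.range n, (F.h (x i) : ℝ≥0∞)

/-- The likelihood relative to the reference measure. -/
def relLik (θ : EReal) (n : ℕ) (x : ℕ → ℝ) : ℝ≥0∞ :=
  ∏ i ∈ Finset.range n, relDensity F.ref θ (x i)

variable {F} {n : ℕ} {x x' : ℕ → ℝ}

lemma baseLik_ne_top : F.baseLik n x ≠ ∞ :=
  ENNReal.prod_ne_top fun _ _ => ENNReal.coe_ne_top

lemma baseLik_ne_zero (hx : ∀ i < n, F.h (x i) ≠ 0) : F.baseLik n x ≠ 0 :=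
  Finset.prod_ne_zero_iff.2 fun i hi => by simpa using hx i (Finset.mem_range.1 hi)

lemma lik_eq (θ : EReal) : F.lik θ n x = F.baseLik n x * F.relLik θ n x :=
  Finset.prod_mul_distrib

lemma relLik_coe (t : ℝ) : F.relLik (t : EReal) n x =
    ENNReal.ofReal (Real.exp (t * (∑ i ∈ Finset.range n, x i) - n * cgf id F.ref t)) := by
  simp only [relLik, relDensity_coe]
  rw [← ENNReal.ofReal_prod_of_nonneg fun _ _ => (Real.exp_pos _).le, ← Real.exp_sum,
    Finset.sum_sub_distrib, Finset.mul_sum]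
  simp

lemma maxLik_eq_mul : F.maxLik n x = F.baseLik n x * ⨆ θ ∈ F.Θ, F.relLik θ n x := by
  simp only [maxLik, lik_eq, ENNReal.mul_iSup]

lemma profile_le_iSup : profile (cgf id F.ref) F.realParam n (∑ i ∈ Finset.range n, x i) ≤
    ⨆ θ ∈ F.Θ, F.relLik θ n x := by
  refine iSup₂_le fun t ht => ?_
  rw [← relLik_coe]
  exact le_iSup₂ (f := fun θ (_ : θ ∈ F.Θ) => F.relLik θ n x) (t : EReal) ht

lemma baseLik_mul_profile_le : F.baseLik n x *
    profile (cgf id F.ref) F.realParam n (∑ i ∈ Finset.range n, x i) ≤ F.maxLik n x := by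
  rw [maxLik_eq_mul]
  gcongr
  exact profile_le_iSup

/-- Two distinct observations give each degenerate member likelihood 0, so only real parameters
matter. -/
lemma maxLik_eq_profile {i j : ℕ} (hi : i < n) (hj : j < n) (hij : x i ≠ x j) :
    F.maxLik n x = F.baseLik n x *
      profile (cgf id F.ref) F.realParam n (∑ i ∈ Finset.range n, x i) := by
  refine le_antisymm ?_ baseLik_mul_profile_le
  rw [maxLik_eq_mul]
  gcongr
  have hne : ∀ e : EReal, (x i : EReal) ≠ e ∨ (x j : EReal) ≠ e := by
    intro e
    by_contra! h
    exact hij (EReal.coe_eq_coe_iff.1 (h.1.trans h.2.symm))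
  have hzero : ∀ l < n, ∀ θ, relDensity F.ref θ (x l) = 0 → F.relLik θ n x = 0 :=
    fun l hl θ h => Finset.prod_eq_zero (Finset.mem_range.2 hl) h
  refine iSup₂_le fun θ hθ => ?_
  induction θ with
  | bot =>
    rcases hne (lowerEnd F.ref) with h | h
    · rw [hzero i hi _ (by simp [relDensity, h])]; exact zero_le
    · rw [hzero j hj _ (by simp [relDensity, h])]; exact zero_le
  | top =>
    rcases hne (upperEnd F.ref) with h | h
    · rw [hzero i hi _ (by simp [relDensity, h])]; exact zero_le
    · rw [hzero j hj _ (by simp [relDensity, h])]; exact zero_le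
  | coe t =>
    rw [relLik_coe]
    exact le_profile (T := F.realParam) hθ

lemma lik_congr (h : ∀ i < n, x i = x' i) (θ : EReal) : F.lik θ n x = F.lik θ n x' :=
  Finset.prod_congr rfl fun i hi => by rw [h i (Finset.mem_range.1 hi)]

lemma maxLik_congr (h : ∀ i < n, x i = x' i) : F.maxLik n x = F.maxLik n x' := by
  simp only [maxLik, lik_congr h]

lemma shtarkov_congr (h : ∀ i < n, x i = x' i) (j : ℕ) : F.shtarkov n j x = F.shtarkov n j x' := by
  simp only [shtarkov, lik_congr h]

lemma snml_congr (h : ∀ i ≤ n, x i = x' i) : F.snml n x = F.snml n x' := by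
  rw [snml, snml, cnml, cnml, maxLik_congr fun i hi => h i (Nat.lt_succ_iff.1 hi),
    shtarkov_congr fun i hi => h i hi.le]

lemma lik_update (θ : EReal) (y : ℝ) :
    F.lik θ (n + 1) (Function.update x n y) = F.lik θ n x * F.density θ y := by
  rw [lik, Finset.prod_range_succ, Function.update_self, lik]
  congr 1
  exact Finset.prod_congr rfl fun i hi => by
    rw [Function.update_of_ne (Finset.mem_range.1 hi).ne]

lemma shtarkov_one : F.shtarkov n 1 x =
    ∫⁻ y, F.maxLik (n + 1) (Function.update x n y) ∂F.lam := by
  have := F.sigmaFinite_lam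
  rw [← (measurePreserving_funUnique F.lam (Fin 1)).lintegral_comp_emb
    (MeasurableEquiv.measurableEmbedding _), shtarkov]
  simp only [maxLik, lik_update]
  simp [MeasurableEquiv.funUnique]
  rfl

lemma sum_update (y : ℝ) :
    ∑ i ∈ Finset.range (n + 1), Function.update x n y i = (∑ i ∈ Finset.range n, x i) + y := by
  rw [Finset.sum_range_succ, Function.update_self]
  congr 1
  exact Finset.sum_congr rfl fun i hi => by
    rw [Function.update_of_ne (Finset.mem_range.1 hi).ne]

lemma baseLik_update (y : ℝ) :
    F.baseLik (n + 1) (Function.update x n y) = F.baseLik n x * F.h y := by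
  rw [baseLik, Finset.prod_range_succ, Function.update_self, baseLik]
  congr 1
  exact Finset.prod_congr rfl fun i hi => by
    rw [Function.update_of_ne (Finset.mem_range.1 hi).ne]

lemma baseLik_mul_lintegral_le : F.baseLik n x *
    ∫⁻ y, profile (cgf id F.ref) F.realParam (n + 1) ((∑ i ∈ Finset.range n, x i) + y) ∂F.ref ≤
      F.shtarkov n 1 x := by
  rw [shtarkov_one, lintegral_ref, ← lintegral_const_mul' _ _ baseLik_ne_top]
  refine lintegral_mono fun y => ?_
  refine le_trans (le_of_eq ?_) baseLik_mul_profile_le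
  rw [sum_update, baseLik_update, mul_assoc]

lemma shtarkov_eq_profile {i j : ℕ} (hi : i < n) (hj : j < n) (hij : x i ≠ x j) :
    F.shtarkov n 1 x = F.baseLik n x * ∫⁻ y, profile (cgf id F.ref) F.realParam (n + 1)
      ((∑ i ∈ Finset.range n, x i) + y) ∂F.ref := by
  rw [shtarkov_one, lintegral_ref, ← lintegral_const_mul' _ _ baseLik_ne_top]
  refine lintegral_congr fun y => ?_
  rw [maxLik_eq_profile (i := i) (j := j) (by omega) (by omega), sum_update, baseLik_update,
    mul_assoc]
  rwa [Function.update_of_ne hi.ne, Function.update_of_ne hj.ne]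

/-- A sample point of positive density at which the densities of the family are bounded. -/
structure GoodPoint (F : NaturalExpFamily) (a : ℝ) : Prop where
  mem : a ∈ F.X
  pos : F.h a ≠ 0
  bounded : ⨆ θ ∈ F.Θ, F.density θ a ≠ ∞

lemma shtarkov_ne_zero (hx : ∀ i < n, F.h (x i) ≠ 0) : F.shtarkov n 1 x ≠ 0 := by
  intro h0
  have h := baseLik_mul_lintegral_le (F := F) (n := n) (x := x)
  rw [h0, nonpos_iff_eq_zero, mul_eq_zero, or_iff_right (baseLik_ne_zero hx),
    lintegral_eq_zero_iff (measurable_profile (by fun_prop))] at h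
  obtain ⟨t, ht⟩ := F.realParam_nonempty
  have hne : F.ref ≠ 0 := F.ref_ne_zero
  rw [← ae_neBot] at hne
  obtain ⟨y, hy⟩ := h.exists
  have := le_profile (A := cgf id F.ref) (n := n + 1)
    (s := (∑ i ∈ Finset.range n, x i) + y) ht
  simp only [Pi.zero_apply] at hy
  rw [hy] at this
  simp at this
  exact absurd this (Real.exp_pos _).not_ge

lemma maxLik_ne_zero (hx : ∀ i < n, F.h (x i) ≠ 0) : F.maxLik n x ≠ 0 := by
  obtain ⟨t, ht⟩ := F.realParam_nonempty
  intro h0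
  have h := baseLik_mul_profile_le (F := F) (n := n) (x := x)
  rw [h0, nonpos_iff_eq_zero, mul_eq_zero, or_iff_right (baseLik_ne_zero hx)] at h
  have := le_profile (A := cgf id F.ref) (n := n) (s := ∑ i ∈ Finset.range n, x i) ht
  rw [h] at this
  simp at this
  exact absurd this (Real.exp_pos _).not_ge

lemma prod_density_le (θ : EReal) (hθ : θ ∈ F.Θ) (s : Finset ℕ) :
    ∏ i ∈ s, F.density θ (x i) ≤ ∏ i ∈ s, ⨆ θ ∈ F.Θ, F.density θ (x i) :=
  Finset.prod_le_prod' fun i _ =>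
    le_iSup₂ (f := fun θ (_ : θ ∈ F.Θ) => F.density θ (x i)) θ hθ

lemma maxLik_ne_top (hx : ∀ i < n, F.GoodPoint (x i)) : F.maxLik n x ≠ ∞ := by
  refine ne_top_of_le_ne_top (ENNReal.prod_ne_top fun i hi => (hx i (Finset.mem_range.1 hi)).bounded)
    (iSup₂_le fun θ hθ => prod_density_le θ hθ (Finset.range n))

/-- Outcomes after the first m contribute bounded density factors, which leaves the Shtarkov
integral after m outcomes. -/
lemma shtarkov_ne_top {m : ℕ} (hm : F.ProperAfter m) (hmn : m ≤ n)
    (hx : ∀ i < n, F.GoodPoint (x i)) : F.shtarkov n 1 x ≠ ∞ := by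
  have hC : ∏ i ∈ Finset.Ico m n, ⨆ θ ∈ F.Θ, F.density θ (x i) ≠ ∞ :=
    ENNReal.prod_ne_top fun i hi => (hx i (Finset.mem_Ico.1 hi).2).bounded
  have hfin := ((hm x fun i hi => (hx i (hi.trans_le hmn)).mem).2 1).ne
  refine ne_top_of_le_ne_top (ENNReal.mul_ne_top hfin hC) ?_
  rw [shtarkov_one, shtarkov_one, ← lintegral_mul_const' _ _ hC]
  refine lintegral_mono fun y => iSup₂_le fun θ hθ => ?_
  rw [lik_update, lik, ← Finset.prod_range_mul_prod_Ico _ hmn, mul_right_comm]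
  refine mul_le_mul' ?_ (prod_density_le θ hθ _)
  rw [← lik, ← lik_update]
  exact le_iSup₂ (f := fun θ (_ : θ ∈ F.Θ) => F.lik θ (m + 1) (Function.update x m y)) θ hθ

lemma lintegral_profile_ne_top {m : ℕ} (hm : F.ProperAfter m) {a : ℝ} (ha : F.GoodPoint a) :
    ∫⁻ y, profile (cgf id F.ref) F.realParam (m + 1) (m * a + y) ∂F.ref ≠ ∞ := by
  have h := baseLik_mul_lintegral_le (F := F) (n := m) (x := fun _ => a)
  have hs := shtarkov_ne_top (x := fun _ => a) hm le_rfl fun _ _ => ha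
  intro htop
  simp only [Finset.sum_const, Finset.card_range, nsmul_eq_mul] at h
  rw [htop, ENNReal.mul_top (baseLik_ne_zero fun _ _ => ha.pos)] at h
  exact hs (top_le_iff.1 h)

/-- Exchangeability compares the two orders of the last two of `s + 2` outcomes. -/
lemma maxLik_mul_shtarkov_eq {m s : ℕ} (hm : F.ProperAfter m) (hms : m ≤ s)
    (hx : ∀ i < s + 2, F.GoodPoint (x i)) (h1 : ∀ i < s, x' i = x i) (h2 : x' s = x (s + 1))
    (h3 : x' (s + 1) = x s) (hex : F.snmlJoint m (s + 2) x' = F.snmlJoint m (s + 2) x) :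
    F.maxLik (s + 1) x' * F.shtarkov (s + 1) 1 x = F.maxLik (s + 1) x * F.shtarkov (s + 1) 1 x' := by
  have hx' : ∀ i < s + 2, F.GoodPoint (x' i) := by
    intro i hi
    rcases lt_trichotomy i s with h | rfl | h
    · rw [h1 i h]; exact hx i hi
    · rw [h2]; exact hx _ (by omega)
    · obtain rfl : i = s + 1 := by omega
      rw [h3]; exact hx _ (by omega)
  have key : ∀ z : ℕ → ℝ, (∀ i < s + 2, F.GoodPoint (z i)) → ∀ n < s + 2, m ≤ n →
      F.snml n z ≠ 0 ∧ F.snml n z ≠ ∞ := by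
    intro z hz n hn hmn
    have a1 := maxLik_ne_zero (F := F) (n := n + 1) (x := z) fun i hi => (hz i (by omega)).pos
    have a2 := maxLik_ne_top (F := F) (n := n + 1) (x := z) fun i hi => hz i (by omega)
    have a3 := shtarkov_ne_zero (F := F) (n := n) (x := z) fun i hi => (hz i (by omega)).pos
    have a4 := shtarkov_ne_top (F := F) (n := n) (x := z) hm hmn fun i hi => hz i (by omega)
    exact ⟨ENNReal.div_ne_zero.2 ⟨a1, a4⟩, ENNReal.div_ne_top a2 a3⟩
  have hmax : F.maxLik (s + 2) x' = F.maxLik (s + 2) x := by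
    simp only [maxLik]
    refine iSup_congr fun θ => iSup_congr fun _ => ?_
    rw [lik, lik, Finset.prod_range_succ, Finset.prod_range_succ, Finset.prod_range_succ,
      Finset.prod_range_succ, h2, h3, mul_right_comm]
    rw [Finset.prod_congr rfl fun i hi => by rw [h1 i (Finset.mem_range.1 hi)]]
  have hpre : ∏ i ∈ Finset.Ico m s, F.snml i x' = ∏ i ∈ Finset.Ico m s, F.snml i x :=
    Finset.prod_congr rfl fun i hi => snml_congr fun j hj =>
      h1 j (by have := (Finset.mem_Ico.1 hi).2; omega)
  have hQ0 : ∏ i ∈ Finset.Ico m s, F.snml i x ≠ 0 := Finset.prod_ne_zero_iff.2 fun i hi =>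
    (key x hx i (by have := (Finset.mem_Ico.1 hi).2; omega) (Finset.mem_Ico.1 hi).1).1
  have hQt : ∏ i ∈ Finset.Ico m s, F.snml i x ≠ ∞ := ENNReal.prod_ne_top fun i hi =>
    (key x hx i (by have := (Finset.mem_Ico.1 hi).2; omega) (Finset.mem_Ico.1 hi).1).2
  rw [snmlJoint, snmlJoint, Finset.prod_Ico_succ_top (by omega), Finset.prod_Ico_succ_top hms,
    Finset.prod_Ico_succ_top (by omega), Finset.prod_Ico_succ_top hms, hpre, mul_assoc, mul_assoc,
    ENNReal.mul_right_inj hQ0 hQt, snml, snml, snml, snml, cnml, cnml, cnml, cnml, hmax,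
    shtarkov_congr h1] at hex
  have a1 := maxLik_ne_zero (F := F) (n := s + 2) (x := x) fun i hi => (hx i hi).pos
  have a2 := maxLik_ne_top (F := F) (n := s + 2) (x := x) hx
  have b1 := shtarkov_ne_zero (F := F) (n := s) (x := x) fun i hi => (hx i (by omega)).pos
  have b2 := shtarkov_ne_top (F := F) (n := s) (x := x) hm hms fun i hi => hx i (by omega)
  have c1 := shtarkov_ne_zero (F := F) (n := s + 1) (x := x) fun i hi => (hx i (by omega)).pos
  have c2 := shtarkov_ne_top (F := F) (n := s + 1) (x := x) hm (by omega) fun i hi => hx i (by omega)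
  have d1 := shtarkov_ne_zero (F := F) (n := s + 1) (x := x') fun i hi => (hx' i (by omega)).pos
  have d2 := shtarkov_ne_top (F := F) (n := s + 1) (x := x') hm (by omega)
    fun i hi => hx' i (by omega)
  have e : ∀ p q r v : ℝ≥0∞, p / q * (r / v) = (r / q) * (p / v) := by
    intro p q r v
    simp only [div_eq_mul_inv]
    ring
  -- Regrouping isolates the factor common to both orders: the last maximized likelihood over the
  -- Shtarkov integral after s outcomes.
  rw [e, e _ _ (F.maxLik (s + 2) x), ENNReal.mul_right_inj (ENNReal.div_ne_zero.2 ⟨a1, b2⟩)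
    (ENNReal.div_ne_top a2 b1)] at hex
  exact (ennreal_div_eq_div_iff d1 d2 c1 c2).1 hex

lemma sum_range_ite (a b : ℝ) {i s : ℕ} (his : i ≤ s) :
    ∑ l ∈ Finset.range s, (if l < i then a else b) = i * a + ((s : ℝ) - i) * b := by
  rw [← Finset.sum_range_add_sum_Ico _ his,
    Finset.sum_congr rfl fun l hl => if_pos (Finset.mem_range.1 hl),
    Finset.sum_congr rfl fun l hl => if_neg (Finset.mem_Ico.1 hl).1.not_gt]
  simp [Nat.cast_sub his]

/-- Exchangeability implies invariance along the grid of two good points. -/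
theorem gridInvariant {m : ℕ} (hm : F.ProperAfter m)
    (hex : ∀ n, m < n → ∀ x : ℕ → ℝ, (∀ i < n, x i ∈ F.X) →
      ∀ σ : Equiv.Perm ℕ, (∀ i < m, σ i = i) → (∀ i, n ≤ i → σ i = i) →
        F.snmlJoint m n (x ∘ σ) = F.snmlJoint m n x)
    {a b : ℝ} (ha : F.GoodPoint a) (hb : F.GoodPoint b) (hab : a ≠ b) :
    GridInvariant F.ref F.realParam m a b := by
  intro t hmt i j hi hit hj hjt
  obtain ⟨s, rfl⟩ : ∃ s, t = s + 1 := ⟨t - 1, by omega⟩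
  set ρ : ℕ → ℝ≥0∞ := fun i =>
    profile (cgf id F.ref) F.realParam (s + 1) (i * a + ((s + 1 : ℕ) - i) * b) with hρ
  set Z : ℕ → ℝ≥0∞ := fun i => ∫⁻ y, profile (cgf id F.ref) F.realParam (s + 1 + 1)
    (i * a + ((s + 1 : ℕ) - i) * b + y) ∂F.ref with hZ
  have hgood : ∀ i l : ℕ, F.GoodPoint (if l < i then a else b) := by
    intro i l
    split_ifs
    exacts [ha, hb]
  have hZne : ∀ i, 0 < i → i < s + 1 → Z i ≠ 0 ∧ Z i ≠ ∞ := by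
    intro i hi his
    set y : ℕ → ℝ := fun l => if l < i then a else b with hy
    have e := shtarkov_eq_profile (F := F) (n := s + 1) (x := y) (i := 0) (j := i) (by omega) his
      (by simpa [hy, hi] using hab)
    have h0 := shtarkov_ne_zero (F := F) (n := s + 1) (x := y) fun l _ => (hgood i l).pos
    have h1 := shtarkov_ne_top (F := F) (n := s + 1) (x := y) hm (by omega) fun l _ => hgood i l
    have hK := baseLik_ne_zero (F := F) (n := s + 1) (x := y) fun l _ => (hgood i l).pos
    rw [sum_range_ite a b his.le] at e
    rw [e] at h0 h1
    refine ⟨right_ne_zero_of_mul h0, fun h => h1 ?_⟩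
    change F.baseLik (s + 1) y * Z i = ∞
    rw [h, ENNReal.mul_top hK]
  -- Start with i copies of a, continue with b, and put a at place s. Swapping places s and s + 1
  -- compares i + 1 copies of a with i copies among the first s + 1. Both values already occur among
  -- the first s, so degenerate members drop out.
  have hstep : ∀ i, 0 < i → i + 1 < s + 1 → ρ (i + 1) * Z i = ρ i * Z (i + 1) := by
    intro i hi his
    set y : ℕ → ℝ := fun l => if l < i then a else b with hy
    have his' : i < s := by omega
    have hys : ∀ l, i ≤ l → y l = b := fun l hl => if_neg hl.not_gt
    have hy0 : y 0 = a := if_pos hi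
    have hval : ∀ c, F.GoodPoint c →
        F.maxLik (s + 1) (Function.update y s c) = F.baseLik s y * F.h c *
          profile (cgf id F.ref) F.realParam (s + 1) (i * a + ((s : ℝ) - i) * b + c) ∧
        F.shtarkov (s + 1) 1 (Function.update y s c) = F.baseLik s y * F.h c *
          ∫⁻ z, profile (cgf id F.ref) F.realParam (s + 1 + 1)
            (i * a + ((s : ℝ) - i) * b + c + z) ∂F.ref := by
      intro c hc
      have hne : Function.update y s c 0 ≠ Function.update y s c i := by
        rw [Function.update_of_ne (by omega), Function.update_of_ne (by omega), hy0,
          hys i le_rfl]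
        exact hab
      rw [maxLik_eq_profile (i := 0) (j := i) (by omega) (by omega) hne,
        shtarkov_eq_profile (i := 0) (j := i) (by omega) (by omega) hne, sum_update,
        baseLik_update, sum_range_ite a b his'.le]
      exact ⟨rfl, rfl⟩
    have hxg : ∀ l < s + 2, F.GoodPoint (Function.update y s a l) := by
      intro l _
      rcases eq_or_ne l s with rfl | h
      · rwa [Function.update_self]
      · rw [Function.update_of_ne h]; exact hgood i l
    have hperm := hex (s + 2) (by omega) (Function.update y s a) (fun l hl => (hxg l hl).mem)
      (Equiv.swap s (s + 1)) (fun l hl => Equiv.swap_apply_of_ne_of_ne (by omega) (by omega))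
      (fun l hl => Equiv.swap_apply_of_ne_of_ne (by omega) (by omega))
    have hcomp1 : ∀ l < s, (Function.update y s a ∘ Equiv.swap s (s + 1)) l =
        Function.update y s a l := fun l hl => by
      rw [Function.comp_apply, Equiv.swap_apply_of_ne_of_ne (by omega) (by omega)]
    have hmain := maxLik_mul_shtarkov_eq hm (by omega) hxg hcomp1 (by simp) (by simp) hperm
    have hcongr : ∀ l < s + 1, (Function.update y s a ∘ Equiv.swap s (s + 1)) l =
        Function.update y s b l := by
      intro l hl
      rcases Nat.lt_succ_iff_lt_or_eq.1 hl with h | rfl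
      · rw [hcomp1 l h, Function.update_of_ne h.ne, Function.update_of_ne h.ne]
      · simp [hys (l + 1) (by omega)]
    rw [maxLik_congr hcongr, shtarkov_congr hcongr, (hval a ha).1, (hval a ha).2, (hval b hb).1,
      (hval b hb).2] at hmain
    have ea : (i : ℝ) * a + ((s : ℝ) - i) * b + a =
        ((i + 1 : ℕ) : ℝ) * a + (((s + 1 : ℕ) : ℝ) - (i + 1 : ℕ)) * b := by push_cast; ring
    have eb : (i : ℝ) * a + ((s : ℝ) - i) * b + b =
        (i : ℝ) * a + (((s + 1 : ℕ) : ℝ) - i) * b := by push_cast; ring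
    rw [ea, eb] at hmain
    change F.baseLik s y * F.h b * ρ i * (F.baseLik s y * F.h a * Z (i + 1)) =
      F.baseLik s y * F.h a * ρ (i + 1) * (F.baseLik s y * F.h b * Z i) at hmain
    have hK := baseLik_ne_zero (F := F) (n := s) (x := y) fun l _ => (hgood i l).pos
    have hKt := baseLik_ne_top (F := F) (n := s) (x := y)
    have hc0 : F.baseLik s y * F.h b * (F.baseLik s y * F.h a) ≠ 0 :=
      mul_ne_zero (mul_ne_zero hK (by simpa using hb.pos)) (mul_ne_zero hK (by simpa using ha.pos))
    have hct : F.baseLik s y * F.h b * (F.baseLik s y * F.h a) ≠ ∞ :=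
      ENNReal.mul_ne_top (ENNReal.mul_ne_top hKt ENNReal.coe_ne_top)
        (ENNReal.mul_ne_top hKt ENNReal.coe_ne_top)
    rw [← ENNReal.mul_right_inj hc0 hct]
    calc _ = F.baseLik s y * F.h a * ρ (i + 1) * (F.baseLik s y * F.h b * Z i) := by ring
      _ = _ := hmain.symm
      _ = _ := by ring
  have hdiv : ∀ i, 1 ≤ i → i < s + 1 → ρ i / Z i = ρ 1 / Z 1 := by
    intro i hi
    induction i, hi using Nat.le_induction with
    | base => intro _; rfl
    | succ i hi ih =>
      intro his
      rw [← ih (by omega)]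
      obtain ⟨p0, pt⟩ := hZne i hi (by omega)
      obtain ⟨q0, qt⟩ := hZne (i + 1) (by omega) his
      exact (ennreal_div_eq_div_iff q0 qt p0 pt).2 (hstep i hi his)
  have hij := (hdiv i hi hit).trans (hdiv j hj hjt).symm
  obtain ⟨p0, pt⟩ := hZne i hi hit
  obtain ⟨q0, qt⟩ := hZne j hj hjt
  exact (ennreal_div_eq_div_iff p0 pt q0 qt).1 hij

end NaturalExpFamily

/-! ### Ends of the support and the convex core -/

section Ends

variable {ν : Measure ℝ} {w : ℝ}

lemma lowerEnd_lt_iff : lowerEnd ν < (w : EReal) ↔ ν (Set.Iio w) ≠ 0 := by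
  rw [lowerEnd, sInf_lt_iff]
  constructor
  · rintro ⟨_, ⟨x, hx, rfl⟩, hxw⟩
    exact ((Measure.mem_support_iff_forall x).1 hx _ (Iio_mem_nhds (EReal.coe_lt_coe_iff.1 hxw))).ne'
  · intro h
    obtain ⟨x, hxw, hx⟩ := Measure.nonempty_inter_support_of_pos (pos_iff_ne_zero.2 h)
    exact ⟨x, ⟨x, hx, rfl⟩, EReal.coe_lt_coe_iff.2 hxw⟩

lemma lt_upperEnd_iff : (w : EReal) < upperEnd ν ↔ ν (Set.Ioi w) ≠ 0 := by
  rw [upperEnd, lt_sSup_iff]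
  constructor
  · rintro ⟨_, ⟨x, hx, rfl⟩, hxw⟩
    exact ((Measure.mem_support_iff_forall x).1 hx _ (Ioi_mem_nhds (EReal.coe_lt_coe_iff.1 hxw))).ne'
  · intro h
    obtain ⟨x, hxw, hx⟩ := Measure.nonempty_inter_support_of_pos (pos_iff_ne_zero.2 h)
    exact ⟨x, ⟨x, hx, rfl⟩, EReal.coe_lt_coe_iff.2 hxw⟩

lemma innerCore_subset_convexCore : innerCore ν ⊆ convexCore ν :=
  fun _ hw => ⟨Or.inl (lowerEnd_lt_iff.2 hw.1), Or.inl (lt_upperEnd_iff.2 hw.2)⟩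

lemma exists_side_of_notMem_innerCore (hw : w ∉ innerCore ν) :
    ∃ σ : ℝ, (σ = 1 ∨ σ = -1) ∧ ∀ᵐ x ∂ν, 0 ≤ σ * (x - w) := by
  rcases not_and_or.1 hw with h | h
  · refine ⟨1, Or.inl rfl, ?_⟩
    refine measure_mono_null (fun x hx => ?_) (not_not.1 h)
    simpa using hx
  · refine ⟨-1, Or.inr rfl, ?_⟩
    refine measure_mono_null (fun x hx => ?_) (not_not.1 h)
    simpa using hx

lemma atom_of_mem_convexCore (hw : w ∈ convexCore ν) (hw' : w ∉ innerCore ν) : ν {w} ≠ 0 := by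
  by_contra h
  refine hw' ⟨lowerEnd_lt_iff.1 (hw.1.resolve_right fun h' => h'.2 h),
    lt_upperEnd_iff.1 (hw.2.resolve_right fun h' => h'.2 h)⟩

/-- A support point outside the inner core is the smallest or largest one. There are at most two
such points, null unless they are atoms. -/
lemma ae_mem_innerCore_or_atom : ∀ᵐ x ∂ν, x ∈ innerCore ν ∨ ν {x} ≠ 0 := by
  have key : ∀ B : Set ℝ, B.Subsingleton → (∀ x ∈ B, ν {x} = 0) → ν B = 0 := by
    intro B hB h
    rcases hB.eq_empty_or_singleton with rfl | ⟨x, rfl⟩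
    · simp
    · exact h x rfl
  have h1 : ∀ᵐ x ∂ν, ¬ (x ∈ ν.support ∧ ν (Set.Iio x) = 0 ∧ ν {x} = 0) := by
    have hsub : {x | x ∈ ν.support ∧ ν (Set.Iio x) = 0 ∧ ν {x} = 0}.Subsingleton := by
      have : ∀ x y, x ∈ ν.support → ν (Set.Iio y) = 0 → y ≤ x := fun x y hx hy =>
        not_lt.1 fun hxy => ((Measure.mem_support_iff_forall x).1 hx _ (Iio_mem_nhds hxy)).ne' hy
      exact fun x hx y hy => le_antisymm (this y x hy.1 hx.2.1) (this x y hx.1 hy.2.1)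
    rw [ae_iff]
    simpa using key _ hsub fun x hx => hx.2.2
  have h2 : ∀ᵐ x ∂ν, ¬ (x ∈ ν.support ∧ ν (Set.Ioi x) = 0 ∧ ν {x} = 0) := by
    have hsub : {x | x ∈ ν.support ∧ ν (Set.Ioi x) = 0 ∧ ν {x} = 0}.Subsingleton := by
      have : ∀ x y, x ∈ ν.support → ν (Set.Ioi y) = 0 → x ≤ y := fun x y hx hy =>
        not_lt.1 fun hxy => ((Measure.mem_support_iff_forall x).1 hx _ (Ioi_mem_nhds hxy)).ne' hy
      exact fun x hx y hy => le_antisymm (this x y hx.1 hy.2.1) (this y x hy.1 hx.2.1)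
    rw [ae_iff]
    simpa using key _ hsub fun x hx => hx.2.2
  filter_upwards [h1, h2, Measure.support_mem_ae (μ := ν)] with x hx1 hx2 hs
  by_contra! h
  exact h.1 ⟨fun h' => hx1 ⟨hs, h', h.2⟩, fun h' => hx2 ⟨hs, h', h.2⟩⟩

end Ends

/-! ### Consequences of a maximal mean-value space, and the conclusion -/

namespace NaturalExpFamily

variable {F : NaturalExpFamily}

lemma law_coe {t : ℝ} (ht : t ∈ F.realParam) :
    F.law (t : EReal) = F.ref.tilted fun x => t * x := by
  have e : F.density (t : EReal) = (fun x => (F.h x : ℝ≥0∞)) *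
      fun x => ENNReal.ofReal (Real.exp (t * x) / ∫ x, Real.exp (t * x) ∂F.ref) := by
    ext x
    rw [density, relDensity_coe, integral_exp_mul (F.realParam_subset ht), Real.exp_sub]
    rfl
  rw [law, e, withDensity_mul _ F.measurable_h.coe_nnreal_ennreal (by fun_prop)]
  rfl

lemma withDensity_atom {e : EReal} {x₀ : ℝ} (hx₀ : (x₀ : EReal) = e) (h0 : F.ref {x₀} ≠ 0)
    {r : ℝ → ℝ≥0∞} (hr : ∀ x : ℝ, (x : EReal) = e → r x = (F.ref {x})⁻¹)
    (hr' : ∀ x : ℝ, (x : EReal) ≠ e → r x = 0) :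
    F.lam.withDensity (fun x => (F.h x : ℝ≥0∞) * r x) = Measure.dirac x₀ := by
  obtain ⟨t, ht⟩ := F.realParam_nonempty
  have htop : F.ref {x₀} ≠ ∞ := atom_ne_top (F.realParam_subset ht)
  have er : r = Set.indicator {x₀} fun _ => (F.ref {x₀})⁻¹ := by
    ext x
    by_cases hx : x = x₀
    · rw [hx, hr x₀ hx₀]; simp
    · rw [hr' x fun h => hx (EReal.coe_eq_coe_iff.1 (h.trans hx₀.symm))]
      simp [hx]
  have hm : Measurable r := by
    rw [er]; exact measurable_const.indicator (measurableSet_singleton _)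
  have := withDensity_mul F.lam F.measurable_h.coe_nnreal_ennreal hm
  refine this.trans ?_
  change F.ref.withDensity r = _
  rw [er, withDensity_indicator (measurableSet_singleton _), withDensity_const,
    Measure.restrict_singleton, smul_smul, ENNReal.inv_mul_cancel h0 htop, one_smul]

lemma law_cases {θ : EReal} (hθ : θ ∈ F.Θ) : (∃ t ∈ F.realParam, θ = (t : EReal)) ∨
    ∃ x₀ : ℝ, x₀ ∉ innerCore F.ref ∧ F.law θ = Measure.dirac x₀ := by
  rcases F.subset_extNaturalSpace hθ with ⟨t, rfl, ht⟩ | ⟨rfl, x₀, hx₀, h0⟩ | ⟨rfl, x₀, hx₀, h0⟩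
  · exact Or.inl ⟨t, hθ, rfl⟩
  · refine Or.inr ⟨x₀, fun h => ?_, withDensity_atom hx₀ h0 (fun x hx => ?_) fun x hx => ?_⟩
    · exact (lowerEnd_lt_iff.2 h.1).ne' hx₀
    · exact (if_pos rfl).trans (if_pos hx)
    · exact (if_pos rfl).trans (if_neg hx)
  · refine Or.inr ⟨x₀, fun h => ?_, withDensity_atom hx₀ h0 (fun x hx => ?_) fun x hx => ?_⟩
    · exact (lt_upperEnd_iff.2 h.2).ne hx₀
    · exact (if_neg (by simp)).trans ((if_pos rfl).trans (if_pos hx))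
    · exact (if_neg (by simp)).trans ((if_pos rfl).trans (if_neg hx))

lemma exists_of_hasMean {θ : EReal} (hθ : θ ∈ F.Θ) {w : ℝ} (hw : w ∈ innerCore F.ref)
    (hm : F.HasMean θ w) : ∃ t ∈ F.realParam, θ = (t : EReal) ∧
      Integrable id (F.ref.tilted fun x => t * x) ∧ ∫ x, x ∂(F.ref.tilted fun x => t * x) = w := by
  rcases law_cases hθ with ⟨t, ht, rfl⟩ | ⟨x₀, hx₀, hl⟩
  · rw [HasMean, law_coe ht] at hm
    exact ⟨t, ht, rfl, hm⟩
  · rw [HasMean, hl, integral_dirac] at hm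
    exact absurd (hm.2 ▸ hw) hx₀

/-- With maximal mean-value parameter space, members with inner means have interior parameters. -/
lemma mem_interior_of_hasMean (hmax : F.HasMaximalMeanSpace) {θ : EReal} (hθ : θ ∈ F.Θ) {w : ℝ}
    (hw : w ∈ innerCore F.ref) (hm : F.HasMean θ w) : ∃ t ∈ F.realParam, θ = (t : EReal) ∧
      t ∈ interior (integrableExpSet id F.ref) ∧ deriv (cgf id F.ref) t = w := by
  obtain ⟨t, ht, rfl, hi, hwt⟩ := exists_of_hasMean hθ hw hm
  have hex : ∀ v ∈ innerCore F.ref, ∃ s ∈ F.realParam,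
      Integrable id (F.ref.tilted fun x => s * x) ∧ ∫ x, x ∂(F.ref.tilted fun x => s * x) = v := by
    intro v hv
    have hv' : v ∈ F.meanSpace := by rw [hmax]; exact innerCore_subset_convexCore hv
    obtain ⟨θ, hθ, hm⟩ := hv'
    obtain ⟨s, hs, -, h⟩ := exists_of_hasMean hθ hv hm
    exact ⟨s, hs, h⟩
  obtain ⟨ε, hε, hball⟩ := Metric.isOpen_iff.1 isOpen_innerCore w hw
  have hlt : ∀ s r v u, s ∈ F.realParam → r ∈ F.realParam →
      Integrable id (F.ref.tilted fun x => s * x) → Integrable id (F.ref.tilted fun x => r * x) →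
      ∫ x, x ∂(F.ref.tilted fun x => s * x) = v → ∫ x, x ∂(F.ref.tilted fun x => r * x) = u →
      v < u → s < r := by
    intro s r v u hs hr his hir hv hu hvu
    have g1 := sub_mul_mean_le (F.realParam_subset hr) (F.realParam_subset hs) his hv
    have g2 := sub_mul_mean_le (F.realParam_subset hs) (F.realParam_subset hr) hir hu
    rcases lt_trichotomy s r with h | rfl | h
    · exact h
    · exact absurd (hv.symm.trans hu) hvu.ne
    · nlinarith
  -- By maximality the means w ± ε/2 are attained as well. Parameters are ordered like their means,
  -- so t lies strictly between two parameters of the convex natural parameter set.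
  obtain ⟨s₁, hs₁, hi₁, hv₁⟩ := hex (w - ε / 2) (hball (by
    rw [Metric.mem_ball, Real.dist_eq, abs_lt]; constructor <;> linarith))
  obtain ⟨s₂, hs₂, hi₂, hv₂⟩ := hex (w + ε / 2) (hball (by
    rw [Metric.mem_ball, Real.dist_eq, abs_lt]; constructor <;> linarith))
  have l₁ := hlt _ _ _ _ hs₁ ht hi₁ hi hv₁ hwt (by linarith)
  have l₂ := hlt _ _ _ _ ht hs₂ hi hi₂ hwt hv₂ (by linarith)
  have hsub : Set.Ioo s₁ s₂ ⊆ integrableExpSet id F.ref := fun r hr =>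
    convex_integrableExpSet.ordConnected.out (F.realParam_subset hs₁) (F.realParam_subset hs₂)
      ⟨hr.1.le, hr.2.le⟩
  have htI : t ∈ interior (integrableExpSet id F.ref) :=
    interior_maximal hsub isOpen_Ioo ⟨l₁, l₂⟩
  exact ⟨t, ht, rfl, htI, (integral_tilt htI).symm.trans hwt⟩

lemma exists_param_of_mem_innerCore (hmax : F.HasMaximalMeanSpace) {w : ℝ}
    (hw : w ∈ innerCore F.ref) : ∃ t ∈ F.realParam,
      t ∈ interior (integrableExpSet id F.ref) ∧ deriv (cgf id F.ref) t = w := by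
  have hw' : w ∈ F.meanSpace := by rw [hmax]; exact innerCore_subset_convexCore hw
  obtain ⟨θ, hθ, hm⟩ := hw'
  obtain ⟨t, ht, -, h⟩ := mem_interior_of_hasMean hmax hθ hw hm
  exact ⟨t, ht, h⟩

/-- At an inner point the maximum likelihood member for the single outcome a bounds all densities;
at an atom, density times mass is a probability. -/
lemma exists_relDensity_le (hmax : F.HasMaximalMeanSpace) {a : ℝ}
    (ha : a ∈ innerCore F.ref ∨ F.ref {a} ≠ 0) :
    ∃ C : ℝ≥0∞, C ≠ ∞ ∧ ∀ θ ∈ F.Θ, relDensity F.ref θ a ≤ C := by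
  rcases ha with ha | ha
  · obtain ⟨τ, hτ, hτI, hτa⟩ := exists_param_of_mem_innerCore hmax ha
    refine ⟨ENNReal.ofReal (Real.exp (τ * a - cgf id F.ref τ)), ENNReal.ofReal_ne_top,
      fun θ hθ => ?_⟩
    induction θ with
    | bot => simp [relDensity, (lowerEnd_lt_iff.2 ha.1).ne']
    | top => simp [relDensity, (lt_upperEnd_iff.2 ha.2).ne]
    | coe t =>
      rw [relDensity_coe]
      refine ENNReal.ofReal_le_ofReal (Real.exp_le_exp.2 ?_)
      have := gibbs (F.realParam_subset hθ) hτI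
      rw [hτa] at this
      linarith
  · refine ⟨(F.ref {a})⁻¹, ENNReal.inv_ne_top.2 ha, fun θ hθ => ?_⟩
    induction θ with
    | bot => simp only [relDensity, if_true]; split_ifs <;> simp
    | top => simp only [relDensity]; split_ifs <;> simp
    | coe t =>
      rw [relDensity_coe, ENNReal.le_inv_iff_mul_le]
      exact mul_le_mul_cgf_atom (F.realParam_subset hθ)

lemma ae_goodPoint (hmax : F.HasMaximalMeanSpace) : ∀ᵐ a ∂F.ref, F.GoodPoint a := by
  have h1 : ∀ᵐ a ∂F.ref, a ∈ F.X :=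
    (withDensity_absolutelyContinuous _ _).ae_le (measure_eq_zero_iff_ae_notMem.1 F.lam_compl_X |>.mono
      fun a ha => not_not.1 ha)
  have h2 : ∀ᵐ a ∂F.ref, F.h a ≠ 0 := by
    rw [ref, ae_withDensity_iff F.measurable_h.coe_nnreal_ennreal]
    exact ae_of_all _ fun a ha => by simpa using ha
  filter_upwards [h1, h2, ae_mem_innerCore_or_atom (ν := F.ref)] with a ha1 ha2 ha3
  obtain ⟨C, hC, h⟩ := exists_relDensity_le hmax ha3
  refine ⟨ha1, ha2, ne_top_of_le_ne_top (ENNReal.mul_ne_top (ENNReal.coe_ne_top (r := F.h a)) hC)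
    (iSup₂_le fun θ hθ => ?_)⟩
  rw [density]
  gcongr
  exact h θ hθ

lemma variance_eq_zero_of_ae_eq {P : Measure ℝ} [IsProbabilityMeasure P] {c : ℝ}
    (h : ∀ᵐ x ∂P, x = c) : variance id P = 0 := by
  have h' : (id : ℝ → ℝ) =ᵐ[P] fun _ => c := h
  rw [variance_congr h']
  simp [variance_eq_integral (aemeasurable_const (b := c))]

/-- If w is not inner, x - w has constant sign ν-almost everywhere; a member with mean w must then
be concentrated at w. -/
lemma variance_law_eq_zero {θ : EReal} (hθ : θ ∈ F.Θ) {w : ℝ} (hw : w ∉ innerCore F.ref)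
    (hm : F.HasMean θ w) : variance id (F.law θ) = 0 := by
  rcases law_cases hθ with ⟨t, ht, rfl⟩ | ⟨x₀, hx₀, hl⟩
  · have := isProbabilityMeasure_tilt (F.realParam_subset ht)
    rw [HasMean, law_coe ht] at hm
    rw [law_coe ht]
    obtain ⟨σ, hσ, hae⟩ := exists_side_of_notMem_innerCore hw
    have hae' : ∀ᵐ x ∂(F.ref.tilted fun x => t * x), 0 ≤ σ * (x - w) :=
      (tilted_absolutelyContinuous _ _).ae_le hae
    have hi : Integrable (fun x : ℝ => x) (F.ref.tilted fun x => t * x) := hm.1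
    have h0 : ∫ x, σ * (x - w) ∂(F.ref.tilted fun x => t * x) = 0 := by
      rw [integral_const_mul, integral_sub hi (integrable_const _), hm.2]
      simp
    rw [integral_eq_zero_iff_of_nonneg_ae hae' ((hi.sub (integrable_const w)).const_mul σ)] at h0
    refine variance_eq_zero_of_ae_eq (c := w) ?_
    filter_upwards [h0] with x hx
    have hσ0 : σ ≠ 0 := by rcases hσ with rfl | rfl <;> norm_num
    exact sub_eq_zero.1 ((mul_eq_zero.1 hx).resolve_left hσ0)
  · rw [hl]
    exact variance_eq_zero_of_ae_eq (c := x₀) (by rw [ae_dirac_eq]; rfl)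

lemma varianceFunction_spec {w : ℝ} (hw : w ∈ F.meanSpace) :
    ∃ θ ∈ F.Θ, F.HasMean θ w ∧ F.varianceFunction w = variance id (F.law θ) := by
  have hw' : ∃ θ ∈ F.Θ, F.HasMean θ w := hw
  exact ⟨hw'.choose, hw'.choose_spec.1, hw'.choose_spec.2, dif_pos hw'⟩

lemma exists_varianceFunction_eq (hmax : F.HasMaximalMeanSpace) {w : ℝ}
    (hw : w ∈ innerCore F.ref) : ∃ t ∈ innerParam F.ref, deriv (cgf id F.ref) t = w ∧
      F.varianceFunction w = iteratedDeriv 2 (cgf id F.ref) t := by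
  have hw' : w ∈ F.meanSpace := by rw [hmax]; exact innerCore_subset_convexCore hw
  obtain ⟨θ, hθ, hm, hv⟩ := varianceFunction_spec hw'
  obtain ⟨t, ht, rfl, htI, htw⟩ := mem_interior_of_hasMean hmax hθ hw hm
  exact ⟨t, ⟨htI, htw ▸ hw⟩, htw, by rw [hv, law_coe ht, variance_tilt htI]⟩

/-- A continuous formula for the variance function on inner means extends to all means. -/
lemma varianceFunction_eq_of_boundary (hmax : F.HasMaximalMeanSpace) {g : ℝ → ℝ}
    (hg : Continuous g) (hne : (innerCore F.ref).Nonempty)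
    (h : ∀ t ∈ innerParam F.ref, iteratedDeriv 2 (cgf id F.ref) t = g (deriv (cgf id F.ref) t))
    {w : ℝ} (hw : w ∈ F.meanSpace) : F.varianceFunction w = g w := by
  by_cases hwi : w ∈ innerCore F.ref
  · obtain ⟨t, ht, rfl, hv⟩ := exists_varianceFunction_eq hmax hwi
    rw [hv, h t ht]
  · obtain ⟨θ, hθ, hm, hv⟩ := varianceFunction_spec hw
    rw [hv, variance_law_eq_zero hθ hwi hm]
    obtain ⟨u, hu⟩ := hne
    obtain ⟨t, ht, -⟩ := exists_varianceFunction_eq hmax hu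
    obtain ⟨σ, hσ, hae⟩ := exists_side_of_notMem_innerCore hwi
    rw [hmax] at hw
    obtain ⟨s, hs, hs1, hs2⟩ := exists_tendsto_boundary hσ hae (atom_of_mem_convexCore hw hwi) ht
    refine tendsto_nhds_unique (hs2.congr fun n => h _ (hs n)) ((hg.tendsto w).comp hs1)

/-- An affine function that is nonnegative at inner means is nonnegative at all means. -/
lemma nonneg_of_boundary (hmax : F.HasMaximalMeanSpace) {g : ℝ → ℝ}
    (hg : Continuous g) (hne : (innerCore F.ref).Nonempty)
    (h : ∀ t ∈ innerParam F.ref, 0 ≤ g (deriv (cgf id F.ref) t))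
    {w : ℝ} (hw : w ∈ F.meanSpace) : 0 ≤ g w := by
  by_cases hwi : w ∈ innerCore F.ref
  · obtain ⟨t, ht, rfl, hv⟩ := exists_varianceFunction_eq hmax hwi
    exact h t ht
  · obtain ⟨u, hu⟩ := hne
    obtain ⟨t, ht, -⟩ := exists_varianceFunction_eq hmax hu
    obtain ⟨σ, hσ, hae⟩ := exists_side_of_notMem_innerCore hwi
    rw [hmax] at hw
    obtain ⟨s, hs, hs1, -⟩ := exists_tendsto_boundary hσ hae (atom_of_mem_convexCore hw hwi) ht
    exact ge_of_tendsto' ((hg.tendsto w).comp hs1) fun n => h _ (hs n)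

/-- The variance function of an SNML exchangeable family with maximal mean-value parameter space
is the square or the power `3/2` of an affine function. -/
theorem exists_varianceFunction_form (hmax : F.HasMaximalMeanSpace)
    (hex : F.SNMLExchangeable) :
    ∃ k l : ℝ,
      (∀ μ ∈ F.meanSpace, F.varianceFunction μ = (k * μ + l) ^ 2) ∨
      (∀ μ ∈ F.meanSpace,
        0 ≤ k * μ + l ∧ F.varianceFunction μ = (k * μ + l) ^ (3 / 2 : ℝ)) := by
  rcases (SNML.innerCore F.ref).eq_empty_or_nonempty with he | hne
  · refine ⟨0, 0, Or.inl fun μ hμ => ?_⟩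
    obtain ⟨θ, hθ, hm, hv⟩ := varianceFunction_spec hμ
    rw [hv, variance_law_eq_zero hθ (by simp [he]) hm]
    norm_num
  obtain ⟨m, ⟨hm, -⟩, hex⟩ := hex
  have hgrid : ∀ u ∈ innerCore F.ref, ∀ v ∈ innerCore F.ref, ∃ a b, a < u ∧ a < v ∧ u < b ∧
      v < b ∧ ∫⁻ y, profile (cgf id F.ref) F.realParam (m + 1) (m * a + y) ∂F.ref ≠ ∞ ∧
      ∫⁻ y, profile (cgf id F.ref) F.realParam (m + 1) (m * b + y) ∂F.ref ≠ ∞ ∧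
      GridInvariant F.ref F.realParam m a b := by
    intro u hu v hv
    have hmin : min u v ∈ innerCore F.ref := by
      rcases min_choice u v with h | h <;> rw [h] <;> assumption
    have hmax' : max u v ∈ innerCore F.ref := by
      rcases max_choice u v with h | h <;> rw [h] <;> assumption
    -- Positive mass below an inner point and goodness of almost every point yield a good point
    -- there.
    obtain ⟨a, hau, ha⟩ := ((frequently_ae_iff (p := fun x => x < min u v)).2
      hmin.1 |>.and_eventually (ae_goodPoint hmax)).exists
    obtain ⟨b, hbu, hb⟩ := ((frequently_ae_iff (p := fun x => max u v < x)).2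
      hmax'.2 |>.and_eventually (ae_goodPoint hmax)).exists
    obtain ⟨h1, h2⟩ := lt_min_iff.1 hau
    obtain ⟨h3, h4⟩ := max_lt_iff.1 hbu
    exact ⟨a, b, h1, h2, h3, h4, lintegral_profile_ne_top hm ha, lintegral_profile_ne_top hm hb,
      gridInvariant hm hex ha hb (h1.trans h3).ne⟩
  obtain ⟨c, l, h | h⟩ := variance_form_of_gridInvariant F.realParam_subset
    (fun v hv => exists_param_of_mem_innerCore hmax hv) hgrid
  · exact ⟨c, l, Or.inl fun μ hμ => varianceFunction_eq_of_boundary hmax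
      (g := fun μ => (c * μ + l) ^ 2) (by fun_prop) hne h hμ⟩
  · refine ⟨c, l, Or.inr fun μ hμ => ⟨nonneg_of_boundary hmax (g := fun μ => c * μ + l)
      (by fun_prop) hne (fun t ht => (h t ht).1) hμ, varianceFunction_eq_of_boundary hmax
      (g := fun μ => (c * μ + l) ^ (3 / 2 : ℝ)) ?_ hne (fun t ht => (h t ht).2) hμ⟩⟩
    exact (Real.continuous_rpow_const (by norm_num)).comp (by fun_prop)

end NaturalExpFamily
end SNML

end

theorem theorem2 (F : SNML.NaturalExpFamily) (hmax : F.HasMaximalMeanSpace)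
    (hex : F.SNMLExchangeable) :
    ∃ k l : ℝ,
      (∀ μ ∈ F.meanSpace, F.varianceFunction μ = (k * μ + l) ^ 2) ∨
      (∀ μ ∈ F.meanSpace,
        0 ≤ k * μ + l ∧ F.varianceFunction μ = (k * μ + l) ^ (3 / 2 : ℝ)) :=
  F.exists_varianceFunction_form hmax hex
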